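/- **Proposition 2.5 (Basic Poincaré Lemma).** Let $M$ be a compact smooth Riemannian manifold without boundary, with a smooth foliation $\mathcal F$ all of whose leaves are closed subsets of $M$, and suppose that the metric is bundle-like for $\mathcal F$, i.e. the metric it induces on the normal bundle of $\mathcal F$ is invariant under holonomy (so $\mathcal F$ is a Riemannian foliation). For an open set $U\subseteq M$, a smooth differential form $\omega$ on $U$ is called basic if $i(X)\omega=0$ and $i(X)(d\omega)=0$ for every vector field $X$ tangent to the leaves. Let $L$ be a leaf, and for $\varepsilon>0$ let $U_\varepsilon$ be the set of points of $M$ at distance less than $\varepsilon$ from $L$. Then there is $\varepsilon_0>0$ such that for all $0<\varepsilon<\varepsilon_0$ and all $k>0$, every closed basic $k$-form $\omega$ on $U_\varepsilon$ is exact in the complex of basic forms: there is a basic $(k-1)$-form $\mu$ on $U_\varepsilon$ with $d\mu=\omega$. -/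

import Mathlib

open Bundle
open scoped Manifold ContDiff Topology

noncomputable section

/-- Euclidean space `ℝ^d`. -/
abbrev Euc (d : ℕ) : Type := EuclideanSpace ℝ (Fin d)

/-- A smooth foliation of dimension `p` and codimension `q` of the `n`-manifold `M`, given by an
atlas of smooth foliated charts `φ : M ⊇ source → ℝ^p × ℝ^q` (diffeomorphisms between open sets)
whose transition maps have, locally, the form `(x, y) ↦ (h (x, y), g y)`. -/
structure SmoothFoliation (n p q : ℕ) (M : Type*) [TopologicalSpace M]
    [ChartedSpace (Euc n) M] where
  /-- the foliated charts -/
  charts : Set (OpenPartialHomeomorph M (Euc p × Euc q))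
  covers : ∀ x : M, ∃ φ ∈ charts, x ∈ φ.source
  smooth : ∀ φ ∈ charts, ContMDiffOn (𝓡 n) 𝓘(ℝ, Euc p × Euc q) ∞ φ φ.source
  smooth_symm : ∀ φ ∈ charts, ContMDiffOn 𝓘(ℝ, Euc p × Euc q) (𝓡 n) ∞ φ.symm φ.target
  compat : ∀ φ ∈ charts, ∀ ψ ∈ charts, ∀ z ∈ (φ.symm.trans ψ).source,
    ∃ g : Euc q → Euc q, ∀ᶠ w in 𝓝 z, (ψ (φ.symm w)).2 = g w.2

namespace SmoothFoliation

variable {n p q : ℕ} {M : Type*} [TopologicalSpace M] [ChartedSpace (Euc n) M]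

/-- The plaque of the foliated chart `φ` through `x`: the connected component containing `x` of the
level set in `φ.source` of the transverse coordinate. -/
def plaque (φ : OpenPartialHomeomorph M (Euc p × Euc q)) (x : M) : Set M :=
  connectedComponentIn {y | y ∈ φ.source ∧ (φ y).2 = (φ x).2} x

/-- The leaf through `x`: all points that can be joined to `x` by a finite chain of plaques. -/
def leaf (F : SmoothFoliation n p q M) (x : M) : Set M :=
  {y | Relation.ReflTransGen (fun a b => ∃ φ ∈ F.charts, a ∈ φ.source ∧ b ∈ plaque φ a) x y}

/-- The differential at `x` of the transverse coordinate `y ↦ (φ y).2` of a foliated chart. -/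
def transverseDeriv (φ : OpenPartialHomeomorph M (Euc p × Euc q)) (x : M) :
    TangentSpace (𝓡 n) x →L[ℝ] Euc q :=
  mfderiv (𝓡 n) 𝓘(ℝ, Euc q) (fun y => (φ y).2) x

/-- The tangent space at `x` of the leaf through `x`: the vectors killed by the differential of the
transverse coordinate of the foliated charts around `x`. -/
def tangent (F : SmoothFoliation n p q M) (x : M) : Submodule ℝ (TangentSpace (𝓡 n) x) where
  carrier := {v | ∀ φ ∈ F.charts, x ∈ φ.source → transverseDeriv φ x v = 0}
  zero_mem' := fun φ _ _ => map_zero (transverseDeriv φ x)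
  add_mem' := fun {v w} hv hw φ hφ hx => by
    rw [map_add (transverseDeriv φ x), hv φ hφ hx, hw φ hφ hx, add_zero]
  smul_mem' := fun c v hv φ hφ hx => by
    rw [map_smul (transverseDeriv φ x), hv φ hφ hx, smul_zero]

/-- The Riemannian metric of `M` is bundle-like for `F`: the metric induced on the normal bundle is
invariant under holonomy, i.e. in every foliated chart, two vectors orthogonal to the leaves, based
at points of one plaque and with the same transverse projection, have the same length. (The same
then holds for inner products, by polarization.) -/
def IsBundleLike (F : SmoothFoliation n p q M)
    [RiemannianBundle (fun x : M => TangentSpace (𝓡 n) x)] : Prop :=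
  ∀ φ ∈ F.charts, ∀ a ∈ φ.source, ∀ b ∈ plaque φ a,
    ∀ v : TangentSpace (𝓡 n) a, ∀ w : TangentSpace (𝓡 n) b,
      (∀ t ∈ F.tangent a, inner ℝ t v = 0) → (∀ t ∈ F.tangent b, inner ℝ t w = 0) →
      transverseDeriv φ a v = transverseDeriv φ b w → ‖v‖ = ‖w‖

end SmoothFoliation

section Forms

variable {n : ℕ} {M : Type*} [TopologicalSpace M] [ChartedSpace (Euc n) M]

/-- A (not necessarily smooth) field of alternating `k`-forms on the tangent spaces of `M`. A form
on an open set `U` is represented by its values at the points of `U`; the values elsewhere are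
irrelevant. -/
abbrev FormField (n : ℕ) (M : Type*) [TopologicalSpace M] [ChartedSpace (Euc n) M] (k : ℕ) :
    Type _ :=
  ∀ x : M, (TangentSpace (𝓡 n) x) [⋀^Fin k]→L[ℝ] ℝ

/-- The expression of `η` in the preferred chart around `x₀`: the pullback of `η` by the inverse
of that chart. -/
def FormField.inChart {k : ℕ} (η : FormField n M k) (x₀ : M) :
    Euc n → (Euc n) [⋀^Fin k]→L[ℝ] ℝ :=
  fun z => (η ((extChartAt (𝓡 n) x₀).symm z)).compContinuousLinearMap
    (mfderiv 𝓘(ℝ, Euc n) (𝓡 n) (extChartAt (𝓡 n) x₀).symm z)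

/-- `η` is a smooth form on the open set `U`: its expressions in charts are smooth. -/
def FormField.SmoothOn {k : ℕ} (η : FormField n M k) (U : Set M) : Prop :=
  ∀ x₀ : M, ContDiffOn ℝ ∞ (η.inChart x₀)
    ((extChartAt (𝓡 n) x₀).target ∩ (extChartAt (𝓡 n) x₀).symm ⁻¹' U)

/-- The exterior derivative, computed at `x` in the preferred chart around `x` (for smooth forms
any other smooth chart gives the same value). -/
def FormField.extD {k : ℕ} (η : FormField n M k) : FormField n M (k + 1) :=
  fun x => (extDeriv (η.inChart x) (extChartAt (𝓡 n) x x)).compContinuousLinearMap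
    (mfderiv (𝓡 n) 𝓘(ℝ, Euc n) (extChartAt (𝓡 n) x) x)

/-- `i(X) η = 0` at `x` for all `X` tangent to the leaves: `η` vanishes as soon as one of its
arguments is tangent to the leaf. (No condition for `k = 0`.) -/
def FormField.HorizontalAt {k p q : ℕ} (η : FormField n M k) (F : SmoothFoliation n p q M)
    (x : M) : Prop :=
  ∀ (v : Fin k → TangentSpace (𝓡 n) x) (i : Fin k), v i ∈ F.tangent x → η x v = 0

/-- `η` is a basic form on the open set `U`: it is smooth on `U`, and `i(X) η = 0` and
`i(X) (dη) = 0` on `U` for all `X` tangent to the leaves. -/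
def FormField.IsBasicOn {k p q : ℕ} (η : FormField n M k) (F : SmoothFoliation n p q M)
    (U : Set M) : Prop :=
  η.SmoothOn U ∧ ∀ x ∈ U, η.HorizontalAt F x ∧ η.extD.HorizontalAt F x

end Forms

end

/-! A tube around a closed leaf contracts onto it along geodesics orthogonal to the leaf; for a
bundle-like metric the contraction respects the foliation, and integrating a closed basic form along
it gives a basic primitive. The proof carries this out in charts: only the transverse coordinates
and the radial segments in them are used, and local primitives are glued.

A closed leaf `L` meets a small transversal in a compact countable set, which has an isolated point
by Baire's theorem; hence `L` is locally a single level of the transverse coordinate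
(`isTransverselyIsolatedAt_leaf`). The metric on vectors orthogonal to the leaves descends to a
Riemannian metric on the transverse ball of a chart. In normal coordinates for it, centred at `L`,
the Gauss lemma says that the lift of the radial field is the gradient of half the squared norm `h y
y` of the transverse coordinate `y` (`exists_isNormalChart`). Comparing lengths of curves, `√(h y
y)` is the distance to `L` near `L` (`eventually_infEDist_eq`). The normal coordinates come from an
exponential map obtained by the inverse function theorem in a space of curves
(`exists_exponential_of_spray`).

The distance to `L` does not depend on the chart, so neither does the gradient of its square, and
transitions preserve the transverse radial field. By Euler's equation they commute with `y ↦ s • y`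
(`transition_euler`).

A closed basic `(k + 1)`-form is locally the pullback of a closed form `α` on the transverse ball
(`apply_eq_transversalForm`), and `∫₀¹ s ^ k • α (s • y) (y, ·, …, ·) ds` is a primitive of `α`
(`extDeriv_radialPrimitive`). Its pullback is basic, and the pullbacks from two charts agree at
points whose radial segments lie in both (`tubularPrimitive_eq`). Compactness of `L` gives a tube on
which this holds for a finite family of charts, and the local primitives define `μ`. -/

noncomputable section

/-! ### Smoothness of composition operators on spaces of continuous maps -/

section Superposition

set_option synthInstance.maxHeartbeats 400000
set_option maxHeartbeats 1000000

/-- Pointwise application of a continuous family of operators to a continuous map. -/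
def ContinuousMap.applyFamily (K : Type*) [TopologicalSpace K] [CompactSpace K]
    (V W : Type*) [NormedAddCommGroup V] [NormedSpace ℝ V]
    [NormedAddCommGroup W] [NormedSpace ℝ W] :
    C(K, V →L[ℝ] W) →L[ℝ] C(K, V) →L[ℝ] C(K, W) :=
  LinearMap.mkContinuous₂
    (LinearMap.mk₂ ℝ (fun (A : C(K, V →L[ℝ] W)) (y : C(K, V)) => (⟨fun t => A t (y t), by fun_prop⟩ : C(K, W)))
      (fun A B y => by ext t; simp) (fun c A y => by ext t; simp)
      (fun A x y => by ext t; simp) (fun c A y => by ext t; simp)) 1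
    (fun A y => by
      rw [ContinuousMap.norm_le _ (by positivity)]
      intro t
      rw [one_mul]
      exact ((A t).le_opNorm _).trans (mul_le_mul (A.norm_coe_le_norm t) (y.norm_coe_le_norm t)
        (norm_nonneg _) ((norm_nonneg _).trans (A.norm_coe_le_norm t))))

variable {K : Type*} [TopologicalSpace K] [CompactSpace K]

@[simp]
theorem ContinuousMap.applyFamily_apply {V W : Type*} [NormedAddCommGroup V] [NormedSpace ℝ V]
    [NormedAddCommGroup W] [NormedSpace ℝ W] (A : C(K, V →L[ℝ] W)) (y : C(K, V)) (t : K) :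
    ContinuousMap.applyFamily K V W A y t = A t (y t) := rfl

/-- The mean value inequality is applied at each `t`. What makes the estimate uniform is the
continuity of `y ↦ f'.comp y` in the sup norm, which holds for any continuous `f'` because `K` is
compact. -/
theorem ContinuousMap.hasFDerivAt_postcomp {V W : Type*} [NormedAddCommGroup V] [NormedSpace ℝ V]
    [NormedAddCommGroup W] [NormedSpace ℝ W] (f : C(V, W)) (f' : C(V, V →L[ℝ] W))
    (hf : ∀ x, HasFDerivAt f (f' x) x) (y : C(K, V)) :
    HasFDerivAt (fun y : C(K, V) => f.comp y) (applyFamily K V W (f'.comp y)) y := by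
  rw [hasFDerivAt_iff_isLittleO_nhds_zero, Asymptotics.isLittleO_iff]
  intro c hc
  have hcont : Continuous fun y : C(K, V) => f'.comp y := f'.continuous_postcomp
  obtain ⟨r, hr, hball⟩ := Metric.nhds_basis_ball.mem_iff.1
    (hcont.continuousAt.preimage_mem_nhds (Metric.ball_mem_nhds (f'.comp y) hc))
  filter_upwards [Metric.ball_mem_nhds (0 : C(K, V)) hr] with d hd
  rw [mem_ball_zero_iff] at hd
  rw [ContinuousMap.norm_le _ (by positivity)]
  intro t
  have key := (convex_ball (y t) r).norm_image_sub_le_of_norm_hasFDerivWithin_le' (f := f)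
    (f' := f') (φ := f' (y t)) (C := c) (x := y t) (y := y t + d t)
    (fun x _ => (hf x).hasFDerivWithinAt) ?_ (Metric.mem_ball_self hr) ?_
  · simp only [add_sub_cancel_left] at key
    refine (le_of_eq ?_).trans (key.trans ?_)
    · simp
    · gcongr
      exact d.norm_coe_le_norm t
  · intro x hx
    -- A point `x` near `y t` is the value at `t` of a translate of the whole map `y`, and the
    -- translate is as close to `y` as `x` is to `y t`. This turns the bound on maps into a bound at
    -- `x`.
    have h1 := @hball (y + ContinuousMap.const K (x - y t)) (by
      rw [Metric.mem_ball, dist_eq_norm, add_sub_cancel_left]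
      rw [Metric.mem_ball, dist_eq_norm] at hx
      refine lt_of_le_of_lt ?_ hx
      rw [ContinuousMap.norm_le _ (norm_nonneg _)]
      intro s
      simp)
    have h2 := (ContinuousMap.dist_apply_le_dist t).trans (Metric.mem_ball.1 h1).le
    simpa [dist_eq_norm] using h2
  · rw [Metric.mem_ball, dist_eq_norm, add_sub_cancel_left]
    exact (d.norm_coe_le_norm t).trans_lt hd

/-- The derivative is again a composition operator, with `f'` in place of `f`, followed by the
continuous linear `applyFamily`; hence an induction in which the target `W` varies. -/
theorem ContinuousMap.contDiff_postcomp_nat {V : Type} [NormedAddCommGroup V]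
    [NormedSpace ℝ V] (m : ℕ) : ∀ {W : Type} [NormedAddCommGroup W] [NormedSpace ℝ W]
    (f : C(V, W)), ContDiff ℝ m f → ContDiff ℝ m (fun y : C(K, V) => f.comp y) := by
  induction m with
  | zero =>
    intro W _ _ f _
    exact contDiff_zero.2 f.continuous_postcomp
  | succ m ih =>
    intro W _ _ f hf
    obtain ⟨f', hf', hff'⟩ := contDiff_succ_iff_hasFDerivAt.1 hf
    refine contDiff_succ_iff_hasFDerivAt.2
      ⟨fun y => applyFamily K V W ((⟨f', hf'.continuous⟩ : C(V, V →L[ℝ] W)).comp y), ?_, ?_⟩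
    · exact (applyFamily K V W).contDiff.comp (ih ⟨f', hf'.continuous⟩ hf')
    · exact hasFDerivAt_postcomp f ⟨f', hf'.continuous⟩ hff'

theorem ContinuousMap.contDiff_postcomp {V W : Type} [NormedAddCommGroup V]
    [NormedSpace ℝ V] [NormedAddCommGroup W] [NormedSpace ℝ W]
    (f : C(V, W)) (hf : ContDiff ℝ ∞ f) : ContDiff ℝ ∞ (fun y : C(K, V) => f.comp y) :=
  contDiff_infty.2 fun m => contDiff_postcomp_nat m f (hf.of_le (by exact_mod_cast le_top))

end Superposition

/-! ### Cutoffs and extension of smooth functions -/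

section Cutoff

variable {V W : Type*} [NormedAddCommGroup V] [NormedSpace ℝ V] [FiniteDimensional ℝ V]
  [NormedAddCommGroup W] [NormedSpace ℝ W]

theorem exists_contDiff_cutoff {C O : Set V} (hC : IsClosed C) (hO : IsOpen O) (hCO : C ⊆ O) :
    ∃ χ : V → ℝ, ContDiff ℝ ∞ χ ∧ (∀ᶠ x in 𝓝ˢ C, χ x = 1) ∧ (∀ᶠ x in 𝓝ˢ Oᶜ, χ x = 0) := by
  obtain ⟨χ, h0, h1, -⟩ := exists_contMDiffMap_zero_one_nhds_of_isClosed 𝓘(ℝ, V) (n := ⊤)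
    hO.isClosed_compl hC (Set.disjoint_left.2 fun x hx hx' => hx (hCO hx'))
  exact ⟨χ, χ.contMDiff.contDiff, h1, h0⟩

omit [FiniteDimensional ℝ V] in
theorem ContDiffOn.cutoff_smul {f : V → W} {O : Set V} (hO : IsOpen O) (hf : ContDiffOn ℝ ∞ f O)
    {χ : V → ℝ} (hχ : ContDiff ℝ ∞ χ) (h0 : ∀ᶠ x in 𝓝ˢ Oᶜ, χ x = 0) :
    ContDiff ℝ ∞ (fun x => χ x • f x) := by
  rw [contDiff_iff_contDiffAt]
  intro x
  by_cases hx : x ∈ O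
  · exact hχ.contDiffAt.smul (hf.contDiffAt (hO.mem_nhds hx))
  · have : (fun x => χ x • f x) =ᶠ[𝓝 x] fun _ => 0 := by
      filter_upwards [Filter.Eventually.filter_mono (nhds_le_nhdsSet hx) h0] with z hz
      simp [hz]
    exact contDiffAt_const.congr_of_eventuallyEq this

theorem ContDiffOn.exists_contDiff_extension {f : V → W} {C O : Set V} (hO : IsOpen O)
    (hf : ContDiffOn ℝ ∞ f O) (hC : IsClosed C) (hCO : C ⊆ O) :
    ∃ g : V → W, ContDiff ℝ ∞ g ∧ ∀ᶠ x in 𝓝ˢ C, g x = f x := by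
  obtain ⟨χ, hχ, h1, h0⟩ := exists_contDiff_cutoff hC hO hCO
  exact ⟨fun x => χ x • f x, hf.cutoff_smul hO hχ h0, h1.mono fun x hx => by simp [hx]⟩

end Cutoff

/-! ### Integrals and rays as continuous linear maps -/

section IntervalIntegral

open MeasureTheory

/-- The integral over `[0, 1]` of a continuous function on the unit interval. -/
def unitIntervalIntegral (V : Type*) [NormedAddCommGroup V] [NormedSpace ℝ V] :
    C(unitInterval, V) →L[ℝ] V :=
  LinearMap.mkContinuous
    { toFun := fun y => ∫ s in (0 : ℝ)..1, y (Set.projIcc 0 1 zero_le_one s)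
      map_add' := fun x y => by
        rw [← intervalIntegral.integral_add]
        · rfl
        all_goals exact (Continuous.intervalIntegrable (by fun_prop) _ _)
      map_smul' := fun c y => by
        rw [RingHom.id_apply, ← intervalIntegral.integral_smul]; rfl } 1
    (fun y => by
      have := intervalIntegral.norm_integral_le_of_norm_le_const (a := 0) (b := 1) (C := ‖y‖)
        (f := fun s => y (Set.projIcc 0 1 zero_le_one s)) (fun s _ => y.norm_coe_le_norm _)
      simpa using this)

theorem unitIntervalIntegral_apply {V : Type*} [NormedAddCommGroup V] [NormedSpace ℝ V]
    (y : C(unitInterval, V)) :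
    unitIntervalIntegral V y = ∫ s in (0 : ℝ)..1, y (Set.projIcc 0 1 zero_le_one s) := rfl

/-- The curve `s ↦ s • v` on the unit interval, depending linearly on `v`. -/
def unitRay (V : Type*) [NormedAddCommGroup V] [NormedSpace ℝ V] :
    V →L[ℝ] C(unitInterval, V) :=
  LinearMap.mkContinuous
    { toFun := fun v => ⟨fun s => (s : ℝ) • v, by fun_prop⟩
      map_add' := fun x y => ContinuousMap.ext fun s => smul_add _ _ _
      map_smul' := fun c y => ContinuousMap.ext fun s => smul_comm _ _ _ } 1
    (fun v => by
      rw [ContinuousMap.norm_le _ (by positivity)]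
      intro s
      have h := abs_le.2 ⟨by linarith [s.2.1], s.2.2⟩
      simp only [LinearMap.coe_mk, AddHom.coe_mk, ContinuousMap.coe_mk, norm_smul,
        Real.norm_eq_abs, one_mul]
      exact mul_le_of_le_one_left (norm_nonneg _) h)

@[simp]
theorem unitRay_apply {V : Type*} [NormedAddCommGroup V] [NormedSpace ℝ V] (v : V)
    (s : unitInterval) : unitRay V v s = (s : ℝ) • v := rfl

end IntervalIntegral

/-! ### Smoothness of radial averages -/

section RadialIntegral

/-- The average `∫₀¹ s ^ k • f (s • y) ds` of `f` along the segment from `0` to `y`. -/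
def radialIntegral {V W : Type*} [NormedAddCommGroup V] [NormedSpace ℝ V]
    [NormedAddCommGroup W] [NormedSpace ℝ W] (k : ℕ) (f : V → W) (y : V) : W :=
  ∫ s in (0 : ℝ)..1, s ^ k • f (s • y)

/-- The continuous linear functional `g ↦ ∫₀¹ s ^ k • g s ds`. -/
def weightedIntegral (k : ℕ) (W : Type*) [NormedAddCommGroup W] [NormedSpace ℝ W] :
    C(unitInterval, W) →L[ℝ] W :=
  unitIntervalIntegral W ∘L ContinuousMap.applyFamily unitInterval W W
    ⟨fun s => (s : ℝ) ^ k • ContinuousLinearMap.id ℝ W, by fun_prop⟩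

theorem weightedIntegral_apply (k : ℕ) {W : Type*} [NormedAddCommGroup W] [NormedSpace ℝ W]
    (g : ℝ → W) (y : C(unitInterval, W)) (h : ∀ s : unitInterval, y s = g s) :
    weightedIntegral k W y = ∫ s in (0 : ℝ)..1, s ^ k • g s := by
  rw [weightedIntegral, ContinuousLinearMap.comp_apply, unitIntervalIntegral_apply]
  refine intervalIntegral.integral_congr fun s hs => ?_
  rw [Set.uIcc_of_le zero_le_one] at hs
  simp [Set.projIcc_of_mem zero_le_one hs, h]

variable {V W : Type} [NormedAddCommGroup V] [NormedSpace ℝ V] [FiniteDimensional ℝ V]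
  [NormedAddCommGroup W] [NormedSpace ℝ W]

omit [FiniteDimensional ℝ V] in
theorem radialIntegral_eq_weightedIntegral (k : ℕ) (f : C(V, W)) (y : V) :
    radialIntegral k f y = weightedIntegral k W (f.comp (unitRay V y)) :=
  (weightedIntegral_apply k (fun s => f (s • y)) _ fun _ => rfl).symm

-- The average factors as ray, composition with `f`, weighted integral: linear, smooth, linear.
-- Differentiation under the integral sign is contained in the smoothness of composition operators.
omit [FiniteDimensional ℝ V] in
theorem ContDiff.radialIntegral (k : ℕ) {f : V → W} (hf : ContDiff ℝ ∞ f) :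
    ContDiff ℝ ∞ (radialIntegral k f) := by
  have h : _root_.radialIntegral k f = fun y => weightedIntegral k W
      ((⟨f, hf.continuous⟩ : C(V, W)).comp (unitRay V y)) :=
    funext fun y => radialIntegral_eq_weightedIntegral k ⟨f, hf.continuous⟩ y
  rw [h]
  exact (weightedIntegral k W).contDiff.comp
    ((ContinuousMap.contDiff_postcomp ⟨f, hf.continuous⟩ hf).comp (unitRay V).contDiff)

omit [FiniteDimensional ℝ V] in
theorem ContDiff.fderiv_radialIntegral (k : ℕ) {f : V → W} (hf : ContDiff ℝ ∞ f) (y w : V) :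
    fderiv ℝ (_root_.radialIntegral k f) y w =
      ∫ s in (0 : ℝ)..1, s ^ k • fderiv ℝ f (s • y) (s • w) := by
  have hf' : ContDiff ℝ ∞ (fderiv ℝ f) := hf.fderiv_right (by simp)
  have h : _root_.radialIntegral k f = fun y => weightedIntegral k W
      ((⟨f, hf.continuous⟩ : C(V, W)).comp (unitRay V y)) :=
    funext fun y => radialIntegral_eq_weightedIntegral k ⟨f, hf.continuous⟩ y
  have h1 := ContinuousMap.hasFDerivAt_postcomp (⟨f, hf.continuous⟩ : C(V, W))
    ⟨fderiv ℝ f, hf'.continuous⟩ (fun x => (hf.differentiable (by simp) x).hasFDerivAt)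
    (unitRay V y)
  have h2 := h1.comp y (unitRay V).hasFDerivAt
  have h3 := (weightedIntegral k W).hasFDerivAt.comp y h2
  have h4 := h3.congr_of_eventuallyEq (Filter.Eventually.of_forall fun y => congrFun h y)
  rw [h4.fderiv]
  exact weightedIntegral_apply k (fun s => fderiv ℝ f (s • y) (s • w)) _ fun _ => rfl

/-- Reduces functions on a star-shaped open set to global ones: the segment from `0` to `y` is
compact, so a cutoff of `f` agrees with `f` near it, hence near the segments to all points close to
`y`. -/
theorem exists_contDiff_eventually_eq_on_segment {O : Set V} (hO : IsOpen O)
    (hstar : StarConvex ℝ 0 O) {f : V → W} (hf : ContDiffOn ℝ ∞ f O) {y : V} (hy : y ∈ O) :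
    ∃ g : V → W, ContDiff ℝ ∞ g ∧ ∀ᶠ z in 𝓝 y, ∀ s ∈ Set.Icc (0 : ℝ) 1,
      ∀ᶠ w in 𝓝 (s • z), g w = f w := by
  have hC : IsCompact (Set.range (unitRay V y)) := isCompact_range (unitRay V y).continuous
  have hCO : Set.range (unitRay V y) ⊆ O := by
    rintro _ ⟨s, rfl⟩
    exact hstar.smul_mem hy s.2.1 s.2.2
  obtain ⟨g, hg, hgf⟩ := hf.exists_contDiff_extension hO hC.isClosed hCO
  obtain ⟨N, hN, hCN, hNg⟩ := eventually_nhdsSet_iff_exists.1 hgf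
  refine ⟨g, hg, ?_⟩
  have h1 : ∀ᶠ z in 𝓝 y, Set.MapsTo (unitRay V z) Set.univ N :=
    (unitRay V).continuous.continuousAt.eventually
      (ContinuousMap.eventually_mapsTo isCompact_univ hN
        fun s _ => hCN (Set.mem_range_self s))
  filter_upwards [h1] with z hz s hs
  filter_upwards [hN.mem_nhds (hz (Set.mem_univ ⟨s, hs⟩))] with w hw using hNg w hw

omit [FiniteDimensional ℝ V] in
theorem radialIntegral_congr_on_segment (k : ℕ) {f g : V → W} {y : V}
    (h : ∀ s ∈ Set.Icc (0 : ℝ) 1, ∀ᶠ w in 𝓝 (s • y), g w = f w) :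
    radialIntegral k f y = radialIntegral k g y := by
  refine intervalIntegral.integral_congr fun s hs => ?_
  rw [Set.uIcc_of_le zero_le_one] at hs
  simp only [(h s hs).self_of_nhds]

theorem ContDiffOn.radialIntegral (k : ℕ) {O : Set V} (hO : IsOpen O) (hstar : StarConvex ℝ 0 O)
    {f : V → W} (hf : ContDiffOn ℝ ∞ f O) : ContDiffOn ℝ ∞ (radialIntegral k f) O := by
  intro y hy
  obtain ⟨g, hg, hgf⟩ := exists_contDiff_eventually_eq_on_segment hO hstar hf hy
  refine ContDiffAt.contDiffWithinAt ?_
  refine (hg.radialIntegral k).contDiffAt.congr_of_eventuallyEq ?_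
  filter_upwards [hgf] with z hz using radialIntegral_congr_on_segment k hz

theorem ContDiffOn.fderiv_radialIntegral (k : ℕ) {O : Set V} (hO : IsOpen O)
    (hstar : StarConvex ℝ 0 O) {f : V → W} (hf : ContDiffOn ℝ ∞ f O) {y : V} (hy : y ∈ O) (w : V) :
    fderiv ℝ (_root_.radialIntegral k f) y w =
      ∫ s in (0 : ℝ)..1, s ^ k • fderiv ℝ f (s • y) (s • w) := by
  obtain ⟨g, hg, hgf⟩ := exists_contDiff_eventually_eq_on_segment hO hstar hf hy
  have h1 : _root_.radialIntegral k f =ᶠ[𝓝 y] _root_.radialIntegral k g := by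
    filter_upwards [hgf] with z hz using radialIntegral_congr_on_segment k hz
  rw [h1.fderiv_eq, hg.fderiv_radialIntegral]
  refine intervalIntegral.integral_congr fun s hs => ?_
  rw [Set.uIcc_of_le zero_le_one] at hs
  have h2 : g =ᶠ[𝓝 (s • y)] f := hgf.self_of_nhds s hs
  simp only [h2.fderiv_eq]

end RadialIntegral

/-! ### Poincaré lemma with the radial primitive -/

section PoincareLemma

variable {V : Type} [NormedAddCommGroup V] [NormedSpace ℝ V] [FiniteDimensional ℝ V]

-- When `A` is the derivative of a closed form the left side vanishes, and the derivative in the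
-- direction `y` is expressed by terms having `y` as an argument.
open ContinuousAlternatingMap in
omit [FiniteDimensional ℝ V] in
theorem ContinuousAlternatingMap.alternatizeUncurryFin_vecCons {k : ℕ}
    (A : V →L[ℝ] V [⋀^Fin (k + 1)]→L[ℝ] ℝ) (y : V) (v : Fin (k + 1) → V) :
    alternatizeUncurryFin A (Matrix.vecCons y v) =
      A y v - ∑ i : Fin (k + 1), (-1) ^ (i : ℕ) • A (v i) (Matrix.vecCons y (i.removeNth v)) := by
  rw [alternatizeUncurryFin_apply, Fin.sum_univ_succ, sub_eq_add_neg, ← Finset.sum_neg_distrib]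
  congr 1
  · simp [Matrix.vecCons]
  · refine Finset.sum_congr rfl fun i _ => ?_
    have : (Fin.succ i).removeNth (Matrix.vecCons y v) = Matrix.vecCons y (i.removeNth v) :=
      Fin.cons_comp_succ_succAbove y v i
    rw [this]
    simp [pow_succ]

/-- `ContinuousAlternatingMap.curryLeft` as a continuous linear map. -/
def ContinuousAlternatingMap.curryLeftCLM (V : Type*) [NormedAddCommGroup V] [NormedSpace ℝ V]
    (k : ℕ) : (V [⋀^Fin (k + 1)]→L[ℝ] ℝ) →L[ℝ] V →L[ℝ] V [⋀^Fin k]→L[ℝ] ℝ :=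
  (ContinuousAlternatingMap.curryLeftLI (𝕜 := ℝ) (E := V) (F := ℝ)
    (n := k)).toContinuousLinearMap

/-- The radial primitive `y ↦ ∫₀¹ s ^ k • α (s • y) (y, ·, …, ·) ds` of a `(k + 1)`-form `α`. -/
def radialPrimitive {k : ℕ} (α : V → V [⋀^Fin (k + 1)]→L[ℝ] ℝ) (y : V) : V [⋀^Fin k]→L[ℝ] ℝ :=
  (radialIntegral k α y).curryLeft y

theorem ContDiffOn.radialPrimitive {k : ℕ} {O : Set V} (hO : IsOpen O) (hstar : StarConvex ℝ 0 O)
    {α : V → V [⋀^Fin (k + 1)]→L[ℝ] ℝ} (hα : ContDiffOn ℝ ∞ α O) :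
    ContDiffOn ℝ ∞ (radialPrimitive α) O := by
  have h := ContinuousLinearMap.contDiff (𝕜 := ℝ) (E := V [⋀^Fin (k + 1)]→L[ℝ] ℝ)
    (F := V →L[ℝ] V [⋀^Fin k]→L[ℝ] ℝ) (n := ∞) (ContinuousAlternatingMap.curryLeftCLM V k)
  exact (h.comp_contDiffOn (hα.radialIntegral k hO hstar)).clm_apply contDiffOn_id

open ContinuousAlternatingMap in
/-- **Poincaré lemma** on a star-shaped open set, with the explicit radial primitive. -/
theorem extDeriv_radialPrimitive {k : ℕ} {O : Set V} (hO : IsOpen O) (hstar : StarConvex ℝ 0 O)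
    {α : V → V [⋀^Fin (k + 1)]→L[ℝ] ℝ} (hα : ContDiffOn ℝ ∞ α O)
    (hd : ∀ y ∈ O, extDeriv α y = 0) {y : V} (hy : y ∈ O) :
    extDeriv (radialPrimitive α) y = α y := by
  set W := radialIntegral k α with hW
  have hWd : HasFDerivAt W (fderiv ℝ W y) y :=
    (((hα.radialIntegral k hO hstar).contDiffAt (hO.mem_nhds hy)).differentiableAt
      (by simp)).hasFDerivAt
  have hfd : ∀ w, fderiv ℝ W y w = ∫ s in (0 : ℝ)..1, s ^ k • fderiv ℝ α (s • y) (s • w) :=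
    fun w => hα.fderiv_radialIntegral k hO hstar hy w
  have hmem : ∀ s ∈ Set.Icc (0 : ℝ) 1, s • y ∈ O := fun s hs => hstar.smul_mem hy hs.1 hs.2
  have hαc : ContinuousOn (fun s : ℝ => fderiv ℝ α (s • y)) (Set.Icc 0 1) :=
    (hα.continuousOn_fderiv_of_isOpen hO (by simp)).comp (by fun_prop) hmem
  have hint : ∀ w, ∀ v : Fin (k + 1) → V, fderiv ℝ W y w v =
      ∫ s in (0 : ℝ)..1, s ^ k • fderiv ℝ α (s • y) (s • w) v := by
    intro w v
    rw [hfd]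
    have h2 : IntervalIntegrable (fun s : ℝ => s ^ k • fderiv ℝ α (s • y) (s • w))
        MeasureTheory.volume 0 1 := by
      apply ContinuousOn.intervalIntegrable
      rw [Set.uIcc_of_le zero_le_one]
      exact (by fun_prop : Continuous fun s : ℝ => s ^ k).continuousOn.smul
        (hαc.clm_apply (by fun_prop))
    exact ((ContinuousAlternatingMap.apply ℝ V ℝ v).intervalIntegral_comp_comm h2).symm
  -- Differentiating under the integral turns `s ^ k` into `s ^ (k + 1)` and leaves `dα` at `s • y`,
  -- which is zero.
  have hclosed : alternatizeUncurryFin (fderiv ℝ W y) = 0 := by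
    ext v
    rw [alternatizeUncurryFin_apply]
    simp_rw [hint, zsmul_eq_mul, ← intervalIntegral.integral_const_mul]
    rw [← intervalIntegral.integral_finsetSum]
    · change _ = (0 : ℝ)
      refine (intervalIntegral.integral_congr (E := ℝ) (g := fun _ => (0 : ℝ))
        fun s hs => ?_).trans intervalIntegral.integral_zero
      rw [Set.uIcc_of_le zero_le_one] at hs
      have h3 := congrArg (fun η : V [⋀^Fin (k + 1 + 1)]→L[ℝ] ℝ => s ^ (k + 1) * η v) (hd _ (hmem s hs))
      simp only [extDeriv, alternatizeUncurryFin_apply, ContinuousAlternatingMap.coe_zero, Pi.zero_apply,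
        mul_zero, Finset.mul_sum] at h3
      simp only
      rw [← h3]
      refine Finset.sum_congr rfl fun i _ => ?_
      simp only [map_smul, ContinuousAlternatingMap.smul_apply, smul_eq_mul, zsmul_eq_mul]
      ring
    · intro i _
      apply ContinuousOn.intervalIntegrable
      rw [Set.uIcc_of_le zero_le_one]
      have h4 : ContinuousOn (fun s : ℝ => fderiv ℝ α (s • y) (s • v i)) (Set.Icc 0 1) :=
        hαc.clm_apply (by fun_prop)
      have h5 := (ContinuousAlternatingMap.apply ℝ V ℝ (i.removeNth v)).continuous.comp_continuousOn
        h4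
      exact continuousOn_const.mul
        ((by fun_prop : Continuous fun s : ℝ => s ^ k).continuousOn.smul h5)
  have hder : HasFDerivAt (radialPrimitive α)
      ((curryLeft (W y)) + (curryLeftCLM V k ∘L fderiv ℝ W y).flip y) y := by
    have h : HasFDerivAt (fun z => (W z).curryLeft) (curryLeftCLM V k ∘L fderiv ℝ W y) y := by
      refine HasFDerivAt.comp (g := fun f : V [⋀^Fin (k + 1)]→L[ℝ] ℝ => f.curryLeft)
        (g' := curryLeftCLM V k) y ?_ hWd
      exact ContinuousLinearMap.hasFDerivAt (𝕜 := ℝ) (E := V [⋀^Fin (k + 1)]→L[ℝ] ℝ)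
        (F := V →L[ℝ] V [⋀^Fin k]→L[ℝ] ℝ) (curryLeftCLM V k)
    have h' := h.clm_apply (hasFDerivAt_id y)
    rw [ContinuousLinearMap.comp_id] at h'
    exact h'
  -- Alternating `curryLeft (W y)` gives `(k + 1) • W y`; the other part of the derivative becomes,
  -- by `hclosed`, the derivative of `W` in the direction `y`. Together they are the integral over
  -- `[0, 1]` of the derivative of `s ^ (k + 1) • α (s • y)`, that is, `α y`.
  rw [extDeriv, hder.fderiv, alternatizeUncurryFin_add, alternatizeUncurryFin_curryLeft]
  ext v
  have h6 := alternatizeUncurryFin_vecCons (fderiv ℝ W y) y v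
  rw [hclosed, ContinuousAlternatingMap.coe_zero, Pi.zero_apply] at h6
  have h7 : alternatizeUncurryFin ((curryLeftCLM V k ∘L fderiv ℝ W y).flip y) v = fderiv ℝ W y y v := by
    rw [alternatizeUncurryFin_apply, ← sub_eq_zero, ← neg_eq_zero, neg_sub, h6]
    rfl
  rw [ContinuousAlternatingMap.add_apply, h7, hint]
  have hWv : W y v = ∫ s in (0 : ℝ)..1, s ^ k • α (s • y) v := by
    have h2 : IntervalIntegrable (fun s : ℝ => s ^ k • α (s • y))
        MeasureTheory.volume 0 1 := by
      apply ContinuousOn.intervalIntegrable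
      rw [Set.uIcc_of_le zero_le_one]
      exact (by fun_prop : Continuous fun s : ℝ => s ^ k).continuousOn.smul
        (hα.continuousOn.comp (by fun_prop) hmem)
    exact ((ContinuousAlternatingMap.apply ℝ V ℝ v).intervalIntegral_comp_comm h2).symm
  have hcv : ContinuousOn (fun s : ℝ => α (s • y) v) (Set.Icc 0 1) :=
    (ContinuousAlternatingMap.apply ℝ V ℝ v).continuous.comp_continuousOn
      (hα.continuousOn.comp (by fun_prop) hmem)
  have hcd : ContinuousOn (fun s : ℝ => fderiv ℝ α (s • y) y v) (Set.Icc 0 1) :=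
    (ContinuousAlternatingMap.apply ℝ V ℝ v).continuous.comp_continuousOn
      (hαc.clm_apply continuousOn_const)
  have hpow : ContinuousOn (fun s : ℝ => s ^ k) (Set.Icc 0 1) := (continuous_pow k).continuousOn
  have hI1 : ContinuousOn (fun s : ℝ => ((k + 1 : ℕ) : ℝ) * (s ^ k • α (s • y) v))
      (Set.Icc 0 1) := continuousOn_const.mul (hpow.smul hcv)
  have hI2 : ContinuousOn (fun s : ℝ => s ^ k • fderiv ℝ α (s • y) (s • y) v)
      (Set.Icc 0 1) := by
    simp only [map_smul, ContinuousAlternatingMap.smul_apply, smul_eq_mul]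
    exact hpow.mul (continuousOn_id.mul hcd)
  rw [ContinuousAlternatingMap.smul_apply, hWv, nsmul_eq_mul,
    ← intervalIntegral.integral_const_mul,
    ← intervalIntegral.integral_add]
  · have hF : ∀ s ∈ Set.uIcc (0 : ℝ) 1, HasDerivAt (fun s : ℝ => s ^ (k + 1) * α (s • y) v)
        (((k + 1 : ℕ) : ℝ) * (s ^ k • α (s • y) v) + s ^ k • fderiv ℝ α (s • y) (s • y) v) s := by
      intro s hs
      rw [Set.uIcc_of_le zero_le_one] at hs
      have h8 : HasFDerivAt α (fderiv ℝ α (s • y)) (s • y) :=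
        ((hα.contDiffAt (hO.mem_nhds (hmem s hs))).differentiableAt (by simp)).hasFDerivAt
      have h9 : HasDerivAt (fun s : ℝ => α (s • y)) (fderiv ℝ α (s • y) y) s := by
        have := h8.comp_hasDerivAt s ((hasDerivAt_id s).smul_const y)
        simp only [id_eq, one_smul] at this
        exact this
      have h10 : HasDerivAt (fun s : ℝ => α (s • y) v) (fderiv ℝ α (s • y) y v) s :=
        (ContinuousAlternatingMap.apply ℝ V ℝ v).hasFDerivAt.comp_hasDerivAt s h9
      have h11 := (hasDerivAt_pow (k + 1) s).mul h10
      refine h11.congr_deriv ?_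
      simp only [map_smul, ContinuousAlternatingMap.smul_apply, smul_eq_mul,
        Nat.add_sub_cancel]
      ring
    rw [intervalIntegral.integral_eq_sub_of_hasDerivAt hF]
    · simp
    · apply ContinuousOn.intervalIntegrable
      rw [Set.uIcc_of_le zero_le_one]
      exact hI1.add hI2
  · apply ContinuousOn.intervalIntegrable
    rw [Set.uIcc_of_le zero_le_one]
    exact hI1
  · apply ContinuousOn.intervalIntegrable
    rw [Set.uIcc_of_le zero_le_one]
    exact hI2

end PoincareLemma

/-! ### Inverse function theorem -/

section LocalDiffeomorphism

variable {V W : Type*} [NormedAddCommGroup V] [NormedSpace ℝ V] [CompleteSpace V]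
  [NormedAddCommGroup W] [NormedSpace ℝ W]

/-- The smooth inverse function theorem, with smoothness of the map and of its inverse on the
whole domains. -/
theorem ContDiffOn.exists_openPartialHomeomorph {f : V → W} {O : Set V} (hO : IsOpen O)
    (hf : ContDiffOn ℝ ∞ f O) {a : V} (ha : a ∈ O) {e : V ≃L[ℝ] W}
    (he : HasFDerivAt f (e : V →L[ℝ] W) a) :
    ∃ Φ : OpenPartialHomeomorph V W, a ∈ Φ.source ∧ Φ.source ⊆ O ∧ (∀ x, Φ x = f x) ∧
      (∀ x ∈ Φ.source, ∃ e : V ≃L[ℝ] W, HasFDerivAt f (e : V →L[ℝ] W) x) ∧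
      ContDiffOn ℝ ∞ Φ.symm Φ.target := by
  have hfa := hf.contDiffAt (hO.mem_nhds ha)
  have hcont : ContinuousOn (fderiv ℝ f) O := hf.continuousOn_fderiv_of_isOpen hO (by simp)
  -- Invertible operators form an open set, so the domain can be cut down to where the derivative is
  -- invertible; there the inverse is smooth at every point and not only at the image of `a`.
  have hev : ∀ᶠ x in 𝓝 a, x ∈ O ∧ fderiv ℝ f x ∈ Set.range ((↑) : (V ≃L[ℝ] W) → V →L[ℝ] W) := by
    refine Filter.Eventually.and (p := (· ∈ O)) (hO.mem_nhds ha) ?_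
    have h := (hcont.continuousAt (hO.mem_nhds ha)).preimage_mem_nhds
      (t := Set.range ((↑) : (V ≃L[ℝ] W) → V →L[ℝ] W))
    exact h (by rw [he.fderiv]; exact ContinuousLinearEquiv.nhds e)
  obtain ⟨N, hN, hNo, haN⟩ := eventually_nhds_iff.1 hev
  let Ψ := hfa.toOpenPartialHomeomorph f he (by simp)
  have hΨ : ∀ x, Ψ x = f x := fun x => rfl
  have haΨ : a ∈ Ψ.source := hfa.mem_toOpenPartialHomeomorph_source he (by simp)
  have hder : ∀ x ∈ N, ∃ e : V ≃L[ℝ] W, HasFDerivAt f (e : V →L[ℝ] W) x := by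
    intro x hx
    obtain ⟨e', he'⟩ := (hN x hx).2
    refine ⟨e', ?_⟩
    rw [he']
    exact ((hf.contDiffAt (hO.mem_nhds (hN x hx).1)).differentiableAt (by simp)).hasFDerivAt
  refine ⟨Ψ.restrOpen N hNo, ⟨haΨ, haN⟩, fun x hx => (hN x hx.2).1, hΨ, fun x hx => hder x hx.2, ?_⟩
  intro y hy
  refine ContDiffAt.contDiffWithinAt ?_
  have hs := (Ψ.restrOpen N hNo).map_target hy
  obtain ⟨e', he'⟩ := hder _ hs.2
  exact (Ψ.restrOpen N hNo).contDiffAt_symm hy he'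
    (hf.contDiffAt (hO.mem_nhds (hN _ hs.2).1))

end LocalDiffeomorphism

/-! ### Primitives and reparametrization of curves -/

section Primitive

variable {V : Type*} [NormedAddCommGroup V] [NormedSpace ℝ V]

open MeasureTheory

/-- The primitive vanishing at `0` of a continuous curve on the unit interval. -/
def unitPrimitive (V : Type*) [NormedAddCommGroup V] [NormedSpace ℝ V] :
    C(unitInterval, V) →L[ℝ] C(unitInterval, V) :=
  LinearMap.mkContinuous
    { toFun := fun y => ⟨fun t => ∫ s in (0 : ℝ)..t, y (Set.projIcc 0 1 zero_le_one s),
        (intervalIntegral.continuous_primitive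
          (fun _ _ => Continuous.intervalIntegrable (by fun_prop) _ _) 0).comp
            continuous_subtype_val⟩
      map_add' := fun x y => by
        ext t
        simp only [ContinuousMap.add_apply, ContinuousMap.coe_mk]
        exact intervalIntegral.integral_add (Continuous.intervalIntegrable (by fun_prop) _ _)
          (Continuous.intervalIntegrable (by fun_prop) _ _)
      map_smul' := fun c y => by
        ext t
        simp only [ContinuousMap.smul_apply, ContinuousMap.coe_mk, RingHom.id_apply]
        exact intervalIntegral.integral_smul _ _ } 1
    (fun y => by
      rw [ContinuousMap.norm_le _ (by positivity)]
      intro t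
      have h := intervalIntegral.norm_integral_le_of_norm_le_const (a := 0) (b := t) (C := ‖y‖)
        (f := fun s => y (Set.projIcc 0 1 zero_le_one s)) (fun s _ => y.norm_coe_le_norm _)
      rw [sub_zero, abs_of_nonneg t.2.1] at h
      refine h.trans ?_
      rw [mul_comm]
      exact mul_le_mul_of_nonneg_right t.2.2 (norm_nonneg _))

theorem unitPrimitive_apply (y : C(unitInterval, V)) (t : unitInterval) :
    unitPrimitive V y t = ∫ s in (0 : ℝ)..t, y (Set.projIcc 0 1 zero_le_one s) := rfl

theorem hasDerivAt_unitPrimitive [CompleteSpace V] (y : C(unitInterval, V)) {t : ℝ}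
    (ht : t ∈ Set.Ioo (0 : ℝ) 1) :
    HasDerivAt (fun t => unitPrimitive V y (Set.projIcc 0 1 zero_le_one t))
      (y ⟨t, ht.1.le, ht.2.le⟩) t := by
  have hc : Continuous fun s => y (Set.projIcc 0 1 zero_le_one s) := by fun_prop
  have h := intervalIntegral.integral_hasDerivAt_right (hc.intervalIntegrable 0 t)
    hc.stronglyMeasurable.stronglyMeasurableAtFilter hc.continuousAt
  rw [Set.projIcc_of_mem zero_le_one ⟨ht.1.le, ht.2.le⟩] at h
  refine h.congr_of_eventuallyEq ?_
  filter_upwards [Ioo_mem_nhds ht.1 ht.2] with s hs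
  rw [unitPrimitive_apply, Set.projIcc_of_mem zero_le_one ⟨hs.1.le, hs.2.le⟩]

/-- The curve `s ↦ c • y (c * s)` for `c ∈ [0, 1]`. -/
def slowDown (c : unitInterval) (y : C(unitInterval, V)) : C(unitInterval, V) :=
  ⟨fun s => (c : ℝ) • y (c * s), by fun_prop⟩

theorem slowDown_apply (c : unitInterval) (y : C(unitInterval, V)) (s : unitInterval) :
    slowDown c y s = (c : ℝ) • y (c * s) := rfl

theorem norm_slowDown_le (c : unitInterval) (y : C(unitInterval, V)) : ‖slowDown c y‖ ≤ ‖y‖ := by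
  rw [ContinuousMap.norm_le _ (norm_nonneg _)]
  intro s
  rw [slowDown_apply, norm_smul, Real.norm_eq_abs, abs_of_nonneg c.2.1]
  exact (mul_le_of_le_one_left (norm_nonneg _) c.2.2).trans (y.norm_coe_le_norm _)

/-- If `y` is the velocity of a curve from `0`, then `slowDown c y` is the velocity of the same
curve run `c` times as fast. -/
theorem unitPrimitive_comp_mul (c : unitInterval) (y : C(unitInterval, V)) (t : unitInterval) :
    unitPrimitive V (slowDown c y) t = unitPrimitive V y (c * t) := by
  rw [unitPrimitive_apply, unitPrimitive_apply]
  have h := intervalIntegral.smul_integral_comp_mul_left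
    (f := fun s => y (Set.projIcc 0 1 zero_le_one s)) (c : ℝ) (a := 0) (b := t)
  rw [mul_zero] at h
  change _ = ∫ s in (0 : ℝ)..(c * t : ℝ), _
  rw [← h, ← intervalIntegral.integral_smul]
  refine intervalIntegral.integral_congr fun s hs => ?_
  rw [Set.uIcc_of_le t.2.1] at hs
  have hs' : s ∈ Set.Icc (0 : ℝ) 1 := ⟨hs.1, hs.2.trans t.2.2⟩
  rw [slowDown_apply, Set.projIcc_of_mem zero_le_one hs',
    show (Set.projIcc 0 1 zero_le_one ((c : ℝ) * s)) = c * ⟨s, hs'⟩ from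
      Set.projIcc_of_mem zero_le_one (c * ⟨s, hs'⟩ : unitInterval).2]

end Primitive

/-! ### Exponential map of a quadratic spray -/

section Spray

variable {V : Type} [NormedAddCommGroup V] [NormedSpace ℝ V] [FiniteDimensional ℝ V]

-- On a line through the origin, `b (s • p)` is `s ^ 2` times a differentiable function of `s`.
omit [FiniteDimensional ℝ V] in
theorem hasFDerivAt_zero_of_quadratic {b : V × V → V} (hb : ContDiff ℝ ∞ b)
    (hquad : ∀ (x u : V) (s : ℝ), b (x, s • u) = s ^ 2 • b (x, u)) :
    HasFDerivAt b (0 : V × V →L[ℝ] V) 0 := by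
  have h := (hb.differentiable (by simp) 0).hasFDerivAt
  suffices fderiv ℝ b 0 = 0 by rwa [this] at h
  refine ContinuousLinearMap.ext fun p => ?_
  have h1 : HasDerivAt (fun s : ℝ => b (s • p)) (fderiv ℝ b 0 p) 0 := by
    have h2 : HasFDerivAt b (fderiv ℝ b 0) ((0 : ℝ) • p) := by rwa [zero_smul]
    have := h2.comp_hasDerivAt (0 : ℝ) ((hasDerivAt_id (0 : ℝ)).smul_const p)
    simpa [Function.comp_def] using this
  have h3 : (fun s : ℝ => b (s • p)) = fun s : ℝ => s ^ 2 • b (s • p.1, p.2) := by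
    funext s
    rw [← hquad]; rfl
  have h4 : HasDerivAt (fun s : ℝ => b (s • p.1, p.2))
      (deriv (fun s : ℝ => b (s • p.1, p.2)) 0) 0 := by
    refine DifferentiableAt.hasDerivAt ?_
    exact (hb.differentiable (by simp) _).comp _ (by fun_prop)
  have h5 := (hasDerivAt_pow 2 (0 : ℝ)).smul h4
  rw [h3] at h1
  have := h1.unique h5
  simpa using this

set_option synthInstance.maxHeartbeats 400000 in
set_option maxHeartbeats 1000000 in
omit [FiniteDimensional ℝ V] in
/-- The exponential map of a quadratic spray: a smooth map `E` near `0` with `E 0 = 0` and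
derivative the identity at `0`, mapping rays to solutions of `x'' = -b (x, x')`. -/
theorem exists_exponential_of_spray [CompleteSpace V] {b : V × V → V} (hb : ContDiff ℝ ∞ b)
    (hquad : ∀ (x u : V) (s : ℝ), b (x, s • u) = s ^ 2 • b (x, u)) :
    ∃ (r : ℝ) (E : V → V), 0 < r ∧ ContDiffOn ℝ ∞ E (Metric.ball 0 r) ∧ E 0 = 0 ∧
      HasFDerivAt E (ContinuousLinearMap.id ℝ V) 0 ∧
      ∀ u ∈ Metric.ball (0 : V) r, fderiv ℝ (fderiv ℝ E) u u u = - b (E u, fderiv ℝ E u u) := by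
  let I := unitInterval
  let J := unitPrimitive V
  let P : C(I, V) →L[ℝ] C(I, V × V) :=
    ContinuousLinearMap.compLeftContinuous ℝ I (ContinuousLinearMap.inl ℝ V V) ∘L J +
      ContinuousLinearMap.compLeftContinuous ℝ I (ContinuousLinearMap.inr ℝ V V)
  have hP : ∀ (y : C(I, V)) (t : I), P y t = (J y t, y t) := by
    intro y t
    simp [P]
  let bc : C(V × V, V) := ⟨b, hb.continuous⟩
  -- The unknown is the velocity `y`, the position being its primitive `J y`. For a constant `v`,
  -- the equation `Θ y = v` is the integrated form of `x'' = -b (x, x')` with `x 0 = 0` and `x' 0 =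
  -- v`. The derivative of `Θ` at `0` is the identity, so the equation is solved smoothly in `v`.
  let Θ : C(I, V) → C(I, V) := fun y => y + J (bc.comp (P y))
  have hΘsmooth : ContDiff ℝ ∞ Θ :=
    contDiff_id.add (J.contDiff.comp ((ContinuousMap.contDiff_postcomp bc hb).comp P.contDiff))
  have hfb : ContDiff ℝ ∞ (fderiv ℝ b) := hb.fderiv_right (by simp)
  have hb0 := hasFDerivAt_zero_of_quadratic hb hquad
  have hΘder : HasFDerivAt Θ ((ContinuousLinearEquiv.refl ℝ C(I, V) : C(I, V) ≃L[ℝ] C(I, V)) :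
      C(I, V) →L[ℝ] C(I, V)) 0 := by
    have h1 := ContinuousMap.hasFDerivAt_postcomp (K := I) bc ⟨fderiv ℝ b, hfb.continuous⟩
      (fun x => (hb.differentiable (by simp) x).hasFDerivAt) (P 0)
    have h2 := J.hasFDerivAt.comp (0 : C(I, V)) (h1.comp (0 : C(I, V)) P.hasFDerivAt)
    have h3 := (hasFDerivAt_id (𝕜 := ℝ) (0 : C(I, V))).add h2
    refine h3.congr_fderiv ?_
    ext1 y
    have h4 : ContinuousMap.applyFamily I (V × V) V
        ((⟨fderiv ℝ b, hfb.continuous⟩ : C(V × V, V × V →L[ℝ] V)).comp (P 0)) = 0 := by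
      ext1 z
      ext t
      simp [hb0.fderiv]
    rw [h4]
    simp
  obtain ⟨Ψ, h0Ψ, -, hΨ, -, hΨs⟩ := (hΘsmooth.contDiffOn (s := Set.univ)).exists_openPartialHomeomorph
    isOpen_univ (Set.mem_univ 0) hΘder
  have hΘ0 : Θ 0 = 0 := by
    have : bc.comp (P 0) = 0 := by
      ext t
      have := hquad 0 0 0
      rw [zero_smul, zero_pow two_ne_zero, zero_smul] at this
      rw [map_zero]
      exact this
    change 0 + J (bc.comp (P 0)) = 0
    rw [this, map_zero, add_zero]
  let c : V →L[ℝ] C(I, V) := ContinuousLinearMap.const ℝ I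
  have h0t : (0 : C(I, V)) ∈ Ψ.target := by
    have := Ψ.map_source h0Ψ
    rwa [hΨ, hΘ0] at this
  have hΨ0 : Ψ.symm 0 = 0 := by
    have := Ψ.left_inv h0Ψ
    rwa [hΨ, hΘ0] at this
  obtain ⟨δ, hδ, hδs⟩ := Metric.mem_nhds_iff.1 (Ψ.open_source.mem_nhds h0Ψ)
  let Y : V → C(I, V) := fun v => Ψ.symm (c v)
  have hev : ∀ᶠ v in 𝓝 (0 : V), c v ∈ Ψ.target ∧ Y v ∈ Metric.ball 0 δ := by
    have h1 : ∀ᶠ z in 𝓝 (0 : C(I, V)), z ∈ Ψ.target ∧ Ψ.symm z ∈ Metric.ball 0 δ := by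
      refine Filter.Eventually.and (p := (· ∈ Ψ.target)) (Ψ.open_target.mem_nhds h0t) ?_
      have h2 := Ψ.continuousAt_symm h0t
      refine h2.eventually ?_
      rw [hΨ0]
      exact Metric.ball_mem_nhds _ hδ
    have h3 : Filter.Tendsto c (𝓝 0) (𝓝 0) := by
      have := c.continuous.tendsto 0
      rwa [map_zero] at this
    exact h3.eventually h1
  obtain ⟨r, hr, hball⟩ := Metric.eventually_nhds_iff_ball.1 hev
  let t1 : I := 1
  let ev1 : C(I, V) →L[ℝ] V := ContinuousMap.evalCLM ℝ t1
  let E : V → V := fun v => ev1 (J (Y v))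
  have hYΘ : ∀ v ∈ Metric.ball (0 : V) r, Θ (Y v) = c v := by
    intro v hv
    rw [← hΨ]
    exact Ψ.right_inv (hball v hv).1
  have hEsmooth : ContDiffOn ℝ ∞ E (Metric.ball 0 r) :=
    (ev1.contDiff.comp J.contDiff).comp_contDiffOn
      (hΨs.comp c.contDiff.contDiffOn fun v hv => (hball v hv).1)
  -- As `b` is quadratic in the velocity, slowing down a solution with initial velocity `v` gives
  -- one with initial velocity `t • v`. It stays in the ball of radius `δ`, on which `Θ` is
  -- injective, so it is `Y (t • v)`.
  have hYslow : ∀ v ∈ Metric.ball (0 : V) r, ∀ t : I, Y ((t : ℝ) • v) = slowDown t (Y v) := by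
    intro v hv t
    have h1 : Θ (slowDown t (Y v)) = c ((t : ℝ) • v) := by
      ext s
      have hval : ∀ s : I, bc.comp (P (slowDown t (Y v))) s = (t : ℝ) •
          slowDown t (bc.comp (P (Y v))) s := by
        intro s
        rw [ContinuousMap.comp_apply, hP, slowDown_apply, slowDown_apply,
          ContinuousMap.comp_apply, hP, smul_smul, ← pow_two]
        rw [show J (slowDown t (Y v)) s = J (Y v) (t * s) from unitPrimitive_comp_mul t (Y v) s]
        exact hquad _ _ _
      have h2 : bc.comp (P (slowDown t (Y v))) = (t : ℝ) • slowDown t (bc.comp (P (Y v))) := by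
        ext s; rw [hval]; rfl
      have h3 := DFunLike.congr_fun (hYΘ v hv) (t * s)
      simp only [Θ, ContinuousMap.add_apply, h2, map_smul, ContinuousMap.smul_apply] at h3 ⊢
      rw [show J (slowDown t (bc.comp (P (Y v)))) s = J (bc.comp (P (Y v))) (t * s) from
        unitPrimitive_comp_mul t _ s, slowDown_apply, ← smul_add, h3]
      rfl
    have h4 : slowDown t (Y v) ∈ Ψ.source := by
      refine hδs ?_
      rw [mem_ball_zero_iff]
      exact (norm_slowDown_le t _).trans_lt (mem_ball_zero_iff.1 (hball v hv).2)
    have h5 := Ψ.left_inv h4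
    rw [hΨ, h1] at h5
    exact h5
  have hEray : ∀ v ∈ Metric.ball (0 : V) r, ∀ t : I, E ((t : ℝ) • v) = J (Y v) t := by
    intro v hv t
    change J (Y ((t : ℝ) • v)) t1 = _
    rw [hYslow v hv t]
    have h6 := unitPrimitive_comp_mul t (Y v) t1
    rw [show t * t1 = t from mul_one t] at h6
    exact h6
  have hmem : ∀ v ∈ Metric.ball (0 : V) r, ∀ t ∈ Set.Ioo (0 : ℝ) 1, t • v ∈ Metric.ball (0 : V) r := by
    intro v hv t ht
    rw [mem_ball_zero_iff] at hv ⊢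
    rw [norm_smul, Real.norm_eq_abs, abs_of_pos ht.1]
    exact (mul_le_of_le_one_left (norm_nonneg _) ht.2.le).trans_lt hv
  have hEd : ∀ v ∈ Metric.ball (0 : V) r, HasFDerivAt E (fderiv ℝ E v) v := fun v hv =>
    ((hEsmooth.contDiffAt (Metric.isOpen_ball.mem_nhds hv)).differentiableAt
      (by simp)).hasFDerivAt
  have hE2 : ∀ v ∈ Metric.ball (0 : V) r,
      HasFDerivAt (fderiv ℝ E) (fderiv ℝ (fderiv ℝ E) v) v := fun v hv =>
    ((((hEsmooth.contDiffAt (Metric.isOpen_ball.mem_nhds hv)).fderiv_right (m := ∞)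
      (by simp))).differentiableAt (by simp)).hasFDerivAt
  have hder1 : ∀ v ∈ Metric.ball (0 : V) r, ∀ t (ht : t ∈ Set.Ioo (0 : ℝ) 1),
      fderiv ℝ E (t • v) v = Y v ⟨t, ht.1.le, ht.2.le⟩ := by
    intro v hv t ht
    have h1 : HasDerivAt (fun t : ℝ => E (t • v)) (fderiv ℝ E (t • v) v) t := by
      have := (hEd _ (hmem v hv t ht)).comp_hasDerivAt t ((hasDerivAt_id t).smul_const v)
      simpa [Function.comp_def] using this
    refine h1.unique ((hasDerivAt_unitPrimitive (Y v) ht).congr_of_eventuallyEq ?_)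
    filter_upwards [Ioo_mem_nhds ht.1 ht.2] with s hs
    rw [Set.projIcc_of_mem zero_le_one ⟨hs.1.le, hs.2.le⟩]
    exact hEray v hv ⟨s, hs.1.le, hs.2.le⟩
  have hder2 : ∀ v ∈ Metric.ball (0 : V) r, ∀ t ∈ Set.Ioo (0 : ℝ) 1,
      fderiv ℝ (fderiv ℝ E) (t • v) v v = - b (E (t • v), fderiv ℝ E (t • v) v) := by
    intro v hv t ht
    have h1 : HasDerivAt (fun t : ℝ => fderiv ℝ E (t • v) v)
        (fderiv ℝ (fderiv ℝ E) (t • v) v v) t := by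
      have := (hE2 _ (hmem v hv t ht)).comp_hasDerivAt t ((hasDerivAt_id t).smul_const v)
      have h2 := this.clm_apply (hasDerivAt_const t v)
      simpa [Function.comp_def] using h2
    have h3 := ((hasDerivAt_const t v).sub (hasDerivAt_unitPrimitive (bc.comp (P (Y v))) ht))
    have h4 := h1.unique (h3.congr_of_eventuallyEq ?_)
    · rw [h4, zero_sub, ContinuousMap.comp_apply, hP, hder1 v hv t ht,
        ← hEray v hv ⟨t, ht.1.le, ht.2.le⟩]
      rfl
    · filter_upwards [Ioo_mem_nhds ht.1 ht.2] with s hs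
      rw [hder1 v hv s hs, Pi.sub_apply, Set.projIcc_of_mem zero_le_one ⟨hs.1.le, hs.2.le⟩]
      have h5 := DFunLike.congr_fun (hYΘ v hv) ⟨s, hs.1.le, hs.2.le⟩
      exact eq_sub_of_add_eq h5
  refine ⟨r, E, hr, hEsmooth, ?_, ?_, ?_⟩
  · change ev1 (J (Ψ.symm (c 0))) = 0
    rw [map_zero, hΨ0, map_zero, map_zero]
  · have h1 : HasFDerivAt Ψ (((ContinuousLinearEquiv.refl ℝ C(I, V) : C(I, V) ≃L[ℝ] C(I, V))) :
        C(I, V) →L[ℝ] C(I, V)) (Ψ.symm (c 0)) := by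
      rw [map_zero, hΨ0]
      exact hΘder.congr_of_eventuallyEq (Filter.Eventually.of_forall hΨ)
    have h2 := Ψ.hasFDerivAt_symm (by rw [map_zero]; exact h0t) h1
    have h3 := (ev1.comp J).hasFDerivAt.comp (0 : V) (h2.comp (0 : V) c.hasFDerivAt)
    refine h3.congr_fderiv ?_
    ext1 v
    change J (c v) t1 = v
    rw [show J (c v) t1 = _ from unitPrimitive_apply _ _]
    change ∫ s in (0 : ℝ)..1, v = v
    simp
  · intro u hu
    rw [mem_ball_zero_iff] at hu
    -- The equation along rays is known for parameters strictly between `0` and `1`, so `u` is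
    -- written as `t` times a longer vector of the ball.
    obtain ⟨t, ht⟩ : ∃ t ∈ Set.Ioo (0 : ℝ) 1, t⁻¹ • u ∈ Metric.ball (0 : V) r := by
      obtain ⟨t, ht1, ht2⟩ := exists_between (show max (‖u‖ / r) 0 < 1 from
        max_lt ((div_lt_one hr).2 hu) one_pos)
      have ht0 : 0 < t := (le_max_right _ _).trans_lt ht1
      refine ⟨t, ⟨ht0, ht2⟩, ?_⟩
      rw [mem_ball_zero_iff, norm_smul, norm_inv, Real.norm_eq_abs, abs_of_pos ht0,
        inv_mul_lt_iff₀ ht0]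
      exact (div_lt_iff₀ hr).1 ((le_max_left _ _).trans_lt ht1)
    have h1 := hder2 _ ht.2 t ht.1
    have ht0 : t ≠ 0 := ht.1.1.ne'
    rw [smul_inv_smul₀ ht0] at h1
    have h2 : u = t • (t⁻¹ • u) := (smul_inv_smul₀ ht0 u).symm
    have h3 : fderiv ℝ (fderiv ℝ E) u u u =
        t ^ 2 • fderiv ℝ (fderiv ℝ E) u (t⁻¹ • u) (t⁻¹ • u) := by
      simp only [map_smul, _root_.smul_apply, smul_smul]
      field_simp
      simp
    have h4 : fderiv ℝ E u u = t • fderiv ℝ E u (t⁻¹ • u) := by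
      rw [map_smul, smul_inv_smul₀ ht0]
    rw [h3, h1, h4, hquad, smul_neg]

end Spray

/-! ### Gauss lemma -/

section Gauss

set_option synthInstance.maxHeartbeats 400000
set_option maxHeartbeats 1000000

variable {V : Type} [NormedAddCommGroup V] [NormedSpace ℝ V]

theorem eq_of_radial_derivative_eq_zero {r : ℝ} {f : V → ℝ}
    (hf : ∀ u ∈ Metric.ball (0 : V) r, DifferentiableAt ℝ f u)
    (h : ∀ u ∈ Metric.ball (0 : V) r, fderiv ℝ f u u = 0) {u : V}
    (hu : u ∈ Metric.ball (0 : V) r) : f u = f 0 := by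
  have hmem : ∀ t ∈ Set.Icc (0 : ℝ) 1, t • u ∈ Metric.ball (0 : V) r := by
    intro t ht
    rw [mem_ball_zero_iff] at hu ⊢
    rw [norm_smul, Real.norm_eq_abs, abs_of_nonneg ht.1]
    exact (mul_le_of_le_one_left (norm_nonneg _) ht.2).trans_lt hu
  have hd : ∀ t ∈ Set.Icc (0 : ℝ) 1, HasDerivAt (fun t : ℝ => f (t • u))
      (fderiv ℝ f (t • u) u) t := by
    intro t ht
    have := (hf _ (hmem t ht)).hasFDerivAt.comp_hasDerivAt t ((hasDerivAt_id t).smul_const u)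
    simpa [Function.comp_def] using this
  obtain ⟨t, ht, hslope⟩ := exists_hasDerivAt_eq_slope (fun t : ℝ => f (t • u))
    (fun t => fderiv ℝ f (t • u) u) one_pos
    (fun t ht => (hd t ht).continuousAt.continuousWithinAt)
    (fun t ht => hd t ⟨ht.1.le, ht.2.le⟩)
  have h1 := h _ (hmem t ⟨ht.1.le, ht.2.le⟩)
  rw [map_smul, smul_eq_mul] at h1
  have h2 : fderiv ℝ f (t • u) u = 0 := (mul_eq_zero.1 h1).resolve_left ht.1.ne'
  simp only [h2, one_smul, zero_smul, sub_zero, div_one] at hslope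
  linarith

theorem HasFDerivAt.bilinear_apply {h : V → V →L[ℝ] V →L[ℝ] ℝ} {h' : V →L[ℝ] V →L[ℝ] V →L[ℝ] ℝ}
    {a b : V → V} {a' b' : V →L[ℝ] V} {u : V} (hh : HasFDerivAt h h' u)
    (ha : HasFDerivAt a a' u) (hb : HasFDerivAt b b' u) :
    DifferentiableAt ℝ (fun u => h u (a u) (b u)) u ∧
    ∀ v, fderiv ℝ (fun u => h u (a u) (b u)) u v =
      h' v (a u) (b u) + h u (a' v) (b u) + h u (a u) (b' v) := by
  have h1 := (hh.clm_apply ha).clm_apply hb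
  refine ⟨h1.differentiableAt, fun v => ?_⟩
  rw [h1.fderiv]
  simp
  ring

/-- The **Gauss lemma** in normal coordinates: if `E` maps rays to geodesics of the metric `h`,
then the metric `E^* h` pairs the radial direction with any vector as in the origin. -/
theorem gauss_lemma {r : ℝ} (hr : 0 < r) {h : V → V →L[ℝ] V →L[ℝ] ℝ} {E : V → V} {O : Set V}
    (hO : IsOpen O)
    (hh : ContDiffOn ℝ ∞ h O) (hsymm : ∀ x ∈ O, ∀ u v, h x u v = h x v u)
    (hE : ContDiffOn ℝ ∞ E (Metric.ball 0 r)) (hE0 : E 0 = 0)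
    (hE' : HasFDerivAt E (ContinuousLinearMap.id ℝ V) 0)
    (hEO : ∀ u ∈ Metric.ball 0 r, E u ∈ O)
    (hgeo : ∀ u ∈ Metric.ball 0 r, ∀ w, h (E u) (fderiv ℝ (fderiv ℝ E) u u u) w =
      - (fderiv ℝ h (E u) (fderiv ℝ E u u) (fderiv ℝ E u u) w -
        1 / 2 * fderiv ℝ h (E u) w (fderiv ℝ E u u) (fderiv ℝ E u u)))
    {u : V} (hu : u ∈ Metric.ball 0 r) (w : V) :
    h (E u) (fderiv ℝ E u u) (fderiv ℝ E u w) = h 0 u w := by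
  have hEc : ∀ u ∈ Metric.ball (0 : V) r, ContDiffAt ℝ ∞ E u := fun u hu =>
    hE.contDiffAt (Metric.isOpen_ball.mem_nhds hu)
  have hE1 : ∀ u ∈ Metric.ball (0 : V) r, HasFDerivAt E (fderiv ℝ E u) u := fun u hu =>
    ((hEc u hu).differentiableAt (by simp)).hasFDerivAt
  have hE2 : ∀ u ∈ Metric.ball (0 : V) r, HasFDerivAt (fderiv ℝ E) (fderiv ℝ (fderiv ℝ E) u) u :=
    fun u hu => (((hEc u hu).fderiv_right (m := ∞) (by simp)).differentiableAt
      (by simp)).hasFDerivAt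
  have hsymE : ∀ u ∈ Metric.ball (0 : V) r, ∀ v w, fderiv ℝ (fderiv ℝ E) u v w =
      fderiv ℝ (fderiv ℝ E) u w v := fun u hu v w =>
    ((hEc u hu).isSymmSndFDerivAt (by
      rw [minSmoothness_of_isRCLikeNormedField]; exact WithTop.coe_le_coe.2 le_top)) v w
  have hhE : ∀ u ∈ Metric.ball (0 : V) r, HasFDerivAt (fun u => h (E u))
      (fderiv ℝ h (E u) ∘L fderiv ℝ E u) u := fun u hu =>
    (((hh.contDiffAt (hO.mem_nhds (hEO u hu))).differentiableAt (by simp)).hasFDerivAt).comp u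
      (hE1 u hu)
  have hy : ∀ u ∈ Metric.ball (0 : V) r, HasFDerivAt (fun u => fderiv ℝ E u u)
      (fderiv ℝ E u + (fderiv ℝ (fderiv ℝ E) u).flip u) u := by
    intro u hu
    have := (hE2 u hu).clm_apply (hasFDerivAt_id u)
    simpa using this
  have hZ : ∀ w, ∀ u ∈ Metric.ball (0 : V) r, HasFDerivAt (fun u => fderiv ℝ E u w)
      ((fderiv ℝ (fderiv ℝ E) u).flip w) u := by
    intro w u hu
    have := (hE2 u hu).clm_apply (hasFDerivAt_const w u)
    simpa using this
  have hfder0 : fderiv ℝ E 0 = ContinuousLinearMap.id ℝ V := hE'.fderiv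
  -- conservation of energy along rays
  have henergy : ∀ v ∈ Metric.ball (0 : V) r,
      h (E v) (fderiv ℝ E v v) (fderiv ℝ E v v) = h 0 v v := by
    intro v hv
    have hmem : ∀ t ∈ Set.Icc (0 : ℝ) 1, t • v ∈ Metric.ball (0 : V) r := by
      intro t ht
      rw [mem_ball_zero_iff] at hv ⊢
      rw [norm_smul, Real.norm_eq_abs, abs_of_nonneg ht.1]
      exact (mul_le_of_le_one_left (norm_nonneg _) ht.2).trans_lt hv
    have hd : ∀ t ∈ Set.Icc (0 : ℝ) 1, HasDerivAt
        (fun t : ℝ => h (E (t • v)) (fderiv ℝ E (t • v) v) (fderiv ℝ E (t • v) v))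
        (fderiv ℝ h (E (t • v)) (fderiv ℝ E (t • v) v) (fderiv ℝ E (t • v) v)
          (fderiv ℝ E (t • v) v) + h (E (t • v)) (fderiv ℝ (fderiv ℝ E) (t • v) v v)
          (fderiv ℝ E (t • v) v) + h (E (t • v)) (fderiv ℝ E (t • v) v)
          (fderiv ℝ (fderiv ℝ E) (t • v) v v)) t := by
      intro t ht
      have hb := HasFDerivAt.bilinear_apply (hhE _ (hmem t ht)) (hZ v _ (hmem t ht))
        (hZ v _ (hmem t ht))
      have := hb.1.hasFDerivAt.comp_hasDerivAt t ((hasDerivAt_id t).smul_const v)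
      simpa [Function.comp_def, hb.2] using this
    obtain ⟨t, ht, hslope⟩ := exists_hasDerivAt_eq_slope _ _ one_pos
      (fun t ht => (hd t ht).continuousAt.continuousWithinAt)
      (fun t ht => hd t ⟨ht.1.le, ht.2.le⟩)
    have hm := hmem t ⟨ht.1.le, ht.2.le⟩
    have hg := hgeo _ hm (fderiv ℝ E (t • v) v)
    have ht0 : t ≠ 0 := ht.1.ne'
    rw [hsymm _ (hEO _ hm) (fderiv ℝ E (t • v) v)] at hslope
    simp only [map_smul, _root_.smul_apply, smul_eq_mul] at hg
    have hg' : h (E (t • v)) (fderiv ℝ (fderiv ℝ E) (t • v) v v) (fderiv ℝ E (t • v) v) =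
        - (1 / 2) * fderiv ℝ h (E (t • v)) (fderiv ℝ E (t • v) v) (fderiv ℝ E (t • v) v)
          (fderiv ℝ E (t • v) v) := by
      have ht2 : t * t ≠ 0 := mul_ne_zero ht0 ht0
      apply mul_left_cancel₀ ht2
      linarith
    rw [hg'] at hslope
    simp only [one_smul, zero_smul, hE0, hfder0, ContinuousLinearMap.id_apply, sub_zero,
      div_one] at hslope
    linarith
  have hp := fun u (hu : u ∈ Metric.ball (0 : V) r) =>
    HasFDerivAt.bilinear_apply (hhE u hu) (hy u hu) (hZ w u hu)
  have he := fun u (hu : u ∈ Metric.ball (0 : V) r) =>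
    HasFDerivAt.bilinear_apply (hhE u hu) (hy u hu) (hy u hu)
  -- The pairing and the linear function `u ↦ h 0 u w` both vanish at the origin; it remains to see
  -- that their radial derivatives agree.
  have hconst := eq_of_radial_derivative_eq_zero (r := r)
    (f := fun u => h (E u) (fderiv ℝ E u u) (fderiv ℝ E u w) - (h 0).flip w u)
    (fun u hu => (hp u hu).1.sub ((h 0).flip w).differentiableAt) ?_ hu
  · simp only [map_zero, _root_.zero_apply, sub_zero, ContinuousLinearMap.flip_apply] at hconst
    linarith
  intro u hu
  rw [fderiv_fun_sub (hp u hu).1 ((h 0).flip w).differentiableAt,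
    ContinuousLinearMap.fderiv, _root_.sub_apply, (hp u hu).2 u]
  have hE0mem : (0 : V) ∈ Metric.ball (0 : V) r := Metric.mem_ball_self hr
  have h0O : (0 : V) ∈ O := hE0 ▸ hEO 0 hE0mem
  -- The energy identity holds for all vectors of the ball, so it may be differentiated in the
  -- direction `w`. With the geodesic equation and the symmetry of the second derivative of `E`, it
  -- yields the radial derivative of the pairing.
  have hew : fderiv ℝ (fun u => h (E u) (fderiv ℝ E u u) (fderiv ℝ E u u)) u w = 2 * h 0 u w := by
    have h1 : (fun u => h (E u) (fderiv ℝ E u u) (fderiv ℝ E u u)) =ᶠ[𝓝 u] fun u => h 0 u u := by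
      filter_upwards [Metric.isOpen_ball.mem_nhds hu] with v hv using henergy v hv
    have h2 := HasFDerivAt.bilinear_apply (hasFDerivAt_const (h 0) u) (hasFDerivAt_id u)
      (hasFDerivAt_id u)
    rw [h1.fderiv_eq]
    have h3 := h2.2 w
    simp only [id_eq] at h3
    rw [h3]
    simp only [_root_.zero_apply, ContinuousLinearMap.id_apply]
    rw [hsymm 0 h0O w u]
    ring
  rw [(he u hu).2 w] at hew
  have hg := hgeo u hu (fderiv ℝ E u w)
  simp only [_root_.add_apply, ContinuousLinearMap.flip_apply,
    ContinuousLinearMap.comp_apply, map_add] at hew ⊢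
  rw [hsymm _ (hEO u hu) (fderiv ℝ E u w) (fderiv ℝ E u u),
    hsymm _ (hEO u hu) (fderiv ℝ (fderiv ℝ E) u w u) (fderiv ℝ E u u)] at hew
  rw [hsymE u hu u w, hg]
  linarith

end Gauss

/-! ### Normal coordinates -/

section NormalCoordinates

set_option synthInstance.maxHeartbeats 400000
set_option maxHeartbeats 1000000
set_option maxSynthPendingDepth 3

variable {V : Type} [NormedAddCommGroup V] [NormedSpace ℝ V] [FiniteDimensional ℝ V]

/-- A definite bilinear form on a finite-dimensional space induces an isomorphism with the dual. -/
theorem exists_equiv_dual_of_definite {V : Type*} [NormedAddCommGroup V] [NormedSpace ℝ V]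
    [FiniteDimensional ℝ V] (B : V →L[ℝ] V →L[ℝ] ℝ) (hB : ∀ u, B u u = 0 → u = 0) :
    ∃ e : V ≃L[ℝ] (V →L[ℝ] ℝ), (e : V →L[ℝ] V →L[ℝ] ℝ) = B := by
  have hinj : Function.Injective (B : V →ₗ[ℝ] V →L[ℝ] ℝ) := by
    rw [← LinearMap.ker_eq_bot, LinearMap.ker_eq_bot']
    intro u hu
    refine hB u ?_
    have : B u = 0 := hu
    rw [this]; rfl
  have hdim : Module.finrank ℝ V = Module.finrank ℝ (V →L[ℝ] ℝ) := by
    rw [← (LinearMap.toContinuousLinearMap : (V →ₗ[ℝ] ℝ) ≃ₗ[ℝ] V →L[ℝ] ℝ).finrank_eq]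
    exact Subspace.dual_finrank_eq.symm
  let e := LinearMap.linearEquivOfInjective (B : V →ₗ[ℝ] V →L[ℝ] ℝ) hinj hdim
  refine ⟨e.toContinuousLinearEquiv, ?_⟩
  ext u w
  rfl

/-- The covector `w ↦ (D_u h)(u, w) - (D_w h)(u, u) / 2` of the geodesic equation. -/
def christoffelForm (h : V → V →L[ℝ] V →L[ℝ] ℝ) (p : V × V) : V →L[ℝ] ℝ :=
  fderiv ℝ h p.1 p.2 p.2 - (1 / 2 : ℝ) • ((fderiv ℝ h p.1).flip p.2).flip p.2

omit [FiniteDimensional ℝ V] in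
theorem christoffelForm_apply (h : V → V →L[ℝ] V →L[ℝ] ℝ) (p : V × V) (w : V) :
    christoffelForm h p w = fderiv ℝ h p.1 p.2 p.2 w - 1 / 2 * fderiv ℝ h p.1 w p.2 p.2 := by
  simp [christoffelForm]

omit [FiniteDimensional ℝ V] in
theorem christoffelForm_smul (h : V → V →L[ℝ] V →L[ℝ] ℝ) (x u : V) (s : ℝ) :
    christoffelForm h (x, s • u) = s ^ 2 • christoffelForm h (x, u) := by
  ext w
  simp [christoffelForm_apply]
  ring

theorem contDiffOn_christoffelForm {h : V → V →L[ℝ] V →L[ℝ] ℝ} {O : Set V} (hO : IsOpen O)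
    (hh : ContDiffOn ℝ ∞ h O) : ContDiffOn ℝ ∞ (christoffelForm h) (O ×ˢ Set.univ) := by
  rw [contDiffOn_clm_apply]
  intro w
  have h1 : ContDiffOn ℝ ∞ (fun p : V × V => fderiv ℝ h p.1) (O ×ˢ Set.univ) :=
    (hh.fderiv_of_isOpen hO (m := ∞) (by simp)).comp contDiff_fst.contDiffOn fun p hp => hp.1
  have h2 : ContDiffOn ℝ ∞ (fun p : V × V => p.2) (O ×ˢ Set.univ) := contDiff_snd.contDiffOn
  have h3 := ((h1.clm_apply h2).clm_apply h2).clm_apply (contDiffOn_const (c := w))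
  have h4 := ((h1.clm_apply (contDiffOn_const (c := w))).clm_apply h2).clm_apply h2
  refine (h3.sub (contDiffOn_const (c := (1 / 2 : ℝ)).mul h4)).congr fun p _ => ?_
  rw [christoffelForm_apply]

/-- Existence of normal coordinates at the origin for a Riemannian metric `h` near `0`: in these
coordinates the metric pairs the radial direction with any vector as in the origin. -/
theorem exists_normal_coordinates {h : V → V →L[ℝ] V →L[ℝ] ℝ} {O : Set V} (hO : IsOpen O)
    (h0 : (0 : V) ∈ O) (hh : ContDiffOn ℝ ∞ h O) (hsymm : ∀ x ∈ O, ∀ u v, h x u v = h x v u)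
    (hpos : ∀ x ∈ O, ∀ u, h x u u = 0 → u = 0) :
    ∃ Φ : OpenPartialHomeomorph V V, (0 : V) ∈ Φ.source ∧ Φ 0 = 0 ∧ Φ.target ⊆ O ∧
      ContDiffOn ℝ ∞ Φ Φ.source ∧ ContDiffOn ℝ ∞ Φ.symm Φ.target ∧
      ∀ u ∈ Φ.source, ∀ w, h (Φ u) (fderiv ℝ Φ u u) (fderiv ℝ Φ u w) = h 0 u w := by
  let b₀ : V × V → V := fun p => (h p.1).inverse (christoffelForm h p)
  have hb₀ : ContDiffOn ℝ ∞ b₀ (O ×ˢ Set.univ) := by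
    have h1 : ContDiffOn ℝ ∞ (fun x => (h x).inverse) O := by
      intro x hx
      obtain ⟨e, he⟩ := exists_equiv_dual_of_definite (h x) (hpos x hx)
      have h2 : ContDiffAt ℝ ∞ ContinuousLinearMap.inverse (h x) := he ▸ contDiffAt_map_inverse e
      exact (h2.comp x (hh.contDiffAt (hO.mem_nhds hx))).contDiffWithinAt
    exact (h1.comp contDiff_fst.contDiffOn fun p hp => hp.1).clm_apply
      (contDiffOn_christoffelForm hO hh)
  have hb₀h : ∀ x ∈ O, ∀ u w, h x (b₀ (x, u)) w = christoffelForm h (x, u) w := by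
    intro x hx u w
    obtain ⟨e, he⟩ := exists_equiv_dual_of_definite (h x) (hpos x hx)
    simp only [b₀]
    rw [← he, ContinuousLinearMap.inverse_equiv]
    exact DFunLike.congr_fun (e.apply_symm_apply _) w
  obtain ⟨χ, hχ, hχ1, hχ0⟩ := exists_contDiff_cutoff (isClosed_singleton (x := (0 : V))) hO
    (Set.singleton_subset_iff.2 h0)
  -- The cutoff depends on the position only, so the spray becomes globally smooth and stays
  -- quadratic in the velocity.
  let b : V × V → V := fun p => χ p.1 • b₀ p
  have hb : ContDiff ℝ ∞ b := by
    refine hb₀.cutoff_smul (hO.prod isOpen_univ) (hχ.comp contDiff_fst) ?_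
    rw [eventually_nhdsSet_iff_forall] at hχ0 ⊢
    intro p hp
    have hp1 : p.1 ∈ Oᶜ := fun h => hp ⟨h, Set.mem_univ _⟩
    exact continuousAt_fst.eventually (hχ0 p.1 hp1)
  have hquad : ∀ (x u : V) (s : ℝ), b (x, s • u) = s ^ 2 • b (x, u) := by
    intro x u s
    simp only [b, b₀, christoffelForm_smul, map_smul]
    rw [smul_comm]
  have : CompleteSpace V := FiniteDimensional.complete ℝ V
  obtain ⟨r₀, E, hr₀, hE, hE0, hE', hgeo⟩ := exists_exponential_of_spray hb hquad
  rw [nhdsSet_singleton] at hχ1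
  have hev : ∀ᶠ u in 𝓝 (0 : V), χ (E u) = 1 ∧ E u ∈ O := by
    have hc : Filter.Tendsto E (𝓝 0) (𝓝 0) := by
      have := hE'.continuousAt.tendsto
      rwa [hE0] at this
    exact hc.eventually (hχ1.and (hO.mem_nhds h0))
  obtain ⟨r₁, hr₁, hball⟩ := Metric.eventually_nhds_iff_ball.1 hev
  let r := min r₀ r₁
  have hr : 0 < r := lt_min hr₀ hr₁
  have hsub : Metric.ball (0 : V) r ⊆ Metric.ball 0 r₀ := Metric.ball_subset_ball (min_le_left _ _)
  have hsub' : Metric.ball (0 : V) r ⊆ Metric.ball 0 r₁ := Metric.ball_subset_ball (min_le_right _ _)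
  obtain ⟨Φ, hΦ0, hΦs, hΦE, -, hΦsymm⟩ := (hE.mono hsub).exists_openPartialHomeomorph
    Metric.isOpen_ball (Metric.mem_ball_self hr) (e := ContinuousLinearEquiv.refl ℝ V) hE'
  have hΦfun : (Φ : V → V) = E := funext hΦE
  refine ⟨Φ, hΦ0, by rw [hΦE, hE0], ?_, ?_, hΦsymm, ?_⟩
  · intro y hy
    have h1 := Φ.map_target hy
    have h2 := (hball _ (hsub' (hΦs h1))).2
    rwa [← hΦE, Φ.right_inv hy] at h2
  · rw [hΦfun]
    exact hE.mono (hΦs.trans hsub)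
  · intro u hu w
    rw [hΦfun]
    refine gauss_lemma hr hO hh hsymm (hE.mono hsub) hE0 hE'
      (fun u hu => (hball u (hsub' hu)).2) ?_ (hΦs hu) w
    intro u hu w
    rw [hgeo u (hsub hu), map_neg, _root_.neg_apply]
    simp only [b, (hball u (hsub' hu)).1, one_smul]
    rw [hb₀h _ (hball u (hsub' hu)).2, christoffelForm_apply]

end NormalCoordinates

/-! ### Countable sets and isolated points -/

section Countability

theorem Relation.ReflTransGen.countable_setOf {α : Type*} {r : α → α → Prop}
    (h : ∀ a, {b | r a b}.Countable) (a : α) : {b | Relation.ReflTransGen r a b}.Countable := by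
  let R : ℕ → Set α := fun m => Nat.rec {a} (fun _ s => ⋃ c ∈ s, {b | r c b}) m
  have hR : ∀ m, (R m).Countable := by
    intro m
    induction m with
    | zero => exact Set.countable_singleton a
    | succ m ih => exact ih.biUnion fun c _ => h c
  refine (Set.countable_iUnion hR).mono fun b hb => ?_
  have hb' : Relation.ReflTransGen r a b := hb
  induction hb' with
  | refl => exact Set.mem_iUnion.2 ⟨0, rfl⟩
  | tail hab hbc ih =>
    obtain ⟨m, hm⟩ := Set.mem_iUnion.1 (ih hab)
    exact Set.mem_iUnion.2 ⟨m + 1, Set.mem_biUnion hm hbc⟩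

theorem Set.Countable.image_of_locally_const {X Y : Type*} [TopologicalSpace X]
    [SecondCountableTopology X] {f : X → Y} {s : Set X}
    (h : ∀ x ∈ s, ∀ᶠ z in 𝓝[s] x, f z = f x) : (f '' s).Countable := by
  obtain ⟨t, -, htc, hst⟩ := TopologicalSpace.countable_cover_nhdsWithin h
  refine (htc.image f).mono ?_
  rintro _ ⟨x, hx, rfl⟩
  obtain ⟨y, hy, hxy⟩ := Set.mem_iUnion₂.1 (hst hx)
  exact ⟨y, hy, Eq.symm hxy⟩

/-- Baire category: a countable compact Hausdorff space is a countable union of closed points, so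
the union of their interiors is dense. -/
theorem IsCompact.exists_isolated_of_countable {X : Type*} [TopologicalSpace X] [T2Space X]
    {S W : Set X} (hS : IsCompact S) (hc : S.Countable) (hW : IsOpen W) (hne : (S ∩ W).Nonempty) :
    ∃ x ∈ S ∩ W, ∀ᶠ y in 𝓝 x, y ∈ S → y = x := by
  have : CompactSpace S := isCompact_iff_compactSpace.1 hS
  have : Countable S := hc.to_subtype
  have hd : Dense (⋃ x : S, interior ({x} : Set S)) :=
    dense_iUnion_interior_of_closed (fun x => isClosed_singleton) (Set.iUnion_of_singleton S)
  obtain ⟨x, hxS, hxW⟩ := hne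
  obtain ⟨y, hyW, hy⟩ := hd.inter_open_nonempty (Subtype.val ⁻¹' W)
    (hW.preimage continuous_subtype_val) ⟨⟨x, hxS⟩, hxW⟩
  obtain ⟨z, hz⟩ := Set.mem_iUnion.1 hy
  have hyz : y = z := Set.mem_singleton_iff.1 (interior_subset hz)
  subst hyz
  refine ⟨y, ⟨y.2, hyW⟩, ?_⟩
  have h1 : ({y} : Set S) ∈ 𝓝 y := mem_interior_iff_mem_nhds.1 hz
  rw [nhds_subtype_eq_comap, Filter.mem_comap] at h1
  obtain ⟨t, ht, hts⟩ := h1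
  filter_upwards [ht] with w hw hwS
  exact congrArg Subtype.val (Set.mem_singleton_iff.1 (hts (show (⟨w, hwS⟩ : S) ∈ _ from hw)))

end Countability

/-! ### A closed leaf is locally a single plaque -/

namespace SmoothFoliation

variable {n p q : ℕ} {M : Type*} [TopologicalSpace M] [ChartedSpace (Euc n) M]

theorem symm_mem_plaque {φ : OpenPartialHomeomorph M (Euc p × Euc q)} {C : Set (Euc p)}
    (hC : IsPreconnected C) {y : Euc q} (hsub : C ×ˢ {y} ⊆ φ.target) {x x' : Euc p}
    (hx : x ∈ C) (hx' : x' ∈ C) : φ.symm (x', y) ∈ plaque φ (φ.symm (x, y)) := by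
  have h1 : IsPreconnected (φ.symm '' (C ×ˢ {y})) :=
    (hC.prod isPreconnected_singleton).image _ (φ.continuousOn_symm.mono hsub)
  refine h1.subset_connectedComponentIn ⟨(x, y), ⟨hx, rfl⟩, rfl⟩ ?_ ⟨(x', y), ⟨hx', rfl⟩, rfl⟩
  rintro _ ⟨⟨u, v⟩, ⟨hu, rfl⟩, rfl⟩
  have h2 := hsub (Set.mk_mem_prod hu (Set.mem_singleton v))
  have h3 := hsub (Set.mk_mem_prod hx (Set.mem_singleton v))
  refine ⟨φ.map_target h2, ?_⟩
  rw [φ.right_inv h2, φ.right_inv h3]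

theorem mem_leaf_of_mem_plaque (F : SmoothFoliation n p q M) {x₀ a b : M} (ha : a ∈ F.leaf x₀)
    {φ : OpenPartialHomeomorph M (Euc p × Euc q)} (hφ : φ ∈ F.charts) (has : a ∈ φ.source)
    (hb : b ∈ plaque φ a) : b ∈ F.leaf x₀ :=
  Relation.ReflTransGen.tail ha ⟨φ, hφ, has, hb⟩

theorem symm_mem_leaf (F : SmoothFoliation n p q M) {x₀ : M}
    {φ : OpenPartialHomeomorph M (Euc p × Euc q)} (hφ : φ ∈ F.charts) {C : Set (Euc p)}
    (hC : IsPreconnected C) {y : Euc q} (hsub : C ×ˢ {y} ⊆ φ.target) {x x' : Euc p}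
    (hx : x ∈ C) (hx' : x' ∈ C) (h : φ.symm (x, y) ∈ F.leaf x₀) :
    φ.symm (x', y) ∈ F.leaf x₀ :=
  F.mem_leaf_of_mem_plaque h hφ (φ.map_target (hsub (Set.mk_mem_prod hx rfl)))
    (symm_mem_plaque hC hsub hx hx')

theorem eventually_transverse_eq (F : SmoothFoliation n p q M)
    {φ ψ : OpenPartialHomeomorph M (Euc p × Euc q)} (hφ : φ ∈ F.charts) (hψ : ψ ∈ F.charts)
    {x : M} (hx : x ∈ φ.source) (hx' : x ∈ ψ.source) :
    ∀ᶠ z in 𝓝 x, (φ z).2 = (φ x).2 → (ψ z).2 = (ψ x).2 := by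
  obtain ⟨g, hg⟩ := F.compat φ hφ ψ hψ (φ x) ⟨φ.map_source hx, by
    simpa [φ.left_inv hx] using hx'⟩
  have h1 := (φ.continuousAt hx).eventually hg
  have h2 := h1.self_of_nhds
  filter_upwards [h1, φ.open_source.mem_nhds hx] with z hz hzs hzx
  rw [φ.left_inv hzs] at hz
  rw [φ.left_inv hx] at h2
  rw [hz, h2, hzx]

/-- A product box around a point in the target of a foliated chart. -/
theorem exists_box {φ : OpenPartialHomeomorph M (Euc p × Euc q)} {w : Euc p × Euc q}
    (hw : w ∈ φ.target) :
    ∃ r > 0, Metric.ball w.1 r ×ˢ Metric.ball w.2 r ⊆ φ.target := by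
  obtain ⟨r, hr, h⟩ := Metric.mem_nhds_iff.1 (φ.open_target.mem_nhds hw)
  exact ⟨r, hr, by rwa [ball_prod_same]⟩

/-- A property of points that is locally constant along the level sets of the transverse coordinate
is constant along plaques. -/
theorem iff_of_mem_plaque {φ : OpenPartialHomeomorph M (Euc p × Euc q)} {D : M → Prop}
    {a b : M} (ha : a ∈ φ.source)
    (hD : ∀ c ∈ φ.source, ∀ᶠ z in 𝓝 c, (φ z).2 = (φ c).2 → (D c ↔ D z))
    (hb : b ∈ plaque φ a) : D a ↔ D b := by
  have hpre : IsPreconnected (plaque φ a) := isPreconnected_connectedComponentIn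
  have haS : a ∈ plaque φ a := mem_connectedComponentIn ⟨ha, rfl⟩
  have hsub : plaque φ a ⊆ {y | y ∈ φ.source ∧ (φ y).2 = (φ a).2} :=
    connectedComponentIn_subset _ _
  refine hpre.induction₂ (fun x y => D x ↔ D y) ?_ (fun x y z _ _ _ h1 h2 => h1.trans h2)
    (fun x y _ _ h => h.symm) haS hb
  intro x hx
  have h1 := hD x (hsub hx).1
  filter_upwards [nhdsWithin_le_nhds h1, self_mem_nhdsWithin] with z hz hzS
  exact hz ((hsub hzS).2.trans (hsub hx).2.symm)

/-- The counting uses whole level sets of the transverse coordinates of finitely many charts instead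
of plaques. On a level set of one chart the transverse coordinate of another is locally constant, so
by second countability it takes countably many values. Hence finite chains of level sets reach only
countably many of them, and these cover the leaf. -/
theorem countable_transverse_image_leaf [CompactSpace M] [SecondCountableTopology M]
    (F : SmoothFoliation n p q M) (x₀ : M) {φ : OpenPartialHomeomorph M (Euc p × Euc q)}
    (hφ : φ ∈ F.charts) : ((fun z => (φ z).2) '' (F.leaf x₀ ∩ φ.source)).Countable := by
  choose ψ hψ hψs using F.covers
  obtain ⟨T, hT⟩ := isCompact_univ.elim_nhds_subcover (fun x : M => (ψ x).source)
    (fun x _ => (ψ x).open_source.mem_nhds (hψs x))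
  have hcov : ∀ z : M, ∃ m ∈ T, z ∈ (ψ m).source := by
    intro z
    simpa using hT.2 (Set.mem_univ z)
  have hlc : ∀ (χ : OpenPartialHomeomorph M (Euc p × Euc q)), χ ∈ F.charts → ∀ (m : M) (y : Euc q),
      ((fun z => (χ z).2) '' ({z | z ∈ (ψ m).source ∧ (ψ m z).2 = y} ∩ χ.source)).Countable := by
    intro χ hχ m y
    refine Set.Countable.image_of_locally_const fun x hx => ?_
    filter_upwards [nhdsWithin_le_nhds (F.eventually_transverse_eq (hψ m) hχ hx.1.1 hx.2),
      self_mem_nhdsWithin] with z hz hzS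
    exact hz (hzS.1.2.trans hx.1.2.symm)
  let Pl : M × Euc q → Set M := fun a => {z | z ∈ (ψ a.1).source ∧ (ψ a.1 z).2 = a.2}
  let r : M × Euc q → M × Euc q → Prop := fun a b => b.1 ∈ T ∧ (Pl a ∩ Pl b).Nonempty
  have hr : ∀ a, {b | r a b}.Countable := by
    intro a
    have h1 : (⋃ m ∈ T, (fun y => (m, y)) ''
        ((fun z => (ψ m z).2) '' (Pl a ∩ (ψ m).source))).Countable :=
      T.countable_toSet.biUnion fun m _ => (hlc (ψ m) (hψ m) a.1 a.2).image _
    refine h1.mono ?_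
    rintro ⟨m, y⟩ ⟨hm, z, hza, hzb⟩
    exact Set.mem_biUnion hm ⟨y, ⟨z, ⟨hza, hzb.1⟩, hzb.2⟩, rfl⟩
  obtain ⟨m₀, hm₀, hx₀⟩ := hcov x₀
  let R : Set (M × Euc q) := {b | Relation.ReflTransGen r (m₀, (ψ m₀ x₀).2) b}
  have hR : R.Countable := Relation.ReflTransGen.countable_setOf hr _
  have hleaf : F.leaf x₀ ⊆ {z | ∃ a ∈ R, z ∈ Pl a} := by
    intro z hz
    have hz' : Relation.ReflTransGen _ x₀ z := hz
    induction hz' with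
    | refl => exact ⟨_, Relation.ReflTransGen.refl, hx₀, rfl⟩
    | @tail a b hab hbc ih =>
      obtain ⟨χ, hχ, haχ, hbχ⟩ := hbc
      -- Lying in a reached level set is locally constant along the levels of `χ`, so it spreads
      -- over the plaque.
      refine (iff_of_mem_plaque (D := fun z => ∃ a ∈ R, z ∈ Pl a) haχ ?_ hbχ).1 (ih hab)
      intro c hc
      obtain ⟨m, hm, hcm⟩ := hcov c
      filter_upwards [F.eventually_transverse_eq hχ (hψ m) hc hcm,
        (ψ m).open_source.mem_nhds hcm] with c' hc' hcm' heq
      have key : ∀ u v : M, u ∈ (ψ m).source → v ∈ (ψ m).source → (ψ m u).2 = (ψ m v).2 →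
          (∃ a ∈ R, u ∈ Pl a) → ∃ a ∈ R, v ∈ Pl a := by
        rintro u v hu hv huv ⟨a, haR, hua⟩
        exact ⟨(m, (ψ m u).2), Relation.ReflTransGen.tail haR ⟨hm, u, hua, hu, rfl⟩, hv, huv.symm⟩
      exact ⟨key c c' hcm hcm' (hc' heq).symm, key c' c hcm' hcm (hc' heq)⟩
  refine (hR.biUnion fun a _ => hlc φ hφ a.1 a.2).mono ?_
  rintro _ ⟨z, ⟨hzL, hzs⟩, rfl⟩
  obtain ⟨a, haR, hza⟩ := hleaf hzL
  exact Set.mem_biUnion haR ⟨z, ⟨hza, hzs⟩, rfl⟩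

/-- Near `z`, the set `L` is contained in one level set of the transverse coordinates. -/
def IsTransverselyIsolatedAt (F : SmoothFoliation n p q M) (L : Set M) (z : M) : Prop :=
  ∃ φ ∈ F.charts, z ∈ φ.source ∧ ∀ᶠ w in 𝓝 z, w ∈ L → (φ w).2 = (φ z).2

theorem IsTransverselyIsolatedAt.eventually_eq {F : SmoothFoliation n p q M} {L : Set M} {z : M}
    (h : F.IsTransverselyIsolatedAt L z) {φ : OpenPartialHomeomorph M (Euc p × Euc q)}
    (hφ : φ ∈ F.charts) (hz : z ∈ φ.source) : ∀ᶠ w in 𝓝 z, w ∈ L → (φ w).2 = (φ z).2 := by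
  obtain ⟨ψ, hψ, hzψ, hev⟩ := h
  filter_upwards [hev, F.eventually_transverse_eq hψ hφ hzψ hz] with w h1 h2 hw using h2 (h1 hw)

/-- In a product box, membership in a leaf depends only on the transverse coordinate, so isolation
can be tested on one slice. -/
theorem isTransverselyIsolatedAt_of_slice (F : SmoothFoliation n p q M) {x₀ : M}
    {φ : OpenPartialHomeomorph M (Euc p × Euc q)} (hφ : φ ∈ F.charts) {a : Euc p} {c : M}
    (hc : c ∈ φ.source) {r : ℝ}
    (hbox : Metric.ball a r ×ˢ Metric.ball (φ c).2 r ⊆ φ.target) (hca : (φ c).1 ∈ Metric.ball a r)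
    (h : ∀ᶠ y in 𝓝 (φ c).2, φ.symm (a, y) ∈ F.leaf x₀ → y = (φ c).2) :
    F.IsTransverselyIsolatedAt (F.leaf x₀) c := by
  have hr : 0 < r := Metric.pos_of_mem_ball hca
  refine ⟨φ, hφ, hc, ?_⟩
  have hcont : ContinuousAt (fun z => φ z) c := φ.continuousAt hc
  filter_upwards [(continuousAt_snd.comp hcont).eventually h, φ.open_source.mem_nhds hc,
    (continuousAt_fst.comp hcont).preimage_mem_nhds (Metric.isOpen_ball.mem_nhds hca),
    (continuousAt_snd.comp hcont).preimage_mem_nhds (Metric.ball_mem_nhds _ hr)]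
    with z hz hzs hz1 hz2 hzL
  refine hz ?_
  have hsub : Metric.ball a r ×ˢ {(φ z).2} ⊆ φ.target := by
    rintro ⟨u, v⟩ ⟨hu, hv⟩
    refine hbox ⟨hu, ?_⟩
    rw [Set.mem_singleton_iff] at hv
    exact hv ▸ hz2
  refine F.symm_mem_leaf hφ (convex_ball a r).isPreconnected hsub hz1 (Metric.mem_ball_self hr) ?_
  simpa [φ.left_inv hzs] using hzL

/-- Within a box, isolation passes between points of one level through the central slice, because
leaves are saturated there; connectedness of the plaque does the rest. -/
theorem isTransverselyIsolatedAt_iff_of_mem_plaque (F : SmoothFoliation n p q M) {x₀ : M}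
    {φ : OpenPartialHomeomorph M (Euc p × Euc q)} (hφ : φ ∈ F.charts) {a b : M}
    (ha : a ∈ φ.source) (hb : b ∈ plaque φ a) :
    F.IsTransverselyIsolatedAt (F.leaf x₀) a ↔ F.IsTransverselyIsolatedAt (F.leaf x₀) b := by
  refine iff_of_mem_plaque ha ?_ hb
  intro c hc
  obtain ⟨r, hr, hbox⟩ := exists_box (φ.map_source hc)
  have hcont : ContinuousAt (fun z => φ z) c := φ.continuousAt hc
  have key : ∀ u v : M, u ∈ φ.source → v ∈ φ.source → (φ u).1 ∈ Metric.ball (φ c).1 (r / 2) →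
      (φ v).1 ∈ Metric.ball (φ c).1 (r / 2) → (φ u).2 = (φ c).2 → (φ v).2 = (φ c).2 →
      F.IsTransverselyIsolatedAt (F.leaf x₀) u → F.IsTransverselyIsolatedAt (F.leaf x₀) v := by
    intro u v hu hv hu1 hv1 hu2 hv2 hiso
    have hsub : Metric.ball (φ u).1 (r / 2) ⊆ Metric.ball (φ c).1 r := by
      refine Metric.ball_subset_ball' ?_
      have := Metric.mem_ball.1 hu1
      linarith
    have h1 : ∀ᶠ y in 𝓝 (φ u).2, φ.symm ((φ u).1, y) ∈ F.leaf x₀ → y = (φ u).2 := by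
      have h2 : ContinuousAt (fun y => φ.symm ((φ u).1, y)) (φ u).2 := by
        refine ContinuousAt.comp (f := fun y => ((φ u).1, y)) ?_ (by fun_prop)
        exact φ.continuousAt_symm (φ.map_source hu)
      have h3 : Filter.Tendsto (fun y => φ.symm ((φ u).1, y)) (𝓝 (φ u).2) (𝓝 u) := by
        have := h2.tendsto
        rwa [show φ.symm ((φ u).1, (φ u).2) = u from φ.left_inv hu] at this
      have h4 : ∀ᶠ y in 𝓝 (φ u).2, ((φ u).1, y) ∈ φ.target :=
        (show ContinuousAt (fun y => ((φ u).1, y)) (φ u).2 by fun_prop).preimage_mem_nhds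
          (φ.open_target.mem_nhds (φ.map_source hu))
      filter_upwards [h3.eventually (hiso.eventually_eq hφ hu), h4] with y hy hy' hyL
      have := hy hyL
      rwa [φ.right_inv hy'] at this
    refine F.isTransverselyIsolatedAt_of_slice hφ (a := (φ c).1) (r := r) hv ?_
      (Metric.ball_subset_ball (by linarith) hv1) ?_
    · rw [hv2]; exact hbox
    · rw [hv2, ← hu2]
      filter_upwards [h1, Metric.ball_mem_nhds (φ u).2 hr] with y hy hyr hyL
      refine hy ?_
      have hsub' : Metric.ball (φ c).1 r ×ˢ {y} ⊆ φ.target := by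
        rintro ⟨s, t⟩ ⟨hs, ht⟩
        refine hbox ⟨hs, ?_⟩
        rw [Set.mem_singleton_iff] at ht
        rw [← hu2]
        exact ht ▸ hyr
      exact F.symm_mem_leaf hφ (convex_ball _ r).isPreconnected hsub'
        (Metric.mem_ball_self hr) (Metric.ball_subset_ball (by linarith) hu1) hyL
  filter_upwards [φ.open_source.mem_nhds hc, (continuousAt_fst.comp hcont).preimage_mem_nhds
    (Metric.ball_mem_nhds _ (half_pos hr))] with z hzs hz1 hz2
  exact ⟨key c z hc hzs (Metric.mem_ball_self (half_pos hr)) hz1 rfl hz2,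
    key z c hzs hc hz1 (Metric.mem_ball_self (half_pos hr)) hz2 rfl⟩

/-- A closed leaf of a foliation of a compact manifold meets the foliated charts around its points
locally in one plaque only. -/
theorem isTransverselyIsolatedAt_leaf [CompactSpace M] [SecondCountableTopology M]
    (F : SmoothFoliation n p q M) {x₀ : M} (hclosed : IsClosed (F.leaf x₀)) {z : M}
    (hz : z ∈ F.leaf x₀) : F.IsTransverselyIsolatedAt (F.leaf x₀) z := by
  have hiff : ∀ y ∈ F.leaf x₀, (F.IsTransverselyIsolatedAt (F.leaf x₀) x₀ ↔
      F.IsTransverselyIsolatedAt (F.leaf x₀) y) := by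
    intro y hy
    have hy' : Relation.ReflTransGen _ x₀ y := hy
    induction hy' with
    | refl => exact Iff.rfl
    | tail hab hbc ih =>
      obtain ⟨χ, hχ, haχ, hbχ⟩ := hbc
      exact (ih hab).trans (F.isTransverselyIsolatedAt_iff_of_mem_plaque hχ haχ hbχ)
  suffices ∃ c ∈ F.leaf x₀, F.IsTransverselyIsolatedAt (F.leaf x₀) c by
    obtain ⟨c, hc, hiso⟩ := this
    exact (hiff z hz).1 ((hiff c hc).2 hiso)
  obtain ⟨φ, hφ, hx₀⟩ := F.covers x₀
  obtain ⟨r, hr, hbox⟩ := exists_box (φ.map_source hx₀)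
  have hslice : ∀ y ∈ Metric.ball (φ x₀).2 r, ((φ x₀).1, y) ∈ φ.target := fun y hy =>
    hbox ⟨Metric.mem_ball_self hr, hy⟩
  have hcb : Metric.closedBall (φ x₀).2 (r / 2) ⊆ Metric.ball (φ x₀).2 r :=
    Metric.closedBall_subset_ball (by linarith)
  -- The leaf cuts the slice in a compact countable set, which has an isolated point. Isolation at
  -- one point of the leaf propagates to all by `hiff`.
  let S : Set (Euc q) := Metric.closedBall (φ x₀).2 (r / 2) ∩
    (fun y => φ.symm ((φ x₀).1, y)) ⁻¹' F.leaf x₀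
  have hcontS : ContinuousOn (fun y => φ.symm ((φ x₀).1, y)) (Metric.closedBall (φ x₀).2 (r / 2)) :=
    φ.continuousOn_symm.comp (by fun_prop) fun y hy => hslice y (hcb hy)
  have hScomp : IsCompact S := (isCompact_closedBall _ _).of_isClosed_subset
    (hcontS.preimage_isClosed_of_isClosed Metric.isClosed_closedBall hclosed) Set.inter_subset_left
  have hScount : S.Countable := by
    refine (F.countable_transverse_image_leaf x₀ hφ).mono ?_
    intro y hy
    have ht := hslice y (hcb hy.1)
    exact ⟨φ.symm ((φ x₀).1, y), ⟨hy.2, φ.map_target ht⟩, by simp only [φ.right_inv ht]⟩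
  -- The point is sought in the open ball, so that being isolated in `S` means being isolated in the
  -- slice.
  obtain ⟨y, ⟨hyS, hyW⟩, hiso⟩ := hScomp.exists_isolated_of_countable hScount
    (W := Metric.ball (φ x₀).2 (r / 2)) Metric.isOpen_ball
    ⟨(φ x₀).2, ⟨Metric.mem_closedBall_self (by positivity), by
      change φ.symm (φ x₀) ∈ F.leaf x₀
      rw [φ.left_inv hx₀]
      exact Relation.ReflTransGen.refl⟩, Metric.mem_ball_self (by positivity)⟩
  have ht := hslice y (hcb hyS.1)
  refine ⟨_, hyS.2, F.isTransverselyIsolatedAt_of_slice hφ (a := (φ x₀).1) (r := r / 2)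
    (φ.map_target ht) ?_ ?_ ?_⟩
  · rw [φ.right_inv ht]
    refine subset_trans (Set.prod_mono (Metric.ball_subset_ball (by linarith))
      (Metric.ball_subset_ball' ?_)) hbox
    have := Metric.mem_ball.1 hyW
    linarith
  · rw [φ.right_inv ht]
    exact Metric.mem_ball_self (by positivity)
  · rw [φ.right_inv ht]
    filter_upwards [hiso, Metric.isOpen_ball.mem_nhds hyW] with w hw hwb hwL
    exact hw ⟨Metric.ball_subset_closedBall hwb, hwL⟩

end SmoothFoliation

/-! ### Adapted charts -/

namespace SmoothFoliation

set_option maxSynthPendingDepth 3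

variable {n p q : ℕ} {M : Type*} [TopologicalSpace M] [ChartedSpace (Euc n) M]

/-- A smooth chart of `M` with values in `ℝ^p × ℝ^q` whose second component has the tangent spaces
of the leaves as the kernels of its derivatives. -/
structure IsAdapted (F : SmoothFoliation n p q M)
    (Φ : OpenPartialHomeomorph M (Euc p × Euc q)) : Prop where
  smooth : ContMDiffOn (𝓡 n) 𝓘(ℝ, Euc p × Euc q) ∞ Φ Φ.source
  smooth_symm : ContMDiffOn 𝓘(ℝ, Euc p × Euc q) (𝓡 n) ∞ Φ.symm Φ.target
  mem_tangent_iff : ∀ x ∈ Φ.source, ∀ v : TangentSpace (𝓡 n) x,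
    v ∈ F.tangent x ↔ transverseDeriv Φ x v = 0

theorem _root_.OpenPartialHomeomorph.mdifferentiable_of_smooth
    {Φ : OpenPartialHomeomorph M (Euc p × Euc q)}
    (h : ContMDiffOn (𝓡 n) 𝓘(ℝ, Euc p × Euc q) ∞ Φ Φ.source)
    (h' : ContMDiffOn 𝓘(ℝ, Euc p × Euc q) (𝓡 n) ∞ Φ.symm Φ.target) :
    Φ.MDifferentiable (𝓡 n) 𝓘(ℝ, Euc p × Euc q) :=
  ⟨h.mdifferentiableOn (by simp), h'.mdifferentiableOn (by simp)⟩

theorem IsAdapted.mdifferentiable {F : SmoothFoliation n p q M}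
    {Φ : OpenPartialHomeomorph M (Euc p × Euc q)} (h : F.IsAdapted Φ) :
    Φ.MDifferentiable (𝓡 n) 𝓘(ℝ, Euc p × Euc q) :=
  Φ.mdifferentiable_of_smooth h.smooth h.smooth_symm

theorem transverseDeriv_apply {Φ : OpenPartialHomeomorph M (Euc p × Euc q)}
    (h : Φ.MDifferentiable (𝓡 n) 𝓘(ℝ, Euc p × Euc q)) {x : M} (hx : x ∈ Φ.source)
    (v : TangentSpace (𝓡 n) x) :
    transverseDeriv Φ x v = (mfderiv (𝓡 n) 𝓘(ℝ, Euc p × Euc q) Φ x v : Euc p × Euc q).2 := by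
  have h1 : HasMFDerivAt (𝓡 n) 𝓘(ℝ, Euc p × Euc q) Φ x _ := (h.mdifferentiableAt hx).hasMFDerivAt
  have h2 : HasMFDerivAt 𝓘(ℝ, Euc p × Euc q) 𝓘(ℝ, Euc q) (Prod.snd : Euc p × Euc q → Euc q) (Φ x)
    (ContinuousLinearMap.snd ℝ (Euc p) (Euc q)) := (hasFDerivAt_snd).hasMFDerivAt
  have h3 := (h2.comp x h1).mfderiv
  unfold transverseDeriv
  change mfderiv (𝓡 n) 𝓘(ℝ, Euc q) (Prod.snd ∘ Φ) x v = _
  rw [h3]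
  rfl

/-- The derivative of the inverse of a chart. -/
def symmDeriv (Φ : OpenPartialHomeomorph M (Euc p × Euc q)) (w : Euc p × Euc q) :
    (Euc p × Euc q) →L[ℝ] TangentSpace (𝓡 n) (Φ.symm w) :=
  mfderiv 𝓘(ℝ, Euc p × Euc q) (𝓡 n) Φ.symm w

theorem transverseDeriv_symmDeriv {Φ : OpenPartialHomeomorph M (Euc p × Euc q)}
    (h : Φ.MDifferentiable (𝓡 n) 𝓘(ℝ, Euc p × Euc q)) {w : Euc p × Euc q} (hw : w ∈ Φ.target)
    (u : Euc p × Euc q) : transverseDeriv (n := n) Φ (Φ.symm w) (symmDeriv Φ w u) = u.2 := by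
  rw [transverseDeriv_apply h (Φ.map_target hw)]
  have := h.comp_symm_deriv hw
  have h2 := DFunLike.congr_fun this u
  exact congrArg Prod.snd h2

theorem exists_symmDeriv_eq {Φ : OpenPartialHomeomorph M (Euc p × Euc q)}
    (h : Φ.MDifferentiable (𝓡 n) 𝓘(ℝ, Euc p × Euc q)) {w : Euc p × Euc q} (hw : w ∈ Φ.target)
    (v : TangentSpace (𝓡 n) (Φ.symm w)) : ∃ u, symmDeriv Φ w u = v := by
  have h1 := h.symm_comp_deriv (Φ.map_target hw)
  have h2 := DFunLike.congr_fun h1 v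
  have h3 : ∀ w', w' = w → mfderiv 𝓘(ℝ, Euc p × Euc q) (𝓡 n) Φ.symm w' =
      (mfderiv 𝓘(ℝ, Euc p × Euc q) (𝓡 n) Φ.symm w) := by
    rintro _ rfl; rfl
  refine ⟨mfderiv (𝓡 n) 𝓘(ℝ, Euc p × Euc q) Φ (Φ.symm w) v, ?_⟩
  rw [ContinuousLinearMap.comp_apply] at h2
  unfold symmDeriv
  rw [← h3 _ (Φ.right_inv hw)]
  exact h2

theorem symmDeriv_injective {Φ : OpenPartialHomeomorph M (Euc p × Euc q)}
    (h : Φ.MDifferentiable (𝓡 n) 𝓘(ℝ, Euc p × Euc q)) {w : Euc p × Euc q} (hw : w ∈ Φ.target) :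
    Function.Injective (symmDeriv Φ w : Euc p × Euc q → TangentSpace (𝓡 n) (Φ.symm w)) := by
  intro u u' huu
  have h1 := h.comp_symm_deriv hw
  have h2 := DFunLike.congr_fun h1 u
  have h3 := DFunLike.congr_fun h1 u'
  have h4 : mfderiv (𝓡 n) 𝓘(ℝ, Euc p × Euc q) Φ (Φ.symm w) (symmDeriv Φ w u) = u := h2
  rw [huu] at h4
  exact h4.symm.trans h3

/-- If the transverse coordinate of `ψ` is locally a function of the one of `φ`, then the kernels
of the derivatives are contained in one another. -/
theorem transverseDeriv_eq_zero_of_factor {φ ψ : OpenPartialHomeomorph M (Euc p × Euc q)}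
    (hφ : φ.MDifferentiable (𝓡 n) 𝓘(ℝ, Euc p × Euc q))
    (hψ : ψ.MDifferentiable (𝓡 n) 𝓘(ℝ, Euc p × Euc q)) {w : Euc p × Euc q} (hw : w ∈ φ.target)
    (hw' : φ.symm w ∈ ψ.source)
    {g : Euc q → Euc q} (hg : ∀ᶠ z in 𝓝 w, (ψ (φ.symm z)).2 = g z.2)
    {v : TangentSpace (𝓡 n) (φ.symm w)} (hv : transverseDeriv φ (φ.symm w) v = 0) :
    transverseDeriv ψ (φ.symm w) v = 0 := by
  obtain ⟨u, rfl⟩ := exists_symmDeriv_eq hφ hw v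
  rw [transverseDeriv_symmDeriv hφ hw] at hv
  rw [transverseDeriv_apply hψ hw']
  have h1 : HasMFDerivAt 𝓘(ℝ, Euc p × Euc q) (𝓡 n) φ.symm w (symmDeriv φ w) :=
    (hφ.symm.mdifferentiableAt hw).hasMFDerivAt
  have h2 : HasMFDerivAt (𝓡 n) 𝓘(ℝ, Euc p × Euc q) ψ (φ.symm w) _ :=
    (hψ.mdifferentiableAt hw').hasMFDerivAt
  have h3 := (h2.comp w h1).hasFDerivAt.snd
  obtain ⟨u₁, u₂⟩ := u
  simp only at hv
  subst hv
  -- No differentiability of `g` is available: it is only used along a line on which the transverse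
  -- coordinate is constant.
  have hline : HasDerivAt (fun s : ℝ => w + s • ((u₁, 0) : Euc p × Euc q)) (u₁, 0) 0 := by
    simpa using ((hasDerivAt_id (0 : ℝ)).smul_const ((u₁, 0) : Euc p × Euc q)).const_add w
  have h5 := h3.comp_hasDerivAt_of_eq (0 : ℝ) hline (by simp)
  have h6 : ∀ᶠ s : ℝ in 𝓝 0, (ψ (φ.symm (w + s • ((u₁, 0) : Euc p × Euc q)))).2 = g w.2 := by
    have hc : Filter.Tendsto (fun s : ℝ => w + s • ((u₁, 0) : Euc p × Euc q)) (𝓝 0) (𝓝 w) := by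
      have := hline.continuousAt.tendsto
      simpa using this
    filter_upwards [hc.eventually hg] with s hs
    rw [hs]
    simp
  have h7 := (hasDerivAt_const (0 : ℝ) (g w.2)).congr_of_eventuallyEq h6
  have h8 := h5.unique h7
  exact h8

theorem isAdapted_of_mem_charts (F : SmoothFoliation n p q M)
    {φ : OpenPartialHomeomorph M (Euc p × Euc q)} (hφ : φ ∈ F.charts) : F.IsAdapted φ where
  smooth := F.smooth φ hφ
  smooth_symm := F.smooth_symm φ hφ
  mem_tangent_iff x hx v := by
    have hd : ∀ φ ∈ F.charts, φ.MDifferentiable (𝓡 n) 𝓘(ℝ, Euc p × Euc q) := fun φ hφ =>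
      φ.mdifferentiable_of_smooth (F.smooth φ hφ) (F.smooth_symm φ hφ)
    refine ⟨fun h => h φ hφ hx, fun h ψ hψ hx' => ?_⟩
    obtain ⟨w, hw, rfl⟩ : ∃ w ∈ φ.target, φ.symm w = x := ⟨φ x, φ.map_source hx, φ.left_inv hx⟩
    obtain ⟨g, hg⟩ := F.compat φ hφ ψ hψ w ⟨hw, hx'⟩
    exact transverseDeriv_eq_zero_of_factor (hd φ hφ) (hd ψ hψ) hw hx' hg h

end SmoothFoliation

/-! ### The metric in charts and orthogonal lifts -/

namespace SmoothFoliation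

set_option maxSynthPendingDepth 3

variable {n p q : ℕ} {M : Type*} [TopologicalSpace M] [ChartedSpace (Euc n) M]
  [RiemannianBundle (fun x : M => TangentSpace (𝓡 n) x)]

variable (n) in
/-- The metric in a chart. -/
def chartMetric (Φ : OpenPartialHomeomorph M (Euc p × Euc q)) (w : Euc p × Euc q) :
    (Euc p × Euc q) →L[ℝ] (Euc p × Euc q) →L[ℝ] ℝ :=
  (innerSL ℝ (E := TangentSpace (𝓡 n) (Φ.symm w))).bilinearComp (symmDeriv Φ w) (symmDeriv Φ w)

theorem chartMetric_apply (Φ : OpenPartialHomeomorph M (Euc p × Euc q)) (w u v : Euc p × Euc q) :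
    chartMetric n Φ w u v = inner ℝ (symmDeriv (n := n) Φ w u) (symmDeriv Φ w v) := rfl

theorem chartMetric_comm (Φ : OpenPartialHomeomorph M (Euc p × Euc q)) (w u v : Euc p × Euc q) :
    chartMetric n Φ w u v = chartMetric n Φ w v u := by
  rw [chartMetric_apply, chartMetric_apply, real_inner_comm]

theorem chartMetric_pos {Φ : OpenPartialHomeomorph M (Euc p × Euc q)}
    (h : Φ.MDifferentiable (𝓡 n) 𝓘(ℝ, Euc p × Euc q)) {w : Euc p × Euc q} (hw : w ∈ Φ.target)
    {u : Euc p × Euc q} (hu : u ≠ 0) : 0 < chartMetric n Φ w u u := by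
  rw [chartMetric_apply, real_inner_self_eq_norm_sq]
  have : symmDeriv (n := n) Φ w u ≠ 0 := fun h0 =>
    hu (symmDeriv_injective h hw (h0.trans (map_zero _).symm))
  have := norm_pos_iff.2 this
  positivity

omit [RiemannianBundle (fun x : M => TangentSpace (𝓡 n) x)] in
theorem contMDiffOn_symmDeriv [IsManifold (𝓡 n) ∞ M]
    {Φ : OpenPartialHomeomorph M (Euc p × Euc q)}
    (h : ContMDiffOn 𝓘(ℝ, Euc p × Euc q) (𝓡 n) ∞ Φ.symm Φ.target) (u : Euc p × Euc q) :
    ContMDiffOn 𝓘(ℝ, Euc p × Euc q) ((𝓡 n).prod 𝓘(ℝ, Euc n)) ∞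
      (fun w => (⟨Φ.symm w, symmDeriv Φ w u⟩ : TotalSpace (Euc n) (TangentSpace (𝓡 n) : M → Type _)))
      Φ.target := by
  have h1 := h.contMDiffOn_tangentMapWithin (m := ∞) (by simp) Φ.open_target.uniqueMDiffOn
  have h2 : ContMDiffOn 𝓘(ℝ, Euc p × Euc q) (𝓘(ℝ, Euc p × Euc q).prod 𝓘(ℝ, Euc p × Euc q)) ∞
      (fun w => (⟨w, u⟩ : TangentBundle 𝓘(ℝ, Euc p × Euc q) (Euc p × Euc q))) Φ.target :=
    contMDiffOn_vectorSpace_iff_contDiffOn.2 contDiffOn_const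
  have h3 := h1.comp h2 (fun w hw => hw)
  refine h3.congr fun w hw => ?_
  change _ = (⟨Φ.symm w, mfderivWithin 𝓘(ℝ, Euc p × Euc q) (𝓡 n) Φ.symm Φ.target w u⟩ :
    TotalSpace (Euc n) (TangentSpace (𝓡 n) : M → Type _))
  rw [mfderivWithin_of_isOpen Φ.open_target hw]
  rfl

theorem contDiffOn_chartMetric [IsManifold (𝓡 n) ∞ M]
    [IsContMDiffRiemannianBundle (𝓡 n) ∞ (Euc n) (fun x : M => TangentSpace (𝓡 n) x)]
    {Φ : OpenPartialHomeomorph M (Euc p × Euc q)}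
    (h : ContMDiffOn 𝓘(ℝ, Euc p × Euc q) (𝓡 n) ∞ Φ.symm Φ.target) :
    ContDiffOn ℝ ∞ (chartMetric n Φ) Φ.target := by
  refine contDiffOn_clm_apply.2 fun u => contDiffOn_clm_apply.2 fun v => ?_
  have h1 := ContMDiffOn.inner_bundle (b := fun w => Φ.symm w)
    (v := fun w => symmDeriv Φ w u) (w := fun w => symmDeriv Φ w v) (s := Φ.target)
    (contMDiffOn_symmDeriv h u) (contMDiffOn_symmDeriv h v)
  exact contMDiffOn_iff_contDiffOn.1 h1

end SmoothFoliation

set_option synthInstance.maxHeartbeats 400000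
set_option maxHeartbeats 1000000

theorem ContDiffOn.clm_flip {W E F G : Type*} [NormedAddCommGroup W] [NormedSpace ℝ W]
    [NormedAddCommGroup E] [NormedSpace ℝ E] [NormedAddCommGroup F] [NormedSpace ℝ F]
    [NormedAddCommGroup G] [NormedSpace ℝ G] {f : W → E →L[ℝ] F →L[ℝ] G} {s : Set W}
    {m : WithTop ℕ∞} (hf : ContDiffOn ℝ m f s) : ContDiffOn ℝ m (fun w => (f w).flip) s :=
  have h : ContDiff ℝ m (fun f : E →L[ℝ] F →L[ℝ] G => f.flip) :=
    ContinuousLinearMap.contDiff (𝕜 := ℝ) (E := E →L[ℝ] F →L[ℝ] G) (F := F →L[ℝ] E →L[ℝ] G)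
      (n := m) (ContinuousLinearMap.flipₗᵢ ℝ E F G).toContinuousLinearEquiv.toContinuousLinearMap
  h.comp_contDiffOn hf

/-- The orthogonal lift of vectors of the second factor, for a positive definite form depending
smoothly on a parameter. -/
theorem exists_orthogonal_lift {W P Q : Type} [NormedAddCommGroup W] [NormedSpace ℝ W]
    [NormedAddCommGroup P] [NormedSpace ℝ P] [FiniteDimensional ℝ P]
    [NormedAddCommGroup Q] [NormedSpace ℝ Q]
    {G : W → (P × Q) →L[ℝ] (P × Q) →L[ℝ] ℝ} {O : Set W} (hO : IsOpen O)
    (hG : ContDiffOn ℝ ∞ G O) (hpos : ∀ w ∈ O, ∀ u, G w u u = 0 → u = 0) :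
    ∃ H : W → Q →L[ℝ] P × Q, ContDiffOn ℝ ∞ H O ∧ (∀ w u, (H w u).2 = u) ∧
      ∀ w ∈ O, ∀ u u', G w (u', 0) (H w u) = 0 := by
  have : CompleteSpace P := FiniteDimensional.complete ℝ P
  let ιP : P →L[ℝ] P × Q := ContinuousLinearMap.inl ℝ P Q
  let ιQ : Q →L[ℝ] P × Q := ContinuousLinearMap.inr ℝ P Q
  let res : (P × Q →L[ℝ] ℝ) →L[ℝ] (P →L[ℝ] ℝ) :=
    (ContinuousLinearMap.compL ℝ P (P × Q) ℝ).flip ιP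
  let D : W → (P × Q) →L[ℝ] P →L[ℝ] ℝ := fun w => res ∘L (G w).flip
  have hDs : ContDiffOn ℝ ∞ D O := by
    have h1 : ContDiffOn ℝ ∞ (fun w => (G w).flip) O := hG.clm_flip
    exact contDiffOn_const.clm_comp h1
  have hD : ∀ w a u', D w a u' = G w (u', 0) a := fun w a u' => rfl
  have hB : ∀ w ∈ O, ∃ e : P ≃L[ℝ] (P →L[ℝ] ℝ), (e : P →L[ℝ] (P →L[ℝ] ℝ)) = D w ∘L ιP := by
    intro w hw
    refine exists_equiv_dual_of_definite _ fun u hu => ?_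
    have h1 : G w (u, 0) (u, 0) = 0 := hu
    exact congrArg Prod.fst (hpos w hw _ h1)
  -- The lift is `u ↦ (-A w u, u)`, where `A w u` solves the orthogonality equations; their matrix
  -- is the block of `G w` on the first factor, invertible on `O` by definiteness.
  let A : W → Q →L[ℝ] P := fun w => (D w ∘L ιP).inverse ∘L (D w ∘L ιQ)
  have hAs : ContDiffOn ℝ ∞ A O := by
    have h1 : ContDiffOn ℝ ∞ (fun w => (D w ∘L ιP).inverse) O := by
      intro w hw
      obtain ⟨e, he⟩ := hB w hw
      have h2 : ContDiffAt ℝ ∞ (fun w => D w ∘L ιP) w :=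
        (hDs.clm_comp contDiffOn_const).contDiffAt (hO.mem_nhds hw)
      have h3 := contDiffAt_map_inverse (n := ∞) e
      rw [he] at h3
      exact (h3.comp w h2).contDiffWithinAt
    exact h1.clm_comp (hDs.clm_comp contDiffOn_const)
  refine ⟨fun w => ιQ - ιP ∘L A w, contDiffOn_const.sub (contDiffOn_const.clm_comp hAs),
    fun w u => ?_, fun w hw u u' => ?_⟩
  · change u - 0 = u
    rw [sub_zero]
  · obtain ⟨e, he⟩ := hB w hw
    have h1 : D w (ιP (A w u)) = D w (ιQ u) := by
      change (D w ∘L ιP) ((D w ∘L ιP).inverse (D w (ιQ u))) = _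
      rw [← he, ContinuousLinearMap.inverse_equiv]
      exact e.apply_symm_apply _
    have h2 : D w ((ιQ - ιP ∘L A w) u) = 0 := by
      have : (ιQ - ιP ∘L A w) u = ιQ u - ιP (A w u) := rfl
      rw [this, map_sub, h1, sub_self]
    rw [← hD, h2]
    rfl

/-! ### Normal charts along the leaf -/

namespace SmoothFoliation

set_option maxSynthPendingDepth 3
set_option synthInstance.maxHeartbeats 400000
set_option maxHeartbeats 1000000

variable {n p q : ℕ} {M : Type*} [TopologicalSpace M] [ChartedSpace (Euc n) M]
  [RiemannianBundle (fun x : M => TangentSpace (𝓡 n) x)]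

/-- An adapted chart in which the leaf `L` is the zero level of the transverse coordinate and in
which the transverse part of the metric satisfies the conclusion of the Gauss lemma for the
constant metric `h` and the radial vectors. -/
structure IsNormalChart (F : SmoothFoliation n p q M) (L : Set M)
    (Φ : OpenPartialHomeomorph M (Euc p × Euc q)) (h : Euc q →L[ℝ] Euc q →L[ℝ] ℝ) : Prop where
  adapted : F.IsAdapted Φ
  pos : ∀ u, u ≠ 0 → 0 < h u u
  symm : ∀ u v, h u v = h v u
  mem_iff : ∀ x ∈ Φ.source, x ∈ L ↔ (Φ x).2 = 0
  lift : ∃ H : Euc p × Euc q → Euc q →L[ℝ] Euc p × Euc q, ContDiffOn ℝ ∞ H Φ.target ∧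
    (∀ w u, (H w u).2 = u) ∧
    ∀ w ∈ Φ.target, ∀ u, chartMetric n Φ w (H w w.2) u = h w.2 u.2

theorem bilin_polarization {V : Type*} [NormedAddCommGroup V] [NormedSpace ℝ V]
    {B B' : V →L[ℝ] V →L[ℝ] ℝ} (hB : ∀ u v, B u v = B v u) (hB' : ∀ u v, B' u v = B' v u)
    (h : ∀ u, B u u = B' u u) (u v : V) : B u v = B' u v := by
  have h1 := h (u + v)
  simp only [map_add, _root_.add_apply, hB v u, hB' v u, h u, h v] at h1
  linarith

/-- This is where the bundle-like hypothesis enters: orthogonal lifts have the same norm along a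
plaque, and polarization gives the bilinear form. -/
theorem transverse_metric_eq {F : SmoothFoliation n p q M} (hF : F.IsBundleLike)
    {φ : OpenPartialHomeomorph M (Euc p × Euc q)} (hφ : φ ∈ F.charts) {C : Set (Euc p)}
    (hC : IsPreconnected C) {y : Euc q} (hsub : C ×ˢ {y} ⊆ φ.target) {x x' : Euc p}
    (hx : x ∈ C) (hx' : x' ∈ C) {H : Euc p × Euc q → Euc q →L[ℝ] Euc p × Euc q}
    (hH : ∀ w u, (H w u).2 = u)
    (horth : ∀ w ∈ φ.target, ∀ u u', chartMetric n φ w (u', 0) (H w u) = 0) (u v : Euc q) :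
    chartMetric n φ (x', y) (H (x', y) u) (H (x', y) v) =
      chartMetric n φ (x, y) (H (x, y) u) (H (x, y) v) := by
  have hd := (F.isAdapted_of_mem_charts hφ).mdifferentiable
  have h1 : ∀ w ∈ φ.target, ∀ u, ∀ t ∈ F.tangent (φ.symm w),
      inner ℝ t (symmDeriv φ w (H w u)) = 0 := by
    intro w hw u t ht
    rw [(F.isAdapted_of_mem_charts hφ).mem_tangent_iff _ (φ.map_target hw)] at ht
    obtain ⟨t', rfl⟩ := exists_symmDeriv_eq hd hw t
    rw [transverseDeriv_symmDeriv hd hw] at ht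
    rw [← chartMetric_apply]
    obtain ⟨t₁, t₂⟩ := t'
    simp only at ht
    subst ht
    exact horth w hw u t₁
  have hw : (x, y) ∈ φ.target := hsub (Set.mk_mem_prod hx rfl)
  have hw' : (x', y) ∈ φ.target := hsub (Set.mk_mem_prod hx' rfl)
  let B : Euc p × Euc q → Euc q →L[ℝ] Euc q →L[ℝ] ℝ := fun w =>
    (chartMetric n φ w).bilinearComp (H w) (H w)
  have h2 := bilin_polarization (B := B (x', y)) (B' := B (x, y))
    (fun u v => chartMetric_comm _ _ _ _) (fun u v => chartMetric_comm _ _ _ _) (fun u => ?_) u v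
  · exact h2
  · have h3 := hF φ hφ _ (φ.map_target hw) _ (symm_mem_plaque hC hsub hx hx')
      (symmDeriv φ (x, y) (H (x, y) u)) (symmDeriv φ (x', y) (H (x', y) u)) (h1 _ hw u)
      (h1 _ hw' u) (by
        rw [transverseDeriv_symmDeriv hd hw, transverseDeriv_symmDeriv hd hw', hH, hH])
    change chartMetric n φ _ (H _ u) (H _ u) = chartMetric n φ _ (H _ u) (H _ u)
    rw [chartMetric_apply, chartMetric_apply, real_inner_self_eq_norm_sq, real_inner_self_eq_norm_sq, h3]

omit [RiemannianBundle (fun x : M => TangentSpace (𝓡 n) x)] in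
theorem exists_box_leaf {F : SmoothFoliation n p q M} {x₀ : M} {z : M} (hz : z ∈ F.leaf x₀)
    (hiso : F.IsTransverselyIsolatedAt (F.leaf x₀) z)
    {φ : OpenPartialHomeomorph M (Euc p × Euc q)} (hφ : φ ∈ F.charts) (hzφ : z ∈ φ.source) :
    ∃ r > 0, Metric.ball (φ z).1 r ×ˢ Metric.ball (φ z).2 r ⊆ φ.target ∧
      ∀ x ∈ φ.source, φ x ∈ Metric.ball (φ z).1 r ×ˢ Metric.ball (φ z).2 r →
        (x ∈ F.leaf x₀ ↔ (φ x).2 = (φ z).2) := by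
  have h1 := hiso.eventually_eq hφ hzφ
  have h2 : Filter.Tendsto φ.symm (𝓝 (φ z)) (𝓝 z) := by
    have := (φ.continuousAt_symm (φ.map_source hzφ)).tendsto
    rwa [φ.left_inv hzφ] at this
  obtain ⟨r, hr, hball⟩ := Metric.mem_nhds_iff.1
    ((h2.eventually h1).and (φ.open_target.mem_nhds (φ.map_source hzφ)))
  have hball' : ∀ w ∈ Metric.ball (φ z).1 r ×ˢ Metric.ball (φ z).2 r,
      (φ.symm w ∈ F.leaf x₀ → (φ (φ.symm w)).2 = (φ z).2) ∧ w ∈ φ.target := by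
    intro w hw
    rw [ball_prod_same] at hw
    exact hball hw
  have hsub : Metric.ball (φ z).1 r ×ˢ Metric.ball (φ z).2 r ⊆ φ.target := fun w hw =>
    (hball' _ hw).2
  refine ⟨r, hr, hsub, fun x hx hxb => ⟨fun hxL => ?_, fun hx2 => ?_⟩⟩
  · have h3 := (hball' _ hxb).1
    rw [φ.left_inv hx] at h3
    exact h3 hxL
  · have hs : Metric.ball (φ z).1 r ×ˢ {(φ z).2} ⊆ φ.target := by
      refine subset_trans (Set.prod_mono subset_rfl ?_) hsub
      rw [Set.singleton_subset_iff]
      exact Metric.mem_ball_self hr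
    have h4 := F.symm_mem_leaf hφ (convex_ball _ r).isPreconnected hs
      (x := (φ z).1) (x' := (φ x).1) (Metric.mem_ball_self hr) hxb.1 (by
        change φ.symm (φ z) ∈ _; rwa [φ.left_inv hzφ])
    rw [← hx2] at h4
    change φ.symm (φ x) ∈ _ at h4
    rwa [φ.left_inv hx] at h4

/-- Change of the transverse coordinate in a foliated chart. -/
def changeTransverse (φ : OpenPartialHomeomorph M (Euc p × Euc q)) (a : Euc p) (r : ℝ)
    (E : OpenPartialHomeomorph (Euc q) (Euc q)) : OpenPartialHomeomorph M (Euc p × Euc q) :=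
  φ.trans ((OpenPartialHomeomorph.ofSet (Metric.ball a r) Metric.isOpen_ball).prod E.symm)

section changeTransverse

variable {F : SmoothFoliation n p q M} {φ : OpenPartialHomeomorph M (Euc p × Euc q)} {a : Euc p}
  {r : ℝ} {E : OpenPartialHomeomorph (Euc q) (Euc q)}

omit [ChartedSpace (Euc n) M] [RiemannianBundle (fun x : M => TangentSpace (𝓡 n) x)]

theorem mem_changeTransverse_source {x : M} : x ∈ (changeTransverse φ a r E).source ↔
    x ∈ φ.source ∧ (φ x).1 ∈ Metric.ball a r ∧ (φ x).2 ∈ E.target := by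
  simp [changeTransverse]

theorem mem_changeTransverse_target (hsub : Metric.ball a r ×ˢ E.target ⊆ φ.target)
    {w : Euc p × Euc q} : w ∈ (changeTransverse φ a r E).target ↔
      w.1 ∈ Metric.ball a r ∧ w.2 ∈ E.source := by
  simp only [changeTransverse, OpenPartialHomeomorph.trans_target,
    OpenPartialHomeomorph.prod_target, OpenPartialHomeomorph.ofSet_target,
    OpenPartialHomeomorph.symm_target]
  exact ⟨fun h => h.1, fun h => ⟨h, hsub ⟨h.1, E.map_source h.2⟩⟩⟩

theorem changeTransverse_apply (x : M) :
    changeTransverse φ a r E x = ((φ x).1, E.symm (φ x).2) := rfl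

theorem changeTransverse_symm_apply (w : Euc p × Euc q) :
    (changeTransverse φ a r E).symm w = φ.symm (w.1, E w.2) := rfl

end changeTransverse

omit [RiemannianBundle (fun x : M => TangentSpace (𝓡 n) x)] in
theorem isAdapted_changeTransverse {F : SmoothFoliation n p q M}
    {φ : OpenPartialHomeomorph M (Euc p × Euc q)} (hφ : F.IsAdapted φ) {a : Euc p} {r : ℝ}
    {E : OpenPartialHomeomorph (Euc q) (Euc q)} (hE : ContDiffOn ℝ ∞ E E.source)
    (hE' : ContDiffOn ℝ ∞ E.symm E.target) (hsub : Metric.ball a r ×ˢ E.target ⊆ φ.target) :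
    F.IsAdapted (changeTransverse φ a r E) := by
  have hs : ContMDiffOn (𝓡 n) 𝓘(ℝ, Euc p × Euc q) ∞ (changeTransverse φ a r E)
      (changeTransverse φ a r E).source := by
    have h1 : ContDiffOn ℝ ∞ (fun w : Euc p × Euc q => (w.1, E.symm w.2))
        (Metric.ball a r ×ˢ E.target) :=
      contDiff_fst.contDiffOn.prodMk (hE'.comp contDiff_snd.contDiffOn fun w hw => hw.2)
    refine h1.contMDiffOn.comp (hφ.smooth.mono fun x hx => (mem_changeTransverse_source.1 hx).1) ?_
    exact fun x hx => (mem_changeTransverse_source.1 hx).2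
  have hs' : ContMDiffOn 𝓘(ℝ, Euc p × Euc q) (𝓡 n) ∞ (changeTransverse φ a r E).symm
      (changeTransverse φ a r E).target := by
    have h1 : ContDiffOn ℝ ∞ (fun w : Euc p × Euc q => (w.1, E w.2))
        (changeTransverse φ a r E).target :=
      contDiff_fst.contDiffOn.prodMk (hE.comp contDiff_snd.contDiffOn fun w hw =>
        ((mem_changeTransverse_target hsub).1 hw).2)
    refine hφ.smooth_symm.comp h1.contMDiffOn fun w hw => ?_
    have := (mem_changeTransverse_target hsub).1 hw
    exact hsub ⟨this.1, E.map_source this.2⟩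
  refine ⟨hs, hs', fun x hx v => ?_⟩
  have hd := OpenPartialHomeomorph.mdifferentiable_of_smooth hs hs'
  have hx' := mem_changeTransverse_source.1 hx
  rw [hφ.mem_tangent_iff x hx'.1]
  constructor
  · intro hv
    obtain ⟨w, hw, rfl⟩ : ∃ w ∈ φ.target, φ.symm w = x :=
      ⟨φ x, φ.map_source hx'.1, φ.left_inv hx'.1⟩
    refine transverseDeriv_eq_zero_of_factor (g := fun y => E.symm y) hφ.mdifferentiable hd hw hx
      ?_ hv
    filter_upwards [φ.open_target.mem_nhds hw] with z hz
    rw [changeTransverse_apply, φ.right_inv hz]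
  · intro hv
    obtain ⟨w, hw, rfl⟩ : ∃ w ∈ (changeTransverse φ a r E).target,
      (changeTransverse φ a r E).symm w = x :=
      ⟨_, OpenPartialHomeomorph.map_source _ hx, OpenPartialHomeomorph.left_inv _ hx⟩
    refine transverseDeriv_eq_zero_of_factor (g := fun y => E y) hd hφ.mdifferentiable hw hx'.1
      ?_ hv
    filter_upwards [(changeTransverse φ a r E).open_target.mem_nhds hw] with z hz
    have := (mem_changeTransverse_target hsub).1 hz
    rw [changeTransverse_symm_apply,
      φ.right_inv (hsub (Set.mk_mem_prod this.1 (E.map_source this.2)))]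

theorem chartMetric_changeTransverse
    {φ : OpenPartialHomeomorph M (Euc p × Euc q)}
    (hφ : φ.MDifferentiable (𝓡 n) 𝓘(ℝ, Euc p × Euc q)) {a : Euc p} {r : ℝ}
    {E : OpenPartialHomeomorph (Euc q) (Euc q)} (hE : ContDiffOn ℝ ∞ E E.source)
    (hsub : Metric.ball a r ×ˢ E.target ⊆ φ.target)
    {w : Euc p × Euc q} (hw : w ∈ (changeTransverse φ a r E).target) (u u' : Euc p × Euc q) :
    chartMetric n (changeTransverse φ a r E) w u u' =
      chartMetric n φ (w.1, E w.2) (u.1, fderiv ℝ E w.2 u.2) (u'.1, fderiv ℝ E w.2 u'.2) := by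
  have hw' := (mem_changeTransverse_target hsub).1 hw
  have hEd : HasFDerivAt E (fderiv ℝ E w.2) w.2 :=
    ((hE.contDiffAt (E.open_source.mem_nhds hw'.2)).differentiableAt (by simp)).hasFDerivAt
  have h1 : HasFDerivAt (fun w : Euc p × Euc q => (w.1, E w.2))
      ((ContinuousLinearMap.fst ℝ (Euc p) (Euc q)).prod
        (fderiv ℝ E w.2 ∘L ContinuousLinearMap.snd ℝ (Euc p) (Euc q))) w :=
    hasFDerivAt_fst.prodMk (hEd.comp w hasFDerivAt_snd)
  have h2 : HasMFDerivAt 𝓘(ℝ, Euc p × Euc q) (𝓡 n) φ.symm (w.1, E w.2)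
      (symmDeriv φ (w.1, E w.2)) :=
    (hφ.symm.mdifferentiableAt (hsub (Set.mk_mem_prod hw'.1 (E.map_source hw'.2)))).hasMFDerivAt
  have h3 := (HasMFDerivAt.comp w h2 h1.hasMFDerivAt).mfderiv
  have h4 : ∀ u : Euc p × Euc q, symmDeriv (n := n) (changeTransverse φ a r E) w u =
      symmDeriv (n := n) φ (w.1, E w.2) (u.1, fderiv ℝ E w.2 u.2) := fun u =>
    DFunLike.congr_fun h3 u
  rw [chartMetric_apply, chartMetric_apply, ← h4 u, ← h4 u']
  rfl

/-- In a box the metric on orthogonal lifts does not depend on the leaf coordinate, so it is a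
Riemannian metric on the transverse ball. Its normal coordinates centred at the leaf become the new
transverse coordinate, and its Gauss lemma becomes the identity required of the lifts. -/
theorem exists_isNormalChart [IsManifold (𝓡 n) ∞ M]
    [IsContMDiffRiemannianBundle (𝓡 n) ∞ (Euc n) (fun x : M => TangentSpace (𝓡 n) x)]
    {F : SmoothFoliation n p q M} (hF : F.IsBundleLike) {x₀ z : M} (hz : z ∈ F.leaf x₀)
    (hiso : F.IsTransverselyIsolatedAt (F.leaf x₀) z) :
    ∃ Φ h, F.IsNormalChart (F.leaf x₀) Φ h ∧ z ∈ Φ.source := by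
  obtain ⟨φ, hφ, hzφ⟩ := F.covers z
  have had := F.isAdapted_of_mem_charts hφ
  have hd := had.mdifferentiable
  obtain ⟨r, hr, hbox, hleaf⟩ := exists_box_leaf hz hiso hφ hzφ
  obtain ⟨H, hHs, hH2, horth⟩ := exists_orthogonal_lift φ.open_target
    (contDiffOn_chartMetric had.smooth_symm) (fun w hw u hu => by
      by_contra hne
      exact (chartMetric_pos hd hw hne).ne' hu)
  set a := (φ z).1 with ha
  set b := (φ z).2 with hb
  let T : Euc p × Euc q → Euc q →L[ℝ] Euc q →L[ℝ] ℝ := fun w =>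
    ((chartMetric n φ w ∘L H w).flip ∘L H w).flip
  have hTs : ContDiffOn ℝ ∞ T φ.target :=
    (((contDiffOn_chartMetric had.smooth_symm).clm_comp hHs).clm_flip.clm_comp hHs).clm_flip
  have hmem : ∀ x ∈ Metric.ball a r, ∀ y ∈ Metric.ball (0 : Euc q) r, (x, b + y) ∈ φ.target := by
    intro x hx y hy
    exact hbox ⟨hx, by simpa using hy⟩
  -- The transverse metric on the slice through `z`, translated so that the leaf is at the origin.
  let h₁ : Euc q → Euc q →L[ℝ] Euc q →L[ℝ] ℝ := fun y => T (a, b + y)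
  have hh₁ : ContDiffOn ℝ ∞ h₁ (Metric.ball 0 r) := hTs.comp (by fun_prop) fun y hy =>
    hmem a (Metric.mem_ball_self hr) y hy
  have hpos : ∀ w ∈ φ.target, ∀ u, u ≠ 0 → 0 < T w u u := by
    intro w hw u hu
    refine chartMetric_pos hd hw fun h0 => hu ?_
    have h1 := hH2 w u
    rw [show H w u = 0 from h0] at h1
    exact h1.symm
  obtain ⟨E₀, h0s, hE0, hE0t, hE0s, hE0s', hGauss⟩ := exists_normal_coordinates Metric.isOpen_ball
    (Metric.mem_ball_self hr) hh₁ (fun y _ u v => chartMetric_comm _ _ _ _) (fun y hy u hu => by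
      by_contra hne
      exact (hpos _ (hmem a (Metric.mem_ball_self hr) y hy) u hne).ne' hu)
  let E : OpenPartialHomeomorph (Euc q) (Euc q) := E₀.transHomeomorph (Homeomorph.addLeft b)
  have hEapp : ∀ v, E v = b + E₀ v := fun v => rfl
  have hEsymm : ∀ y, E.symm y = E₀.symm (-b + y) := fun y => rfl
  have hEsource : E.source = E₀.source := rfl
  have hEtarget : ∀ y, y ∈ E.target ↔ -b + y ∈ E₀.target := fun y => Iff.rfl
  have hEs : ContDiffOn ℝ ∞ E E.source := contDiffOn_const.add hE0s
  have hEs' : ContDiffOn ℝ ∞ E.symm E.target :=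
    hE0s'.comp (f := fun y => -b + y) (contDiff_const.add contDiff_id).contDiffOn fun y hy => hy
  have hEd : ∀ v ∈ E.source, fderiv ℝ E v = fderiv ℝ E₀ v := fun v _ => fderiv_const_add b
  have hsub : Metric.ball a r ×ˢ E.target ⊆ φ.target := by
    rintro ⟨x, y⟩ ⟨hx, hy⟩
    have := hmem x hx _ (hE0t ((hEtarget y).1 hy))
    simpa using this
  have hb0 : b ∈ E.target := by
    rw [hEtarget]
    simpa [hE0] using E₀.map_source h0s
  have hEb : E.symm b = 0 := by
    have := E₀.left_inv h0s
    rw [hE0] at this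
    simpa [hEsymm] using this
  refine ⟨changeTransverse φ a r E, h₁ 0, ⟨isAdapted_changeTransverse had hEs hEs' hsub, ?_, ?_, ?_,
    ?_⟩, mem_changeTransverse_source.2 ⟨hzφ, Metric.mem_ball_self hr, hb0⟩⟩
  · exact hpos _ (hmem a (Metric.mem_ball_self hr) 0 (Metric.mem_ball_self hr))
  · exact fun u v => chartMetric_comm _ _ _ _
  · intro x hx
    obtain ⟨hx1, hx2, hx3⟩ := mem_changeTransverse_source.1 hx
    have hx4 : (φ x).2 ∈ Metric.ball b r := by
      have := hE0t ((hEtarget _).1 hx3)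
      simpa [neg_add_eq_sub, dist_eq_norm] using this
    rw [hleaf x hx1 ⟨hx2, hx4⟩, changeTransverse_apply]
    change (φ x).2 = b ↔ E.symm (φ x).2 = 0
    rw [← hEb]
    exact ⟨fun h => by rw [h], fun h => E.symm.injOn hx3 hb0 h⟩
  · refine ⟨fun w => (ContinuousLinearMap.fst ℝ (Euc p) (Euc q) ∘L H (w.1, E w.2) ∘L
      fderiv ℝ E w.2).prod (ContinuousLinearMap.id ℝ (Euc q)), ?_, fun w u => rfl, ?_⟩
    · have h1 : ContDiffOn ℝ ∞ (fun w : Euc p × Euc q => fderiv ℝ E w.2)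
          (changeTransverse φ a r E).target :=
        (hEs.fderiv_of_isOpen E.open_source (m := ∞) (by simp)).comp contDiff_snd.contDiffOn
          fun w hw => ((mem_changeTransverse_target hsub).1 hw).2
      have h2 : ContDiffOn ℝ ∞ (fun w : Euc p × Euc q => H (w.1, E w.2))
          (changeTransverse φ a r E).target := by
        refine hHs.comp (contDiff_fst.contDiffOn.prodMk (hEs.comp contDiff_snd.contDiffOn
          fun w hw => ((mem_changeTransverse_target hsub).1 hw).2)) fun w hw => ?_
        have := (mem_changeTransverse_target hsub).1 hw
        exact hsub ⟨this.1, E.map_source this.2⟩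
      refine contDiffOn_clm_apply.2 fun u => ?_
      have h3 : ContDiffOn ℝ ∞ (fun w : Euc p × Euc q => (H (w.1, E w.2)) (fderiv ℝ E w.2 u))
          (changeTransverse φ a r E).target := h2.clm_apply (h1.clm_apply contDiffOn_const)
      exact h3.fst.prodMk contDiffOn_const
    · intro w hw u
      have hw' := (mem_changeTransverse_target hsub).1 hw
      have hw2 : (w.1, E w.2) ∈ φ.target := hsub ⟨hw'.1, E.map_source hw'.2⟩
      rw [chartMetric_changeTransverse hd hEs hsub hw, hEd _ hw'.2]
      set e := fderiv ℝ E₀ w.2 with he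
      have h1 : ((H (w.1, E w.2) (e w.2)).1, e w.2) = H (w.1, E w.2) (e w.2) :=
        Prod.ext rfl (hH2 _ _).symm
      -- An arbitrary vector is an orthogonal lift plus a vector tangent to the leaf, and the latter
      -- is orthogonal to the radial lift.
      have h2 : (u.1, e u.2) = H (w.1, E w.2) (e u.2) +
          ((u.1 - (H (w.1, E w.2) (e u.2)).1, 0) : Euc p × Euc q) := by
        refine Prod.ext ?_ ?_
        · simp
        · simp [hH2]
      change chartMetric n φ (w.1, E w.2) ((H (w.1, E w.2) (fderiv ℝ E w.2 w.2)).1, e w.2)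
        (u.1, e u.2) = _
      rw [hEd _ hw'.2, ← he, h1, h2, map_add, chartMetric_comm _ _ _ (_, 0), horth _ hw2, add_zero]
      have h3 := transverse_metric_eq hF hφ (convex_ball a r).isPreconnected
        (y := E w.2) (fun v hv => hsub ⟨hv.1, by
          rw [Set.mem_singleton_iff.1 hv.2]; exact E.map_source hw'.2⟩)
        (Metric.mem_ball_self hr) hw'.1 hH2 horth (e w.2) (e u.2)
      rw [h3]
      exact hGauss w.2 hw'.2 u.2

end SmoothFoliation

/-! ### Lifts of radial segments -/

theorem IsPicardLindelof.exists_mem_closedBall_hasDerivWithinAt {E : Type*} [NormedAddCommGroup E]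
    [NormedSpace ℝ E] [CompleteSpace E] {f : ℝ → E → E} {tmin tmax : ℝ} {t₀ : Set.Icc tmin tmax}
    {x₀ x : E} {a r L K : NNReal} (hf : IsPicardLindelof f t₀ x₀ a r L K)
    (hx : x ∈ Metric.closedBall x₀ r) :
    ∃ α : ℝ → E, α t₀ = x ∧ ∀ t ∈ Set.Icc tmin tmax, α t ∈ Metric.closedBall x₀ a ∧
      HasDerivWithinAt α (f t (α t)) (Set.Icc tmin tmax) t := by
  obtain ⟨α, hα⟩ := ODE.FunSpace.exists_isFixedPt_next hf hx
  refine ⟨α.compProj, by rw [ODE.FunSpace.compProj_val, ← hα, ODE.FunSpace.next_apply₀],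
    fun t ht => ⟨α.compProj_mem_closedBall hf.mul_max_le, ?_⟩⟩
  apply ODE.hasDerivWithinAt_picard_Icc t₀.2 hf.continuousOn_uncurry
    α.continuous_compProj.continuousOn (fun _ ht' => α.compProj_mem_closedBall hf.mul_max_le)
    x ht |>.congr_of_mem _ ht
  intro t' ht'
  nth_rw 1 [← hα]
  rw [ODE.FunSpace.compProj_of_mem ht', ODE.FunSpace.next_apply]

/-- Lifts of short radial segments for a connection with a smooth field of coefficients. -/
theorem exists_lift_of_radial_segment {P Q : Type*} [NormedAddCommGroup P] [NormedSpace ℝ P]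
    [CompleteSpace P] [NormedAddCommGroup Q] [NormedSpace ℝ Q] {K : P × Q → Q →L[ℝ] P} {a : P}
    (hK : ContDiffAt ℝ 1 K (a, 0)) {O : Set (P × Q)} (hO : O ∈ 𝓝 (a, (0 : Q))) :
    ∀ᶠ w : P × Q in 𝓝 (a, 0), ∃ α : ℝ → P, ContDiffOn ℝ 1 α (Set.Icc 0 1) ∧ α 1 = w.1 ∧
      ∀ t ∈ Set.Icc (0 : ℝ) 1, (α t, t • w.2) ∈ O ∧
        HasDerivWithinAt α (K (α t, t • w.2) w.2) (Set.Icc 0 1) t := by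
  obtain ⟨C, s, hs, hC⟩ := hK.exists_lipschitzOnWith
  have hb : ∀ᶠ w in 𝓝 (a, (0 : Q)), ‖K w‖ < ‖K (a, 0)‖ + 1 :=
    hK.continuousAt.norm.eventually_lt_const (by linarith)
  obtain ⟨r, hr, hball⟩ := Metric.nhds_basis_closedBall.mem_iff.1
    (Filter.inter_mem (Filter.inter_mem hs hO) hb)
  set B := ‖K (a, 0)‖ + 1 with hB
  have hB0 : 0 < B := by positivity
  have hmem : ∀ x ∈ Metric.closedBall a r, ∀ y ∈ Metric.closedBall (0 : Q) r,
      (x, y) ∈ s ∧ (x, y) ∈ O ∧ ‖K (x, y)‖ < B := by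
    intro x hx y hy
    have : (x, y) ∈ Metric.closedBall (a, (0 : Q)) r := by
      rw [← closedBall_prod_same]; exact ⟨hx, hy⟩
    exact ⟨(hball this).1.1, (hball this).1.2, (hball this).2⟩
  -- The lift has speed at most `B * δ ≤ r / 2`, so a curve ending within `r / 2` of `a` stays
  -- within `r` of it during the unit time interval.
  set δ := min r (r / (2 * B)) with hδ
  have hδ0 : 0 < δ := lt_min hr (by positivity)
  have hBδ : B * δ ≤ r / 2 := by
    calc B * δ ≤ B * (r / (2 * B)) := by gcongr; exact min_le_right _ _
      _ = r / 2 := by field_simp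
  filter_upwards [prod_mem_nhds (Metric.ball_mem_nhds a (half_pos hr))
    (Metric.ball_mem_nhds (0 : Q) hδ0)] with ⟨x₀, y⟩ ⟨hx₀, hy⟩
  have hyδ : ‖y‖ < δ := by simpa using hy
  have hty : ∀ t ∈ Set.Icc (0 : ℝ) 1, t • y ∈ Metric.closedBall (0 : Q) r := by
    intro t ht
    rw [mem_closedBall_zero_iff, norm_smul, Real.norm_of_nonneg ht.1]
    calc t * ‖y‖ ≤ 1 * ‖y‖ := by gcongr; exact ht.2
      _ ≤ r := by rw [one_mul]; exact hyδ.le.trans (min_le_left _ _)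
  -- The value is prescribed at time `1`, the outer end of the segment, and the curve is followed
  -- back to time `0`.
  have hPL : IsPicardLindelof (fun t x => K (x, t • y) y) (tmin := 0) (tmax := 1)
      (⟨1, by simp⟩ : Set.Icc (0 : ℝ) 1) a r.toNNReal (r / 2).toNNReal (B * δ).toNNReal
      (C * ‖y‖₊) := by
    refine ⟨fun t ht => ?_, fun x hx => ?_, fun t ht x hx => ?_, ?_⟩
    · rw [Real.coe_toNNReal _ hr.le]
      refine LipschitzOnWith.of_dist_le_mul fun x hx x' hx' => ?_
      have h1 := hC.dist_le_mul _ (hmem x hx _ (hty t ht)).1 _ (hmem x' hx' _ (hty t ht)).1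
      rw [dist_eq_norm] at h1
      rw [dist_eq_norm, ← _root_.sub_apply]
      refine ((K (x, t • y) - K (x', t • y)).le_opNorm y).trans ?_
      have h2 : dist (x, t • y) (x', t • y) = dist x x' := by
        rw [Prod.dist_eq, dist_self]; exact max_eq_left dist_nonneg
      rw [h2] at h1
      calc ‖K (x, t • y) - K (x', t • y)‖ * ‖y‖ ≤ (C * dist x x') * ‖y‖ := by gcongr
        _ = (C * ‖y‖₊ : NNReal) * dist x x' := by push_cast; ring
    · rw [Real.coe_toNNReal _ hr.le] at hx
      have h1 : ContinuousOn (fun t : ℝ => K (x, t • y)) (Set.Icc 0 1) :=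
        hC.continuousOn.comp (by fun_prop) fun t ht => (hmem x hx _ (hty t ht)).1
      exact h1.clm_apply continuousOn_const
    · rw [Real.coe_toNNReal _ hr.le] at hx
      rw [Real.coe_toNNReal _ (by positivity)]
      refine ((K (x, t • y)).le_opNorm y).trans ?_
      gcongr
      exact (hmem x hx _ (hty t ht)).2.2.le
    · rw [Real.coe_toNNReal _ (by positivity), Real.coe_toNNReal _ (by positivity),
        Real.coe_toNNReal _ (by positivity)]
      simp only [sub_self, sub_zero]
      rw [max_eq_right zero_le_one]
      linarith
  obtain ⟨α, hα1, hα⟩ := hPL.exists_mem_closedBall_hasDerivWithinAt (x := x₀) (by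
    rw [Real.coe_toNNReal _ (by positivity)]
    exact Metric.ball_subset_closedBall hx₀)
  have hαr : ∀ t ∈ Set.Icc (0 : ℝ) 1, α t ∈ Metric.closedBall a r := by
    intro t ht
    have := (hα t ht).1
    rwa [Real.coe_toNNReal _ hr.le] at this
  refine ⟨α, ?_, hα1, fun t ht => ⟨(hmem _ (hαr t ht) _ (hty t ht)).2.1, (hα t ht).2⟩⟩
  rw [contDiffOn_one_iff_derivWithin (uniqueDiffOn_Icc zero_lt_one)]
  have hcont : ContinuousOn α (Set.Icc 0 1) := fun t ht => (hα t ht).2.continuousWithinAt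
  refine ⟨fun t ht => (hα t ht).2.differentiableWithinAt, ?_⟩
  have h1 : ContinuousOn (fun t : ℝ => K (α t, t • y)) (Set.Icc 0 1) :=
    hC.continuousOn.comp (hcont.prodMk (by fun_prop))
      fun t ht => (hmem _ (hαr t ht) _ (hty t ht)).1
  have h2 : ContinuousOn (fun t : ℝ => K (α t, t • y) y) (Set.Icc 0 1) :=
    h1.clm_apply continuousOn_const
  refine h2.congr fun t ht => ?_
  exact (hα t ht).2.derivWithin (uniqueDiffOn_Icc zero_lt_one t ht)

/-! ### Distance to the leaf in a normal chart -/

namespace SmoothFoliation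

set_option maxSynthPendingDepth 3
set_option synthInstance.maxHeartbeats 400000
set_option maxHeartbeats 1000000

variable {n p q : ℕ} {M : Type*} [TopologicalSpace M] [ChartedSpace (Euc n) M]
  [RiemannianBundle (fun x : M => TangentSpace (𝓡 n) x)]
  {F : SmoothFoliation n p q M} {L : Set M} {Φ : OpenPartialHomeomorph M (Euc p × Euc q)}
  {h : Euc q →L[ℝ] Euc q →L[ℝ] ℝ}

theorem IsNormalChart.nonneg (hΦ : F.IsNormalChart L Φ h) (u : Euc q) : 0 ≤ h u u := by
  rcases eq_or_ne u 0 with rfl | hu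
  · simp
  · exact (hΦ.pos u hu).le

/-- The vector is the gradient of half the squared `h`-norm of the transverse coordinate; it is the
lift of the radial vector. -/
theorem IsNormalChart.exists_gradient (hΦ : F.IsNormalChart L Φ h) {x : M} (hx : x ∈ Φ.source) :
    ∃ R : TangentSpace (𝓡 n) x, transverseDeriv Φ x R = (Φ x).2 ∧
      ∀ v : TangentSpace (𝓡 n) x, inner ℝ R v = h (Φ x).2 (transverseDeriv Φ x v) := by
  obtain ⟨H, -, hH2, hH⟩ := hΦ.lift
  have hd := hΦ.adapted.mdifferentiable
  obtain ⟨w, hw, rfl⟩ : ∃ w ∈ Φ.target, Φ.symm w = x := ⟨Φ x, Φ.map_source hx, Φ.left_inv hx⟩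
  rw [Φ.right_inv hw]
  refine ⟨symmDeriv Φ w (H w w.2), ?_, fun v => ?_⟩
  · rw [transverseDeriv_symmDeriv hd hw, hH2]
  · obtain ⟨u, rfl⟩ := exists_symmDeriv_eq hd hw v
    rw [← chartMetric_apply, hH w hw, transverseDeriv_symmDeriv hd hw]

/-- Cauchy–Schwarz for the gradient, whose length is the `h`-norm of the transverse coordinate. It
bounds the variation of this norm along curves by their length. -/
theorem IsNormalChart.abs_le (hΦ : F.IsNormalChart L Φ h) {x : M} (hx : x ∈ Φ.source)
    (v : TangentSpace (𝓡 n) x) :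
    |h (Φ x).2 (transverseDeriv Φ x v)| ≤ √(h (Φ x).2 (Φ x).2) * ‖v‖ := by
  obtain ⟨R, hR1, hR2⟩ := hΦ.exists_gradient hx
  have h1 : ‖R‖ = √(h (Φ x).2 (Φ x).2) := by
    have h0 := hR2 R
    rw [hR1, real_inner_self_eq_norm_sq] at h0
    rw [← h0, Real.sqrt_sq (norm_nonneg R)]
  rw [← hR2 v, ← h1]
  exact abs_real_inner_le_norm R v

omit [RiemannianBundle (fun x : M => TangentSpace (𝓡 n) x)] in
theorem hasDerivAt_transverse (hd : Φ.MDifferentiable (𝓡 n) 𝓘(ℝ, Euc p × Euc q)) {γ : ℝ → M}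
    {t : ℝ} (hγ : MDifferentiableAt 𝓘(ℝ, ℝ) (𝓡 n) γ t) (ht : γ t ∈ Φ.source) :
    HasDerivAt (fun t => (Φ (γ t)).2)
      (transverseDeriv Φ (γ t) (mfderiv 𝓘(ℝ, ℝ) (𝓡 n) γ t (1 : ℝ))) t := by
  have h1 : HasMFDerivAt (𝓡 n) 𝓘(ℝ, Euc p × Euc q) Φ (γ t) _ :=
    (hd.mdifferentiableAt ht).hasMFDerivAt
  have h2 := (h1.comp t hγ.hasMFDerivAt).hasFDerivAt.snd.hasDerivAt
  rw [transverseDeriv_apply hd ht]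
  exact h2

theorem IsNormalChart.sqrt_le_pathELength (hΦ : F.IsNormalChart L Φ h) {γ : ℝ → M}
    (hγ : ContMDiff 𝓘(ℝ, ℝ) (𝓡 n) 1 γ) (hs : ∀ t ∈ Set.Icc (0 : ℝ) 1, γ t ∈ Φ.source)
    (h1 : γ 1 ∈ L) :
    ENNReal.ofReal √(h (Φ (γ 0)).2 (Φ (γ 0)).2) ≤ Manifold.pathELength (𝓡 n) γ 0 1 := by
  have hd := hΦ.adapted.mdifferentiable
  set c : ℝ → Euc q := fun t => (Φ (γ t)).2 with hc
  have hcs : ContDiffOn ℝ 1 c (Set.Icc 0 1) := by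
    have h2 : ContMDiffOn 𝓘(ℝ, ℝ) 𝓘(ℝ, Euc p × Euc q) 1 (fun t => Φ (γ t)) (Set.Icc 0 1) :=
      (hΦ.adapted.smooth.of_le (by simp)).comp hγ.contMDiffOn hs
    exact (contMDiffOn_iff_contDiffOn.1 h2).snd
  have hc' : ∀ t ∈ Set.Icc (0 : ℝ) 1, HasDerivAt c
      (transverseDeriv Φ (γ t) (mfderiv 𝓘(ℝ, ℝ) (𝓡 n) γ t (1 : ℝ))) t := fun t ht =>
    hasDerivAt_transverse hd ((hγ t).mdifferentiableAt one_ne_zero) (hs t ht)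
  refine ENNReal.le_of_forall_pos_le_add fun δ hδ _ => ?_
  -- The curve ends on the zero level, where the norm is not differentiable; adding `δ ^ 2` smooths
  -- it, and `δ` is arbitrary.
  let f : ℝ → ℝ := fun t => √(h (c t) (c t) + (δ : ℝ) ^ 2)
  have hδ' : (0 : ℝ) < δ := hδ
  have hpos : ∀ t, 0 < h (c t) (c t) + (δ : ℝ) ^ 2 := fun t =>
    add_pos_of_nonneg_of_pos (hΦ.nonneg _) (by positivity)
  have hfs : ContDiffOn ℝ 1 f (Set.Icc 0 1) := by
    have h2 : ContDiffOn ℝ 1 (fun t => h (c t) (c t) + (δ : ℝ) ^ 2) (Set.Icc 0 1) :=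
      ((h.contDiff.comp_contDiffOn hcs).clm_apply hcs).add contDiffOn_const
    exact h2.sqrt fun t _ => (hpos t).ne'
  have hf' : ∀ t ∈ Set.Icc (0 : ℝ) 1, ‖deriv f t‖ ≤ ‖mfderiv 𝓘(ℝ, ℝ) (𝓡 n) γ t (1 : ℝ)‖ := by
    intro t ht
    set v := mfderiv 𝓘(ℝ, ℝ) (𝓡 n) γ t (1 : ℝ) with hv
    have h2 : HasDerivAt (fun t => h (c t) (c t) + (δ : ℝ) ^ 2)
        (h (transverseDeriv Φ (γ t) v) (c t) + h (c t) (transverseDeriv Φ (γ t) v)) t :=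
      ((h.hasFDerivAt.comp_hasDerivAt t (hc' t ht)).clm_apply (hc' t ht)).add_const _
    have h3 : deriv f t = h (c t) (transverseDeriv Φ (γ t) v) /
        √(h (c t) (c t) + (δ : ℝ) ^ 2) := by
      rw [(h2.sqrt (hpos t).ne').deriv, hΦ.symm _ (c t)]
      have := Real.sqrt_pos.2 (hpos t)
      field_simp
      ring
    rw [h3, Real.norm_eq_abs, abs_div, abs_of_pos (Real.sqrt_pos.2 (hpos t)),
      div_le_iff₀ (Real.sqrt_pos.2 (hpos t))]
    refine (hΦ.abs_le (hs t ht) v).trans ?_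
    rw [mul_comm]
    gcongr
    exact le_add_of_nonneg_right (by positivity)
  have h2 := enorm_sub_le_lintegral_deriv_of_contDiffOn_Icc hfs zero_le_one
  have h3 : (∫⁻ t in Set.Icc (0 : ℝ) 1, ‖deriv f t‖ₑ) ≤ Manifold.pathELength (𝓡 n) γ 0 1 := by
    rw [Manifold.pathELength_eq_lintegral_mfderiv_Icc]
    refine MeasureTheory.setLIntegral_mono' measurableSet_Icc fun t ht => ?_
    rw [← ofReal_norm, ← ofReal_norm]
    exact ENNReal.ofReal_le_ofReal (hf' t ht)
  have hf1 : f 1 = δ := by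
    have : c 1 = 0 := (hΦ.mem_iff _ (hs 1 (by simp))).1 h1
    simp [f, this]
  have hf0 : √(h (c 0) (c 0)) ≤ f 0 :=
    Real.sqrt_le_sqrt (le_add_of_nonneg_right (by positivity))
  calc ENNReal.ofReal √(h (c 0) (c 0)) ≤ ENNReal.ofReal (‖f 1 - f 0‖ + δ) := by
        refine ENNReal.ofReal_le_ofReal ?_
        rw [hf1, Real.norm_eq_abs]
        have := neg_abs_le ((δ : ℝ) - f 0)
        linarith
    _ = ‖f 1 - f 0‖ₑ + δ := by
        rw [ENNReal.ofReal_add (norm_nonneg _) hδ'.le, ofReal_norm, ENNReal.ofReal_coe_nnreal]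
    _ ≤ _ := by gcongr; exact h2.trans h3

/-- The metric identity concerns the lift of the radial vector `t • y`; dividing by `t` gives the
length of the lift of `y`. -/
theorem norm_symmDeriv_lift
    {H : Euc p × Euc q → Euc q →L[ℝ] Euc p × Euc q} (hH2 : ∀ w u, (H w u).2 = u)
    (hH : ∀ w ∈ Φ.target, ∀ u, chartMetric n Φ w (H w w.2) u = h w.2 u.2)
    {x : Euc p} {t : ℝ} (ht : 0 < t) {y : Euc q} (hw : (x, t • y) ∈ Φ.target) :
    ‖symmDeriv (n := n) Φ (x, t • y) (H (x, t • y) y)‖ = √(h y y) := by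
  have h1 := hH _ hw (H (x, t • y) y)
  simp only [map_smul, _root_.smul_apply, hH2, chartMetric_apply, real_inner_self_eq_norm_sq,
    smul_eq_mul] at h1
  rw [← mul_left_cancel₀ ht.ne' h1, Real.sqrt_sq (norm_nonneg _)]

/-- The lift of the radial segment ending at `x` starts on `L` and has, for `0 < t < 1`, constant
speed equal to the `h`-norm of the transverse coordinate of `x`. -/
theorem IsNormalChart.eventually_exists_riemannianEDist_le (hΦ : F.IsNormalChart L Φ h) {z : M}
    (hz : z ∈ Φ.source) (hzL : z ∈ L) :
    ∀ᶠ x in 𝓝 z, ∃ y ∈ L, Manifold.riemannianEDist (𝓡 n) x y ≤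
      ENNReal.ofReal √(h (Φ x).2 (Φ x).2) := by
  obtain ⟨H, hHs, hH2, hH⟩ := hΦ.lift
  have hd := hΦ.adapted.mdifferentiable
  have hz0 : Φ z = ((Φ z).1, 0) := Prod.ext rfl ((hΦ.mem_iff z hz).1 hzL)
  have hzt : ((Φ z).1, 0) ∈ Φ.target := hz0 ▸ Φ.map_source hz
  have hK : ContDiffAt ℝ 1 (fun w => ContinuousLinearMap.fst ℝ (Euc p) (Euc q) ∘L H w)
      ((Φ z).1, 0) :=
    contDiffAt_const.clm_comp
      ((hHs.of_le (by simp)).contDiffAt (Φ.open_target.mem_nhds hzt))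
  have h1 := exists_lift_of_radial_segment hK (Φ.open_target.mem_nhds hzt)
  rw [← hz0] at h1
  filter_upwards [(Φ.continuousAt hz).eventually h1, Φ.open_source.mem_nhds hz]
    with x ⟨α, hαs, hα1, hα⟩ hx
  set y := (Φ x).2 with hy
  let γ : ℝ → M := fun t => Φ.symm (α t, t • y)
  have hγs : ContMDiffOn 𝓘(ℝ, ℝ) (𝓡 n) 1 γ (Set.Icc 0 1) := by
    have h2 : ContDiffOn ℝ 1 (fun t : ℝ => (α t, t • y)) (Set.Icc 0 1) :=
      hαs.prodMk (by fun_prop)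
    exact (hΦ.adapted.smooth_symm.of_le (by simp)).comp h2.contMDiffOn fun t ht => (hα t ht).1
  have hγ1 : γ 1 = x := by
    simp only [γ, hα1, one_smul]
    exact Φ.left_inv hx
  have hγ0 : γ 0 ∈ L := by
    have h0 := (hα 0 (by simp)).1
    rw [hΦ.mem_iff _ (Φ.map_target h0)]
    change (Φ (Φ.symm (α 0, (0 : ℝ) • y))).2 = 0
    rw [Φ.right_inv h0]
    simp
  refine ⟨γ 0, hγ0, ?_⟩
  rw [Manifold.riemannianEDist_comm]
  refine (Manifold.riemannianEDist_le_pathELength hγs rfl hγ1 zero_le_one).trans ?_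
  rw [Manifold.pathELength_eq_lintegral_mfderiv_Ioo]
  have h2 : ∀ t ∈ Set.Ioo (0 : ℝ) 1, ‖mfderiv 𝓘(ℝ, ℝ) (𝓡 n) γ t (1 : ℝ)‖ₑ ≤
      ENNReal.ofReal √(h y y) := by
    intro t ht
    have ht' := Set.Ioo_subset_Icc_self ht
    have h3 : HasDerivAt (fun t : ℝ => (α t, t • y)) (H (α t, t • y) y) t := by
      have h4 := ((hα t ht').2.hasDerivAt (Icc_mem_nhds ht.1 ht.2)).prodMk
        ((hasDerivAt_id t).smul_const y)
      refine h4.congr_deriv (Prod.ext rfl ?_)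
      rw [hH2]
      exact one_smul _ y
    have h5 : HasMFDerivAt 𝓘(ℝ, Euc p × Euc q) (𝓡 n) Φ.symm (α t, t • y)
        (symmDeriv Φ (α t, t • y)) := (hd.symm.mdifferentiableAt (hα t ht').1).hasMFDerivAt
    have h6 := (HasMFDerivAt.comp t h5 h3.hasFDerivAt.hasMFDerivAt).mfderiv
    have h7 : mfderiv 𝓘(ℝ, ℝ) (𝓡 n) γ t (1 : ℝ) =
        symmDeriv Φ (α t, t • y) (H (α t, t • y) y) := by
      refine (DFunLike.congr_fun h6 (1 : ℝ)).trans ?_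
      change symmDeriv Φ (α t, t • y) ((1 : ℝ) • (H (α t, t • y) y)) = _
      rw [one_smul]
    rw [h7, ← ofReal_norm, norm_symmDeriv_lift hH2 hH ht.1 (hα t ht').1]
  refine (MeasureTheory.setLIntegral_mono' measurableSet_Ioo h2).trans ?_
  simp

end SmoothFoliation

namespace SmoothFoliation

set_option maxSynthPendingDepth 3
set_option synthInstance.maxHeartbeats 400000
set_option maxHeartbeats 1000000

variable {n p q : ℕ} {M : Type*} [EMetricSpace M] [ChartedSpace (Euc n) M]
  [RiemannianBundle (fun x : M => TangentSpace (𝓡 n) x)] [IsRiemannianManifold (𝓡 n) M]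
  {F : SmoothFoliation n p q M} {L : Set M} {Φ : OpenPartialHomeomorph M (Euc p × Euc q)}
  {h : Euc q →L[ℝ] Euc q →L[ℝ] ℝ}

/-- In a normal chart, the distance to the leaf is the norm of the transverse coordinate. -/
theorem IsNormalChart.eventually_infEDist_eq (hΦ : F.IsNormalChart L Φ h) {z : M}
    (hz : z ∈ Φ.source) (hzL : z ∈ L) :
    ∀ᶠ x in 𝓝 z, Metric.infEDist x L = ENNReal.ofReal √(h (Φ x).2 (Φ x).2) := by
  obtain ⟨ρ, hρ, hball⟩ := EMetric.mem_nhds_iff.1 (Φ.open_source.mem_nhds hz)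
  filter_upwards [hΦ.eventually_exists_riemannianEDist_le hz hzL,
    Metric.eball_mem_nhds z (ENNReal.half_pos hρ.ne')] with x ⟨y, hy, hxy⟩ hx
  refine le_antisymm ((Metric.infEDist_le_edist_of_mem hy).trans ?_) ?_
  · rwa [IsRiemannianManifold.out (I := 𝓡 n) x y]
  · by_contra! hlt
    have hxz : Metric.infEDist x L < ρ / 2 := (Metric.infEDist_le_edist_of_mem hzL).trans_lt hx
    -- A curve of length less than `ρ / 2`, starting within `ρ / 2` of `z`, does not leave the
    -- chart, so the lower bound for lengths applies.
    obtain ⟨y', hy', hlt'⟩ := Metric.infEDist_lt_iff.1 (lt_min hlt hxz)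
    rw [IsRiemannianManifold.out (I := 𝓡 n) x y'] at hlt'
    obtain ⟨γ, hγ0, hγ1, hγ, hlen, -, -⟩ :=
      Manifold.exists_lt_locally_constant_of_riemannianEDist_lt hlt' zero_lt_one
    have hs : ∀ t ∈ Set.Icc (0 : ℝ) 1, γ t ∈ Φ.source := by
      intro t ht
      refine hball ?_
      have h1 : edist x (γ t) < ρ / 2 := by
        rw [IsRiemannianManifold.out (I := 𝓡 n) x (γ t)]
        refine lt_of_le_of_lt ?_ (hlen.trans_le (min_le_right _ _))
        exact (Manifold.riemannianEDist_le_pathELength hγ.contMDiffOn hγ0 rfl ht.1).trans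
          (Manifold.pathELength_mono le_rfl ht.2)
      calc edist (γ t) z ≤ edist (γ t) x + edist x z := edist_triangle _ _ _
        _ < ρ / 2 + ρ / 2 := by
          refine ENNReal.add_lt_add ?_ hx
          rwa [edist_comm]
        _ = ρ := ENNReal.add_halves ρ
    have h2 := hΦ.sqrt_le_pathELength hγ hs (hγ1 ▸ hy')
    rw [hγ0] at h2
    exact absurd (h2.trans_lt (hlen.trans_le (min_le_left _ _))) (lt_irrefl _)

end SmoothFoliation

/-- A map satisfying Euler's equation is homogeneous of degree one along radial segments, and its
derivative is homogeneous of degree zero. -/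
theorem homogeneous_of_euler {V W : Type*} [NormedAddCommGroup V] [NormedSpace ℝ V]
    [NormedAddCommGroup W] [NormedSpace ℝ W] {G : V → W} {D : Set V}
    (hG : ∀ y ∈ D, DifferentiableAt ℝ G y) (heuler : ∀ y ∈ D, fderiv ℝ G y y = G y) {y : V}
    (hseg : ∀ᶠ y' in 𝓝 y, ∀ s ∈ Set.Ioc (0 : ℝ) 1, s • y' ∈ D) {s : ℝ}
    (hs : s ∈ Set.Ioc (0 : ℝ) 1) :
    G (s • y) = s • G y ∧ fderiv ℝ G (s • y) = fderiv ℝ G y := by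
  have key : ∀ y', (∀ s ∈ Set.Ioc (0 : ℝ) 1, s • y' ∈ D) → G (s • y') = s • G y' := by
    intro y' hy'
    -- Euler's equation says that `t⁻¹ • G (t • y')` has zero derivative; the interval starts at `s
    -- > 0`, away from the origin.
    have hderiv : ∀ t ∈ Set.Icc s 1, HasDerivAt (fun t : ℝ => t⁻¹ • G (t • y')) 0 t := by
      intro t ht
      have ht0 : 0 < t := hs.1.trans_le ht.1
      have htD := hy' t ⟨ht0, ht.2⟩
      have h1 : HasDerivAt (fun t : ℝ => G (t • y')) (fderiv ℝ G (t • y') y') t := by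
        have h2 : HasDerivAt (fun t : ℝ => t • y') y' t := by
          simpa using (hasDerivAt_id t).smul_const y'
        exact (hG _ htD).hasFDerivAt.comp_hasDerivAt t h2
      have h3 := (hasDerivAt_inv ht0.ne').smul h1
      have h4 : t • fderiv ℝ G (t • y') y' = G (t • y') := by
        rw [← map_smul, heuler _ htD]
      refine h3.congr_deriv ?_
      rw [← h4, smul_smul, ← add_smul]
      have : t⁻¹ + -(t ^ 2)⁻¹ * t = 0 := by field_simp; ring
      rw [this, zero_smul]
    have h5 := constant_of_has_deriv_right_zero
      (fun t ht => (hderiv t ht).continuousAt.continuousWithinAt)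
      (fun t ht => (hderiv t (Set.Ico_subset_Icc_self ht)).hasDerivWithinAt) 1 ⟨hs.2, le_rfl⟩
    simp only [inv_one, one_smul] at h5
    rw [h5, smul_smul, mul_inv_cancel₀ hs.1.ne', one_smul]
  have hy := hseg.self_of_nhds
  refine ⟨key y hy, ?_⟩
  have hyD : y ∈ D := by simpa using hy 1 ⟨one_pos, le_rfl⟩
  have h1 : HasFDerivAt (fun y' : V => G (s • y'))
      (fderiv ℝ G (s • y) ∘L (s • ContinuousLinearMap.id ℝ V)) y :=
    ((hG _ (hy s hs)).hasFDerivAt).comp y ((hasFDerivAt_id y).const_smul s)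
  have h2 : HasFDerivAt (fun y' : V => s • G y') (s • fderiv ℝ G y) y :=
    (hG y hyD).hasFDerivAt.const_smul s
  have h3 := h1.unique (h2.congr_of_eventuallyEq (hseg.mono key))
  ext u
  have h4 := DFunLike.congr_fun h3 u
  simp only [ContinuousLinearMap.comp_apply, _root_.smul_apply, ContinuousLinearMap.id_apply,
    map_smul] at h4
  exact smul_right_injective W hs.1.ne' h4

/-! ### Tubular charts and their transitions -/

namespace SmoothFoliation

set_option maxSynthPendingDepth 3
set_option synthInstance.maxHeartbeats 400000
set_option maxHeartbeats 1000000

section Restriction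

variable {n p q : ℕ} {M : Type*} [TopologicalSpace M] [ChartedSpace (Euc n) M]

theorem IsAdapted.restr {F : SmoothFoliation n p q M} {Φ : OpenPartialHomeomorph M (Euc p × Euc q)}
    (h : F.IsAdapted Φ) (s : Set M) : F.IsAdapted (Φ.restr s) where
  smooth := h.smooth.mono fun _ hx => hx.1
  smooth_symm := h.smooth_symm.mono fun _ hx => hx.1
  mem_tangent_iff x hx v := h.mem_tangent_iff x hx.1 v

end Restriction

variable {n p q : ℕ} {M : Type*} [EMetricSpace M] [ChartedSpace (Euc n) M]
  [RiemannianBundle (fun x : M => TangentSpace (𝓡 n) x)]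

/-- An adapted chart onto a product of balls in which the distance to `L` is the `h`-norm of the
transverse coordinate, the gradient of half the square of this distance being projected to the
radial vector field. -/
structure IsTubularChart (F : SmoothFoliation n p q M) (L : Set M)
    (Φ : OpenPartialHomeomorph M (Euc p × Euc q)) (h : Euc q →L[ℝ] Euc q →L[ℝ] ℝ)
    (a : Euc p) (r : ℝ) : Prop where
  adapted : F.IsAdapted Φ
  pos : 0 < r
  target_eq : Φ.target = Metric.ball a r ×ˢ Metric.ball 0 r
  symm : ∀ u v, h u v = h v u
  definite : ∀ u, u ≠ 0 → 0 < h u u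
  gradient : ∀ x ∈ Φ.source, ∃ R : TangentSpace (𝓡 n) x, transverseDeriv Φ x R = (Φ x).2 ∧
      ∀ v : TangentSpace (𝓡 n) x, inner ℝ R v = h (Φ x).2 (transverseDeriv Φ x v)
  infEDist_eq : ∀ x ∈ Φ.source, Metric.infEDist x L = ENNReal.ofReal √(h (Φ x).2 (Φ x).2)

theorem IsNormalChart.exists_isTubularChart [IsRiemannianManifold (𝓡 n) M]
    {F : SmoothFoliation n p q M} {L : Set M}
    {Φ : OpenPartialHomeomorph M (Euc p × Euc q)} {h : Euc q →L[ℝ] Euc q →L[ℝ] ℝ}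
    (hΦ : F.IsNormalChart L Φ h) {z : M} (hz : z ∈ Φ.source) (hzL : z ∈ L) :
    ∃ (Ψ : OpenPartialHomeomorph M (Euc p × Euc q)) (a : Euc p) (r : ℝ),
      F.IsTubularChart L Ψ h a r ∧ z ∈ Ψ.source := by
  have hz0 : Φ z = ((Φ z).1, 0) := Prod.ext rfl ((hΦ.mem_iff z hz).1 hzL)
  have h1 : Filter.Tendsto Φ.symm (𝓝 (Φ z)) (𝓝 z) := by
    have := (Φ.continuousAt_symm (Φ.map_source hz)).tendsto
    rwa [Φ.left_inv hz] at this
  obtain ⟨r, hr, hball⟩ := Metric.mem_nhds_iff.1 (Filter.inter_mem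
    (Φ.open_target.mem_nhds (Φ.map_source hz)) (h1.eventually (hΦ.eventually_infEDist_eq hz hzL)))
  rw [hz0, ← ball_prod_same] at hball
  set a := (Φ z).1
  let O : Set M := Φ.source ∩ Φ ⁻¹' (Metric.ball a r ×ˢ Metric.ball 0 r)
  have hO : IsOpen O := Φ.isOpen_inter_preimage (Metric.isOpen_ball.prod Metric.isOpen_ball)
  have hs : (Φ.restr O).source = O := by
    rw [Φ.restr_source' O hO]
    exact Set.inter_eq_right.2 Set.inter_subset_left
  refine ⟨Φ.restr O, a, r, ⟨hΦ.adapted.restr O, hr, ?_, hΦ.symm, hΦ.pos, fun x hx => ?_,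
    fun x hx => ?_⟩, ?_⟩
  · ext w
    simp only [OpenPartialHomeomorph.restr_target, hO.interior_eq]
    refine ⟨fun hw => ?_, fun hw => ?_⟩
    · have := hw.2.2
      rwa [Set.mem_preimage, Φ.right_inv hw.1] at this
    · have hwt := (hball hw).1
      refine ⟨hwt, Φ.map_target hwt, ?_⟩
      rwa [Set.mem_preimage, Φ.right_inv hwt]
  · exact hΦ.exists_gradient hx.1
  · rw [hs] at hx
    have := (hball hx.2).2
    simp only [Set.mem_ofPred_eq, Φ.left_inv hx.1] at this
    exact this
  · rw [hs]
    refine ⟨hz, ?_⟩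
    rw [Set.mem_preimage, hz0]
    exact ⟨Metric.mem_ball_self hr, Metric.mem_ball_self hr⟩

section Transition

variable {F : SmoothFoliation n p q M} {L : Set M}
  {Φ Ψ : OpenPartialHomeomorph M (Euc p × Euc q)} {h h' : Euc q →L[ℝ] Euc q →L[ℝ] ℝ}
  {a a' : Euc p} {r r' : ℝ}

theorem IsTubularChart.nonneg (hΦ : F.IsTubularChart L Φ h a r) (u : Euc q) : 0 ≤ h u u := by
  rcases eq_or_ne u 0 with rfl | hu
  · simp
  · exact (hΦ.definite u hu).le

/-- Both sides are the squared distance to `L`, which does not depend on the chart. -/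
theorem IsTubularChart.metric_eq (hΦ : F.IsTubularChart L Φ h a r)
    (hΨ : F.IsTubularChart L Ψ h' a' r') {x : M} (hx : x ∈ Φ.source) (hx' : x ∈ Ψ.source) :
    h (Φ x).2 (Φ x).2 = h' (Ψ x).2 (Ψ x).2 := by
  have h1 := hΦ.infEDist_eq x hx
  rw [hΨ.infEDist_eq x hx', ENNReal.ofReal_eq_ofReal_iff (Real.sqrt_nonneg _) (Real.sqrt_nonneg _),
    Real.sqrt_inj (hΨ.nonneg _) (hΦ.nonneg _)] at h1
  exact h1.symm

omit [RiemannianBundle (fun x : M => TangentSpace (𝓡 n) x)] in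
theorem hasMFDerivAt_transverse {Φ : OpenPartialHomeomorph M (Euc p × Euc q)}
    (hd : Φ.MDifferentiable (𝓡 n) 𝓘(ℝ, Euc p × Euc q)) {x : M} (hx : x ∈ Φ.source) :
    HasMFDerivAt (𝓡 n) 𝓘(ℝ, Euc q) (fun x => (Φ x).2) x (transverseDeriv Φ x) :=
  have h1 : HasMFDerivAt (𝓡 n) 𝓘(ℝ, Euc p × Euc q) Φ x _ := (hd.mdifferentiableAt hx).hasMFDerivAt
  have h2 : HasMFDerivAt 𝓘(ℝ, Euc p × Euc q) 𝓘(ℝ, Euc q) (Prod.snd : Euc p × Euc q → Euc q) (Φ x)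
    (ContinuousLinearMap.snd ℝ (Euc p) (Euc q)) := (hasFDerivAt_snd).hasMFDerivAt
  have h3 : HasMFDerivAt (𝓡 n) 𝓘(ℝ, Euc q) (fun x => (Φ x).2) x _ := h2.comp x h1
  h3.mdifferentiableAt.hasMFDerivAt

theorem IsTubularChart.hasMFDerivAt_metric (hΦ : F.IsTubularChart L Φ h a r) {x : M}
    (hx : x ∈ Φ.source) :
    HasMFDerivAt (𝓡 n) 𝓘(ℝ, ℝ) (fun x => h (Φ x).2 (Φ x).2) x
      (((2 : ℝ) • h (Φ x).2) ∘L transverseDeriv Φ x) := by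
  have h1 : HasFDerivAt (fun y : Euc q => h y y) ((2 : ℝ) • h (Φ x).2) (Φ x).2 := by
    refine (h.hasFDerivAt.clm_apply (hasFDerivAt_id _)).congr_fderiv ?_
    ext u
    simp [hΦ.symm u, two_mul]
  exact HasMFDerivAt.comp x h1.hasMFDerivAt (hasMFDerivAt_transverse hΦ.adapted.mdifferentiable hx)

/-- The transition between two tubular charts maps the radial vector field to the radial vector
field. -/
theorem IsTubularChart.transverseDeriv_radial (hΦ : F.IsTubularChart L Φ h a r)
    (hΨ : F.IsTubularChart L Ψ h' a' r') {x : M} (hx : x ∈ Φ.source) (hx' : x ∈ Ψ.source)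
    {v : TangentSpace (𝓡 n) x} (hv : transverseDeriv Φ x v = (Φ x).2) :
    transverseDeriv Ψ x v = (Ψ x).2 := by
  have h1 : (fun x => h (Φ x).2 (Φ x).2) =ᶠ[𝓝 x] fun x => h' (Ψ x).2 (Ψ x).2 := by
    filter_upwards [Φ.open_source.mem_nhds hx, Ψ.open_source.mem_nhds hx'] with x hx hx' using
      hΦ.metric_eq hΨ hx hx'
  have h2 := hasMFDerivAt_unique (hΦ.hasMFDerivAt_metric hx)
    ((hΨ.hasMFDerivAt_metric hx').congr_of_eventuallyEq h1)
  obtain ⟨R, hR, hRi⟩ := hΦ.gradient x hx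
  obtain ⟨R', hR', hRi'⟩ := hΨ.gradient x hx'
  -- Both are the gradient of half the squared distance to `L`. The given `v` differs from it by a
  -- vector tangent to the leaf, which both charts kill.
  have h3 : R = R' := by
    refine ext_inner_right ℝ fun w => ?_
    have h4 := DFunLike.congr_fun h2 w
    rw [hRi, hRi']
    exact smul_right_injective ℝ (two_ne_zero (α := ℝ)) h4
  have h5 : v - R ∈ F.tangent x := by
    rw [hΦ.adapted.mem_tangent_iff x hx, map_sub, hv, hR, sub_self]
  rw [hΨ.adapted.mem_tangent_iff x hx', map_sub, h3, hR'] at h5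
  exact sub_eq_zero.1 h5

omit [RiemannianBundle (fun x : M => TangentSpace (𝓡 n) x)] in
/-- Vectors with the same transverse projection in one adapted chart have the same transverse
projection in any other one. -/
theorem IsAdapted.transverseDeriv_congr (hΦ : F.IsAdapted Φ) (hΨ : F.IsAdapted Ψ) {x : M}
    (hx : x ∈ Φ.source) (hx' : x ∈ Ψ.source) {v w : TangentSpace (𝓡 n) x}
    (hvw : transverseDeriv Φ x v = transverseDeriv Φ x w) :
    transverseDeriv Ψ x v = transverseDeriv Ψ x w := by
  have h1 : v - w ∈ F.tangent x := by
    rw [hΦ.mem_tangent_iff x hx, map_sub, hvw, sub_self]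
  rw [hΨ.mem_tangent_iff x hx', map_sub] at h1
  exact sub_eq_zero.1 h1

end Transition

end SmoothFoliation

/-! ### Smoothness of alternating forms -/

section Alternating

set_option maxSynthPendingDepth 3

variable {W V V' : Type*} [NormedAddCommGroup W] [NormedSpace ℝ W] [NormedAddCommGroup V]
  [NormedSpace ℝ V] [NormedAddCommGroup V'] [NormedSpace ℝ V']

theorem ContDiffOn.continuousAlternatingMap_apply {m : WithTop ℕ∞} {s : Set W} :
    ∀ {k : ℕ} {f : W → V [⋀^Fin k]→L[ℝ] ℝ} {g : W → Fin k → V}, ContDiffOn ℝ m f s →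
      (∀ i, ContDiffOn ℝ m (fun w => g w i) s) → ContDiffOn ℝ m (fun w => f w (g w)) s
  | 0, f, g, hf, _ => by
    have h := ContinuousLinearMap.contDiff (𝕜 := ℝ) (E := V [⋀^Fin 0]→L[ℝ] ℝ) (F := ℝ) (n := m)
      (ContinuousAlternatingMap.apply ℝ V ℝ ![])
    refine (h.comp_contDiffOn hf).congr fun w _ => ?_
    exact congrArg (f w) (Subsingleton.elim _ _)
  | k + 1, f, g, hf, hg => by
    have h := ContinuousLinearMap.contDiff (𝕜 := ℝ) (E := V [⋀^Fin (k + 1)]→L[ℝ] ℝ)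
      (F := V →L[ℝ] V [⋀^Fin k]→L[ℝ] ℝ) (n := m) (ContinuousAlternatingMap.curryLeftCLM V k)
    have h1 := (h.comp_contDiffOn hf).clm_apply (hg 0)
    refine (ContDiffOn.continuousAlternatingMap_apply h1
      (g := fun w i => g w i.succ) fun i => hg i.succ).congr fun w _ => ?_
    change f w (g w) = f w (Matrix.vecCons (g w 0) fun i => g w i.succ)
    congr 1
    exact (Matrix.cons_head_tail (g w)).symm

/-- In finite dimension a form is recovered linearly from its values on tuples of basis vectors. -/
theorem contDiffOn_continuousAlternatingMap_of_apply [FiniteDimensional ℝ V] {m : WithTop ℕ∞}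
    {s : Set W} {k : ℕ} {f : W → V [⋀^Fin k]→L[ℝ] ℝ}
    (hf : ∀ v, ContDiffOn ℝ m (fun w => f w v) s) : ContDiffOn ℝ m f s := by
  let b := Module.finBasis ℝ V
  let L : (V [⋀^Fin k]→L[ℝ] ℝ) →ₗ[ℝ] ((Fin k → Fin (Module.finrank ℝ V)) → ℝ) :=
    { toFun := fun A j => A fun i => b (j i)
      map_add' := fun A B => rfl
      map_smul' := fun c A => rfl }
  have hL : Function.Injective L := by
    intro A B hAB
    have h : A.toMultilinearMap = B.toMultilinearMap := Module.Basis.ext_multilinear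
      (fun _ => b) fun j => congrFun hAB j
    exact ContinuousAlternatingMap.ext fun v => DFunLike.congr_fun h v
  obtain ⟨g, hg⟩ := L.exists_leftInverse_of_injective (LinearMap.ker_eq_bot.2 hL)
  have h1 : ContDiffOn ℝ m (fun w => L (f w)) s := contDiffOn_pi.2 fun j => hf _
  refine ((LinearMap.toContinuousLinearMap g).contDiff.comp_contDiffOn h1).congr fun w _ => ?_
  exact (DFunLike.congr_fun hg (f w)).symm

theorem ContDiffOn.compContinuousLinearMap [FiniteDimensional ℝ V] {m : WithTop ℕ∞}
    {s : Set W} {k : ℕ} {f : W → V' [⋀^Fin k]→L[ℝ] ℝ} {A : W → V →L[ℝ] V'}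
    (hf : ContDiffOn ℝ m f s) (hA : ContDiffOn ℝ m A s) :
    ContDiffOn ℝ m (fun w => (f w).compContinuousLinearMap (A w)) s :=
  contDiffOn_continuousAlternatingMap_of_apply fun _ =>
    hf.continuousAlternatingMap_apply fun _ => hA.clm_apply contDiffOn_const

end Alternating

/-! ### Pullback of forms to and from the manifold -/

namespace FormField

set_option maxSynthPendingDepth 3

variable {n k : ℕ} {M : Type*} [TopologicalSpace M] [ChartedSpace (Euc n) M]
  {E E' : Type*} [NormedAddCommGroup E] [NormedSpace ℝ E] [NormedAddCommGroup E']
  [NormedSpace ℝ E']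

/-- The pullback of a form on `M` by a map from a normed space. -/
def pullback (η : FormField n M k) (f : E → M) (w : E) : E [⋀^Fin k]→L[ℝ] ℝ :=
  (η (f w)).compContinuousLinearMap (mfderiv 𝓘(ℝ, E) (𝓡 n) f w)

theorem pullback_congr (η : FormField n M k) {f g : E → M} {w : E} (h : f =ᶠ[𝓝 w] g) :
    η.pullback f w = η.pullback g w := by
  have h1 : (mfderiv 𝓘(ℝ, E) (𝓡 n) f w : E →L[ℝ] Euc n) = mfderiv 𝓘(ℝ, E) (𝓡 n) g w :=
    h.mfderiv_eq
  have h2 : ∀ x y : M, x = y → (η x : (Euc n) [⋀^Fin k]→L[ℝ] ℝ) = η y := by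
    rintro x _ rfl
    rfl
  change (η (f w) : (Euc n) [⋀^Fin k]→L[ℝ] ℝ).compContinuousLinearMap
    (mfderiv 𝓘(ℝ, E) (𝓡 n) f w : E →L[ℝ] Euc n) =
    (η (g w) : (Euc n) [⋀^Fin k]→L[ℝ] ℝ).compContinuousLinearMap
    (mfderiv 𝓘(ℝ, E) (𝓡 n) g w : E →L[ℝ] Euc n)
  rw [h1, h2 _ _ h.self_of_nhds]
  rfl

theorem pullback_comp (η : FormField n M k) {f : E → M} {T : E' → E} {w : E'}
    (hf : MDifferentiableAt 𝓘(ℝ, E) (𝓡 n) f (T w)) (hT : DifferentiableAt ℝ T w) :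
    η.pullback (f ∘ T) w = (η.pullback f (T w)).compContinuousLinearMap (fderiv ℝ T w) := by
  have h1 := (hf.hasMFDerivAt.comp w hT.hasFDerivAt.hasMFDerivAt).mfderiv
  unfold pullback
  rw [h1]
  rfl

variable [IsManifold (𝓡 n) ∞ M]

theorem contMDiffOn_extChartAt_symm_inf (x₀ : M) :
    ContMDiffOn 𝓘(ℝ, Euc n) (𝓡 n) ∞ (extChartAt (𝓡 n) x₀).symm (extChartAt (𝓡 n) x₀).target :=
  contMDiffOn_extChartAt_symm x₀

/-- Reduces smoothness and exterior derivatives of pullbacks to maps between normed spaces. The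
chart at `f w₀` is the one in which `extD` is computed there, so `extDeriv_pullback` needs no
independence of the chart. -/
theorem eventually_eq_pullback_inChart (η : FormField n M k) {f : E → M} {O : Set E}
    (hO : IsOpen O) (hf : ContMDiffOn 𝓘(ℝ, E) (𝓡 n) ∞ f O) {w₀ : E} (hw₀ : w₀ ∈ O) :
    ∃ O' ⊆ O, IsOpen O' ∧ w₀ ∈ O' ∧ (∀ w ∈ O', f w ∈ (extChartAt (𝓡 n) (f w₀)).source) ∧
      ContDiffOn ℝ ∞ (extChartAt (𝓡 n) (f w₀) ∘ f) O' ∧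
      ∀ w ∈ O', η.pullback f w = (η.inChart (f w₀) (extChartAt (𝓡 n) (f w₀) (f w))
        ).compContinuousLinearMap (fderiv ℝ (extChartAt (𝓡 n) (f w₀) ∘ f) w) := by
  set e := extChartAt (𝓡 n) (f w₀) with he
  have hO' : IsOpen (O ∩ f ⁻¹' e.source) :=
    hf.continuousOn.isOpen_inter_preimage hO (isOpen_extChartAt_source (f w₀))
  have hT : ContDiffOn ℝ ∞ (e ∘ f) (O ∩ f ⁻¹' e.source) := by
    have h1 : ContMDiffOn (𝓡 n) 𝓘(ℝ, Euc n) ∞ e e.source := by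
      rw [he, extChartAt_source]
      exact contMDiffOn_extChartAt
    exact contMDiffOn_iff_contDiffOn.1 (h1.comp (hf.mono Set.inter_subset_left) fun w hw => hw.2)
  refine ⟨O ∩ f ⁻¹' e.source, Set.inter_subset_left, hO', ⟨hw₀, mem_extChartAt_source (f w₀)⟩,
    fun w hw => hw.2, hT, fun w hw => ?_⟩
  have h1 : f =ᶠ[𝓝 w] e.symm ∘ (e ∘ f) := by
    filter_upwards [hO'.mem_nhds hw] with w' hw'
    exact (e.left_inv hw'.2).symm
  rw [η.pullback_congr h1, η.pullback_comp]
  · rfl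
  · exact ((contMDiffOn_extChartAt_symm_inf (f w₀)).contMDiffAt
      ((isOpen_extChartAt_target (f w₀)).mem_nhds (e.map_source hw.2))).mdifferentiableAt (by simp)
  · exact (hT.contDiffAt (hO'.mem_nhds hw)).differentiableAt (by simp)

theorem SmoothOn.contDiffOn_pullback [FiniteDimensional ℝ E] {η : FormField n M k} {U : Set M}
    (hη : η.SmoothOn U) {f : E → M} {O : Set E} (hO : IsOpen O)
    (hf : ContMDiffOn 𝓘(ℝ, E) (𝓡 n) ∞ f O) (hfU : Set.MapsTo f O U) :
    ContDiffOn ℝ ∞ (η.pullback f) O := by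
  intro w₀ hw₀
  obtain ⟨O', hO'O, hO', hw₀', hs, hT, hp⟩ := η.eventually_eq_pullback_inChart hO hf hw₀
  have h1 : ContDiffOn ℝ ∞ (fun w => η.inChart (f w₀) (extChartAt (𝓡 n) (f w₀) (f w))) O' := by
    refine (hη (f w₀)).comp hT fun w hw => ⟨(extChartAt (𝓡 n) (f w₀)).map_source (hs w hw), ?_⟩
    change (extChartAt (𝓡 n) (f w₀)).symm (extChartAt (𝓡 n) (f w₀) (f w)) ∈ U
    rw [(extChartAt (𝓡 n) (f w₀)).left_inv (hs w hw)]
    exact hfU (hO'O hw)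
  have h2 := h1.compContinuousLinearMap (hT.fderiv_of_isOpen hO' (m := ∞) (by simp))
  exact ((h2.congr hp).contDiffAt (hO'.mem_nhds hw₀')).contDiffWithinAt

theorem SmoothOn.extDeriv_pullback {η : FormField n M k} {U : Set M} (hU : IsOpen U)
    (hη : η.SmoothOn U) {f : E → M} {O : Set E} (hO : IsOpen O)
    (hf : ContMDiffOn 𝓘(ℝ, E) (𝓡 n) ∞ f O) {w₀ : E} (hw₀ : w₀ ∈ O) (hfU : f w₀ ∈ U) :
    extDeriv (η.pullback f) w₀ = η.extD.pullback f w₀ := by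
  obtain ⟨O', hO'O, hO', hw₀', hs, hT, hp⟩ := η.eventually_eq_pullback_inChart hO hf hw₀
  set e := extChartAt (𝓡 n) (f w₀) with he
  have h1 : η.pullback f =ᶠ[𝓝 w₀] fun w => (η.inChart (f w₀) ((e ∘ f) w)).compContinuousLinearMap
      (fderiv ℝ (e ∘ f) w) := by
    filter_upwards [hO'.mem_nhds hw₀'] with w hw using hp w hw
  have h2 : DifferentiableAt ℝ (η.inChart (f w₀)) ((e ∘ f) w₀) := by
    have h3 : IsOpen (e.target ∩ e.symm ⁻¹' U) :=
      (continuousOn_extChartAt_symm (f w₀)).isOpen_inter_preimage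
        (isOpen_extChartAt_target (f w₀)) hU
    refine ((hη (f w₀)).contDiffAt (h3.mem_nhds ⟨mem_extChartAt_target (f w₀), ?_⟩)
      ).differentiableAt (by simp)
    change e.symm (e (f w₀)) ∈ U
    rwa [e.left_inv (mem_extChartAt_source (f w₀))]
  have hT' := hT.contDiffAt (hO'.mem_nhds hw₀')
  rw [h1.extDeriv_eq, _root_.extDeriv_pullback h2 hT'
    (by rw [minSmoothness_of_isRCLikeNormedField]; exact WithTop.coe_le_coe.2 le_top)]
  have h4 : HasMFDerivAt 𝓘(ℝ, E) (𝓡 n) f w₀ _ :=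
    ((hf.contMDiffAt (hO.mem_nhds hw₀)).mdifferentiableAt (by simp)).hasMFDerivAt
  have h5 : HasMFDerivAt (𝓡 n) 𝓘(ℝ, Euc n) e (f w₀) _ :=
    (mdifferentiableAt_extChartAt (mem_chart_source _ (f w₀))).hasMFDerivAt
  have h6 : fderiv ℝ (e ∘ f) w₀ = (mfderiv (𝓡 n) 𝓘(ℝ, Euc n) e (f w₀) : Euc n →L[ℝ] Euc n) ∘L
      (mfderiv 𝓘(ℝ, E) (𝓡 n) f w₀ : E →L[ℝ] Euc n) := by
    rw [← mfderiv_eq_fderiv]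
    exact (h5.comp w₀ h4).mfderiv
  rw [h6]
  rfl

/-- The pullback of a form on a normed space by a map defined on `M`. -/
def ofPullback (τ : M → E) (ν : E → E [⋀^Fin k]→L[ℝ] ℝ) : FormField n M k :=
  fun x => (ν (τ x)).compContinuousLinearMap (mfderiv (𝓡 n) 𝓘(ℝ, E) τ x)

theorem inChart_ofPullback {τ : M → E} {ν : E → E [⋀^Fin k]→L[ℝ] ℝ} {x₀ : M} {z : Euc n}
    (hz : z ∈ (extChartAt (𝓡 n) x₀).target)
    (hτ : MDifferentiableAt (𝓡 n) 𝓘(ℝ, E) τ ((extChartAt (𝓡 n) x₀).symm z)) :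
    (ofPullback τ ν : FormField n M k).inChart x₀ z =
      (ν ((τ ∘ (extChartAt (𝓡 n) x₀).symm) z)).compContinuousLinearMap
        (fderiv ℝ (τ ∘ (extChartAt (𝓡 n) x₀).symm) z) := by
  have h1 : HasMFDerivAt 𝓘(ℝ, Euc n) (𝓡 n) (extChartAt (𝓡 n) x₀).symm z _ :=
    (((contMDiffOn_extChartAt_symm_inf x₀).contMDiffAt
      ((isOpen_extChartAt_target x₀).mem_nhds hz)).mdifferentiableAt (by simp)).hasMFDerivAt
  have h2 : fderiv ℝ (τ ∘ (extChartAt (𝓡 n) x₀).symm) z =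
      (mfderiv (𝓡 n) 𝓘(ℝ, E) τ ((extChartAt (𝓡 n) x₀).symm z) : Euc n →L[ℝ] E) ∘L
        (mfderiv 𝓘(ℝ, Euc n) (𝓡 n) (extChartAt (𝓡 n) x₀).symm z : Euc n →L[ℝ] Euc n) := by
    rw [← mfderiv_eq_fderiv]
    exact (hτ.hasMFDerivAt.comp z h1).mfderiv
  rw [h2]
  rfl

theorem contDiffOn_inChart_ofPullback {τ : M → E} {ν : E → E [⋀^Fin k]→L[ℝ] ℝ} {O : Set M}
    (hO : IsOpen O) (hτ : ContMDiffOn (𝓡 n) 𝓘(ℝ, E) ∞ τ O) {V : Set E}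
    (hν : ContDiffOn ℝ ∞ ν V) (hOV : Set.MapsTo τ O V) (x₀ : M) :
    ContDiffOn ℝ ∞ ((ofPullback τ ν : FormField n M k).inChart x₀)
      ((extChartAt (𝓡 n) x₀).target ∩ (extChartAt (𝓡 n) x₀).symm ⁻¹' O) := by
  have hD : IsOpen ((extChartAt (𝓡 n) x₀).target ∩ (extChartAt (𝓡 n) x₀).symm ⁻¹' O) :=
    (continuousOn_extChartAt_symm x₀).isOpen_inter_preimage (isOpen_extChartAt_target x₀) hO
  have hg : ContDiffOn ℝ ∞ (τ ∘ (extChartAt (𝓡 n) x₀).symm)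
      ((extChartAt (𝓡 n) x₀).target ∩ (extChartAt (𝓡 n) x₀).symm ⁻¹' O) :=
    contMDiffOn_iff_contDiffOn.1 (hτ.comp
      ((contMDiffOn_extChartAt_symm_inf x₀).mono Set.inter_subset_left) fun z hz => hz.2)
  have h1 := (hν.comp hg fun z hz => hOV hz.2).compContinuousLinearMap
    (hg.fderiv_of_isOpen hD (m := ∞) (by simp))
  refine h1.congr fun z hz => inChart_ofPullback hz.1 ?_
  exact (hτ.contMDiffAt (hO.mem_nhds hz.2)).mdifferentiableAt (by simp)

theorem extD_ofPullback {τ : M → E} {ν : E → E [⋀^Fin k]→L[ℝ] ℝ} {O : Set M}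
    (hO : IsOpen O) (hτ : ContMDiffOn (𝓡 n) 𝓘(ℝ, E) ∞ τ O) {V : Set E} (hV : IsOpen V)
    (hν : ContDiffOn ℝ ∞ ν V) (hOV : Set.MapsTo τ O V) {x : M} (hx : x ∈ O) :
    (ofPullback τ ν : FormField n M k).extD x = ofPullback τ (extDeriv ν) x := by
  set e := extChartAt (𝓡 n) x with he
  have hex : e.symm (e x) = x := e.left_inv (mem_extChartAt_source x)
  have hD : IsOpen (e.target ∩ e.symm ⁻¹' O) :=
    (continuousOn_extChartAt_symm x).isOpen_inter_preimage (isOpen_extChartAt_target x) hO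
  have hxD : e x ∈ e.target ∩ e.symm ⁻¹' O :=
    ⟨mem_extChartAt_target x, by rw [Set.mem_preimage, hex]; exact hx⟩
  have h1 : (ofPullback τ ν : FormField n M k).inChart x =ᶠ[𝓝 (e x)] fun z =>
      (ν ((τ ∘ e.symm) z)).compContinuousLinearMap (fderiv ℝ (τ ∘ e.symm) z) := by
    filter_upwards [hD.mem_nhds hxD] with z hz
    exact inChart_ofPullback hz.1 ((hτ.contMDiffAt (hO.mem_nhds hz.2)).mdifferentiableAt (by simp))
  have hg : ContDiffOn ℝ ∞ (τ ∘ e.symm) (e.target ∩ e.symm ⁻¹' O) :=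
    contMDiffOn_iff_contDiffOn.1 (hτ.comp
      ((contMDiffOn_extChartAt_symm_inf x).mono Set.inter_subset_left) fun z hz => hz.2)
  have hg' := hg.contDiffAt (hD.mem_nhds hxD)
  have hτx : (τ ∘ e.symm) (e x) = τ x := congrArg τ hex
  have h2 : DifferentiableAt ℝ ν ((τ ∘ e.symm) (e x)) := by
    rw [hτx]
    exact (hν.contDiffAt (hV.mem_nhds (hOV hx))).differentiableAt (by simp)
  have h3 : HasMFDerivAt (𝓡 n) 𝓘(ℝ, Euc n) e x _ :=
    (mdifferentiableAt_extChartAt (mem_chart_source (Euc n) x)).hasMFDerivAt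
  have h4 : HasMFDerivAt 𝓘(ℝ, Euc n) 𝓘(ℝ, E) (τ ∘ e.symm) (e x) _ :=
    (hg'.differentiableAt (by simp)).hasFDerivAt.hasMFDerivAt
  have h5 : τ =ᶠ[𝓝 x] (τ ∘ e.symm) ∘ e := by
    filter_upwards [(isOpen_extChartAt_source (I := 𝓡 n) x).mem_nhds (mem_extChartAt_source (I := 𝓡 n) x)] with y hy
    exact congrArg τ (e.left_inv hy).symm
  have h6 := ((h4.comp x h3).congr_of_eventuallyEq h5).mfderiv
  unfold extD ofPullback
  rw [h6]
  change (extDeriv ((ofPullback τ ν : FormField n M k).inChart x) (e x)).compContinuousLinearMap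
    _ = _
  rw [h1.extDeriv_eq, _root_.extDeriv_pullback h2 hg'
    (by rw [minSmoothness_of_isRCLikeNormedField]; exact WithTop.coe_le_coe.2 le_top), hτx]
  rfl

omit [IsManifold (𝓡 n) ∞ M] in
/-- The exterior derivative only depends on the germ of the form. -/
theorem extD_congr {η θ : FormField n M k} {x : M} (h : ∀ᶠ y in 𝓝 x, η y = θ y) :
    η.extD x = θ.extD x := by
  have h1 : η.inChart x =ᶠ[𝓝 (extChartAt (𝓡 n) x x)] θ.inChart x := by
    have h2 : Filter.Tendsto (extChartAt (𝓡 n) x).symm (𝓝 (extChartAt (𝓡 n) x x)) (𝓝 x) := by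
      have := (continuousAt_extChartAt_symm (I := 𝓡 n) x).tendsto
      rwa [extChartAt_to_inv] at this
    filter_upwards [h2.eventually h] with z hz
    unfold inChart
    rw [hz]
  unfold extD
  rw [h1.extDeriv_eq]

end FormField

/-! ### Closed horizontal forms on a product -/

section HorizontalForms

set_option maxSynthPendingDepth 3

/-- The arguments are replaced one at a time; each replacement adds a term with an argument in `K`.
-/
theorem ContinuousAlternatingMap.congr_of_sub_mem {V : Type*} [NormedAddCommGroup V]
    [NormedSpace ℝ V] {k : ℕ} {A : V [⋀^Fin k]→L[ℝ] ℝ} {K : Set V}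
    (hA : ∀ v i, v i ∈ K → A v = 0) {v v' : Fin k → V} (hv : ∀ i, v' i - v i ∈ K) :
    A v' = A v := by
  have key : ∀ s : Finset (Fin k), A (s.piecewise v' v) = A v := by
    intro s
    induction s using Finset.induction_on with
    | empty => simp
    | insert i s his ih =>
      rw [Finset.piecewise_insert, ← ih]
      set u := s.piecewise v' v with hu
      have h1 : v' i = u i + (v' i - v i) := by
        rw [hu, Finset.piecewise_eq_of_notMem _ _ _ his]
        abel
      rw [h1, A.map_update_add, Function.update_eq_self,
        hA (Function.update u i (v' i - v i)) i (by simpa using hv i), add_zero]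
  have := key Finset.univ
  rwa [Finset.piecewise_univ] at this

variable {P Q : Type} [NormedAddCommGroup P] [NormedSpace ℝ P] [NormedAddCommGroup Q]
  [NormedSpace ℝ Q]

/-- A closed horizontal form on a product is the pullback of a form on the second factor. -/
theorem eq_of_closed_of_horizontal {k : ℕ} {β : P × Q → (P × Q) [⋀^Fin (k + 1)]→L[ℝ] ℝ} {B : Set P}
    {V : Set Q} (hB : IsOpen B) (hB' : IsPreconnected B) (hV : IsOpen V)
    (hβ : DifferentiableOn ℝ β (B ×ˢ V))
    (hhor : ∀ w ∈ B ×ˢ V, ∀ v i, (v i).2 = 0 → β w v = 0)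
    (hd : ∀ w ∈ B ×ˢ V, extDeriv β w = 0) {x x' : P} (hx : x ∈ B) (hx' : x' ∈ B) {y : Q}
    (hy : y ∈ V) {v v' : Fin (k + 1) → P × Q} (hv : ∀ i, (v' i).2 = (v i).2) :
    β (x', y) v' = β (x, y) v := by
  have hO : IsOpen (B ×ˢ V) := hB.prod hV
  have hap : ∀ w ∈ B ×ˢ V, ∀ c, HasFDerivAt (fun w => β w c)
      (ContinuousAlternatingMap.apply ℝ (P × Q) ℝ c ∘L fderiv ℝ β w) w := fun w hw c =>
    (ContinuousAlternatingMap.apply ℝ (P × Q) ℝ c).hasFDerivAt.comp w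
      (hβ.differentiableAt (hO.mem_nhds hw)).hasFDerivAt
  -- Closedness expresses the derivative of `β` in the direction `(e, 0)` through derivatives of
  -- values of `β` having `(e, 0)` as an argument, and these values vanish identically near `w`. So
  -- the coefficients of `β` do not vary along the first factor.
  have h1 : ∀ w ∈ B ×ˢ V, ∀ e : P, ∀ v, fderiv ℝ β w (e, 0) v = 0 := by
    intro w hw e v
    have h2 := ContinuousAlternatingMap.alternatizeUncurryFin_vecCons (fderiv ℝ β w) ((e, 0) : P × Q) v
    have h3 := hd w hw
    rw [extDeriv] at h3
    rw [h3, ContinuousAlternatingMap.coe_zero, Pi.zero_apply] at h2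
    rw [eq_comm, sub_eq_zero] at h2
    rw [h2]
    refine Finset.sum_eq_zero fun i _ => ?_
    have h4 : (fun w => β w (Matrix.vecCons (e, 0) (i.removeNth v))) =ᶠ[𝓝 w] fun _ => 0 := by
      filter_upwards [hO.mem_nhds hw] with w' hw'
      exact hhor w' hw' _ 0 rfl
    have h5 := (hap w hw (Matrix.vecCons (e, 0) (i.removeNth v))).unique
      ((hasFDerivAt_const (0 : ℝ) w).congr_of_eventuallyEq h4)
    have h6 : fderiv ℝ β w (v i) (Matrix.vecCons (e, 0) (i.removeNth v)) = 0 :=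
      DFunLike.congr_fun h5 (v i)
    rw [h6, smul_zero]
  have h2 : β (x', y) v' = β (x', y) v := by
    refine ContinuousAlternatingMap.congr_of_sub_mem (K := {u : P × Q | u.2 = 0})
      (fun v i hi => hhor _ ⟨hx', hy⟩ v i hi) fun i => ?_
    change (v' i - v i).2 = 0
    rw [Prod.snd_sub, hv, sub_self]
  rw [h2]
  have h3 : ∀ x ∈ B, HasFDerivAt (fun x => β (x, y) v)
      ((ContinuousAlternatingMap.apply ℝ (P × Q) ℝ v ∘L fderiv ℝ β (x, y)) ∘L
        ContinuousLinearMap.inl ℝ P Q) x := fun x hx =>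
    HasFDerivAt.comp (g := fun w => β w v) (f := fun x => (x, y)) x (hap (x, y) ⟨hx, hy⟩ v)
      (hasFDerivAt_prodMk_left x y)
  refine hB.is_const_of_fderiv_eq_zero (𝕜 := ℝ) hB' (f := fun x => β (x, y) v)
    (fun x hx => (h3 x hx).differentiableAt.differentiableWithinAt) (fun x hx => ?_) hx' hx
  rw [(h3 x hx).fderiv]
  ext e
  exact h1 (x, y) ⟨hx, hy⟩ e v

theorem radialPrimitive_apply {V : Type} [NormedAddCommGroup V] [NormedSpace ℝ V] {k : ℕ}
    {α : V → V [⋀^Fin (k + 1)]→L[ℝ] ℝ} {O : Set V} (hstar : StarConvex ℝ 0 O)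
    (hα : ContinuousOn α O) {y : V} (hy : y ∈ O) (v : Fin k → V) :
    radialPrimitive α y v = ∫ s in (0 : ℝ)..1, s ^ k • α (s • y) (Matrix.vecCons y v) := by
  have h2 : IntervalIntegrable (fun s : ℝ => s ^ k • α (s • y)) MeasureTheory.volume 0 1 := by
    apply ContinuousOn.intervalIntegrable
    rw [Set.uIcc_of_le zero_le_one]
    exact (by fun_prop : Continuous fun s : ℝ => s ^ k).continuousOn.smul
      (hα.comp (by fun_prop) fun s hs => hstar.smul_mem hy hs.1 hs.2)
  exact ((ContinuousAlternatingMap.apply ℝ V ℝ (Matrix.vecCons y v)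
    ).intervalIntegral_comp_comm h2).symm

end HorizontalForms

/-! ### Primitives in a tubular chart -/

namespace SmoothFoliation

set_option maxSynthPendingDepth 3

variable {n p q k : ℕ} {M : Type*} [EMetricSpace M] [ChartedSpace (Euc n) M]
  [RiemannianBundle (fun x : M => TangentSpace (𝓡 n) x)]
  {F : SmoothFoliation n p q M} {L : Set M}
  {Φ Ψ : OpenPartialHomeomorph M (Euc p × Euc q)} {h h' : Euc q →L[ℝ] Euc q →L[ℝ] ℝ}
  {a a' : Euc p} {r r' ε : ℝ}

/-- The part of the transverse ball of a tubular chart at distance less than `ε` from the leaf. -/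
def tubeBase (h : Euc q →L[ℝ] Euc q →L[ℝ] ℝ) (r ε : ℝ) : Set (Euc q) :=
  Metric.ball 0 r ∩ {y | h y y < ε ^ 2}

theorem isOpen_tubeBase (h : Euc q →L[ℝ] Euc q →L[ℝ] ℝ) (r ε : ℝ) : IsOpen (tubeBase h r ε) :=
  Metric.isOpen_ball.inter (isOpen_lt (by fun_prop) continuous_const)

theorem IsTubularChart.starConvex_tubeBase (hΦ : F.IsTubularChart L Φ h a r) (ε : ℝ) :
    StarConvex ℝ 0 (tubeBase h r ε) := by
  rw [starConvex_zero_iff]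
  intro y hy s hs0 hs1
  refine ⟨?_, ?_⟩
  · have h1 := hy.1
    rw [mem_ball_zero_iff] at h1 ⊢
    rw [norm_smul, Real.norm_of_nonneg hs0]
    exact (mul_le_of_le_one_left (norm_nonneg y) hs1).trans_lt h1
  · have h2 : h y y < ε ^ 2 := hy.2
    change h (s • y) (s • y) < ε ^ 2
    refine lt_of_le_of_lt ?_ h2
    simp only [map_smul, _root_.smul_apply, smul_eq_mul]
    have := hΦ.nonneg y
    nlinarith [mul_nonneg hs0 this, mul_le_of_le_one_left this hs1]

theorem IsTubularChart.mem_thickening_iff (hΦ : F.IsTubularChart L Φ h a r) (hε : 0 < ε) {x : M}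
    (hx : x ∈ Φ.source) : x ∈ Metric.thickening ε L ↔ h (Φ x).2 (Φ x).2 < ε ^ 2 := by
  rw [Metric.mem_thickening_iff_infEDist_lt, hΦ.infEDist_eq x hx,
    ENNReal.ofReal_lt_ofReal_iff hε, Real.sqrt_lt' hε]

theorem IsTubularChart.mem_tubeBase (hΦ : F.IsTubularChart L Φ h a r) (hε : 0 < ε) {x : M}
    (hx : x ∈ Φ.source) (hxU : x ∈ Metric.thickening ε L) : (Φ x).2 ∈ tubeBase h r ε := by
  refine ⟨?_, (hΦ.mem_thickening_iff hε hx).1 hxU⟩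
  have h1 := Φ.map_source hx
  rw [hΦ.target_eq] at h1
  exact h1.2

theorem IsTubularChart.symm_mem_thickening (hΦ : F.IsTubularChart L Φ h a r) (hε : 0 < ε)
    {w : Euc p × Euc q} (hw : w ∈ Φ.target) (hw2 : w.2 ∈ tubeBase h r ε) :
    Φ.symm w ∈ Metric.thickening ε L := by
  rw [hΦ.mem_thickening_iff hε (Φ.map_target hw), Φ.right_inv hw]
  exact hw2.2

/-- The restriction of a form to the transversal through the centre of a tubular chart. -/
def transversalForm (η : FormField n M k) (Φ : OpenPartialHomeomorph M (Euc p × Euc q))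
    (a : Euc p) : Euc q → (Euc q) [⋀^Fin k]→L[ℝ] ℝ :=
  η.pullback fun y => Φ.symm (a, y)

variable [IsManifold (𝓡 n) ∞ M]

omit [IsManifold (𝓡 n) ∞ M] in
theorem IsTubularChart.mem_target (hΦ : F.IsTubularChart L Φ h a r) {b : Euc p}
    (hb : b ∈ Metric.ball a r) {y : Euc q} (hy : y ∈ tubeBase h r ε) : (b, y) ∈ Φ.target := by
  rw [hΦ.target_eq]
  exact ⟨hb, hy.1⟩

omit [IsManifold (𝓡 n) ∞ M] in
theorem IsTubularChart.contMDiffOn_transversal (hΦ : F.IsTubularChart L Φ h a r) :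
    ContMDiffOn 𝓘(ℝ, Euc q) (𝓡 n) ∞ (fun y => Φ.symm (a, y)) (tubeBase h r ε) := by
  have h1 : ContDiff ℝ ∞ (fun y : Euc q => (a, y)) := contDiff_const.prodMk contDiff_id
  exact hΦ.adapted.smooth_symm.comp h1.contMDiff.contMDiffOn fun y hy =>
    hΦ.mem_target (Metric.mem_ball_self hΦ.pos) hy

theorem IsTubularChart.contDiffOn_transversalForm (hΦ : F.IsTubularChart L Φ h a r) (hε : 0 < ε)
    {η : FormField n M k} (hη : η.SmoothOn (Metric.thickening ε L)) :
    ContDiffOn ℝ ∞ (transversalForm η Φ a) (tubeBase h r ε) :=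
  hη.contDiffOn_pullback (isOpen_tubeBase h r ε) hΦ.contMDiffOn_transversal fun _ hy =>
    hΦ.symm_mem_thickening hε (hΦ.mem_target (Metric.mem_ball_self hΦ.pos) hy) hy

theorem IsTubularChart.extDeriv_transversalForm (hΦ : F.IsTubularChart L Φ h a r) (hε : 0 < ε)
    {η : FormField n M k} (hη : η.SmoothOn (Metric.thickening ε L))
    (hd : ∀ x ∈ Metric.thickening ε L, η.extD x = 0) {y : Euc q} (hy : y ∈ tubeBase h r ε) :
    extDeriv (transversalForm η Φ a) y = 0 := by
  have hU := hΦ.symm_mem_thickening hε (hΦ.mem_target (Metric.mem_ball_self hΦ.pos) hy) hy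
  have h1 := hη.extDeriv_pullback Metric.isOpen_thickening (isOpen_tubeBase h r ε)
    hΦ.contMDiffOn_transversal hy hU
  refine h1.trans ?_
  unfold FormField.pullback
  rw [hd _ hU]
  rfl

/-- A closed basic form is determined by its restriction to the transversal. -/
theorem IsTubularChart.apply_eq_transversalForm (hΦ : F.IsTubularChart L Φ h a r) (hε : 0 < ε)
    {η : FormField n M (k + 1)} (hη : η.IsBasicOn F (Metric.thickening ε L))
    (hd : ∀ x ∈ Metric.thickening ε L, η.extD x = 0) {x : M} (hx : x ∈ Φ.source)
    (hxU : x ∈ Metric.thickening ε L) (v : Fin (k + 1) → TangentSpace (𝓡 n) x) :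
    η x v = transversalForm η Φ a (Φ x).2 (fun i => transverseDeriv Φ x (v i)) := by
  have hdiff := hΦ.adapted.mdifferentiable
  have hy := hΦ.mem_tubeBase hε hx hxU
  obtain ⟨w, hw, rfl⟩ : ∃ w ∈ Φ.target, Φ.symm w = x := ⟨Φ x, Φ.map_source hx, Φ.left_inv hx⟩
  rw [Φ.right_inv hw] at hy ⊢
  choose u hu using fun i => exists_symmDeriv_eq hdiff hw (v i)
  have h1 : (fun i => transverseDeriv Φ (Φ.symm w) (v i)) = fun i => (u i).2 := by
    funext i
    rw [← hu i, transverseDeriv_symmDeriv hdiff hw]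
  have h2 : η (Φ.symm w) v = η.pullback Φ.symm w u := by
    have : v = fun i => symmDeriv Φ w (u i) := funext fun i => (hu i).symm
    rw [this]
    rfl
  have hBV : Metric.ball a r ×ˢ tubeBase h r ε ⊆ Φ.target := fun w hw =>
    hΦ.mem_target hw.1 hw.2
  have hO : IsOpen (Metric.ball a r ×ˢ tubeBase h r ε) :=
    Metric.isOpen_ball.prod (isOpen_tubeBase h r ε)
  have hmaps : Set.MapsTo Φ.symm (Metric.ball a r ×ˢ tubeBase h r ε) (Metric.thickening ε L) :=
    fun w hw => hΦ.symm_mem_thickening hε (hBV hw) hw.2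
  have hs := hΦ.adapted.smooth_symm.mono hBV
  have hwb : w.1 ∈ Metric.ball a r := by
    rw [hΦ.target_eq] at hw
    exact hw.1
  -- Being horizontal and closed, the pullback to the product does not depend on the leaf
  -- coordinate, which may be moved to the centre `a`; the leaf components of the arguments may be
  -- dropped.
  have h3 : η.pullback Φ.symm (w.1, w.2) u = η.pullback Φ.symm (a, w.2) fun i => (0, (u i).2) := by
    refine eq_of_closed_of_horizontal Metric.isOpen_ball (convex_ball a r).isPreconnected
      (isOpen_tubeBase h r ε) ((hη.1.contDiffOn_pullback hO hs hmaps).differentiableOn (by simp))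
      (fun w' hw' v' i hi => ?_) (fun w' hw' => ?_) (Metric.mem_ball_self hΦ.pos) hwb hy
      fun i => rfl
    · refine (hη.2 _ (hmaps hw')).1 (fun i => symmDeriv Φ w' (v' i)) i ?_
      rw [hΦ.adapted.mem_tangent_iff _ (Φ.map_target (hBV hw')),
        transverseDeriv_symmDeriv hdiff (hBV hw'), hi]
    · refine (hη.1.extDeriv_pullback Metric.isOpen_thickening hO hs hw' (hmaps hw')).trans ?_
      unfold FormField.pullback
      rw [hd _ (hmaps hw')]
      rfl
  have h4 : transversalForm η Φ a w.2 = (η.pullback Φ.symm (a, w.2)).compContinuousLinearMap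
      (fderiv ℝ (fun y : Euc q => (a, y)) w.2) :=
    η.pullback_comp (f := Φ.symm) (T := fun y : Euc q => (a, y))
      (hdiff.symm.mdifferentiableAt (hΦ.mem_target (Metric.mem_ball_self hΦ.pos) hy))
      (hasFDerivAt_prodMk_right a w.2).differentiableAt
  rw [h1, h2, h4, (hasFDerivAt_prodMk_right a w.2).fderiv]
  exact h3

/-- The primitive of a closed basic form in a tubular chart. -/
def tubularPrimitive (η : FormField n M (k + 1)) (Φ : OpenPartialHomeomorph M (Euc p × Euc q))
    (a : Euc p) : FormField n M k :=
  FormField.ofPullback (fun x => (Φ x).2) (radialPrimitive (transversalForm η Φ a))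

omit [IsManifold (𝓡 n) ∞ M] in
theorem IsTubularChart.contMDiffOn_transverse (hΦ : F.IsTubularChart L Φ h a r) :
    ContMDiffOn (𝓡 n) 𝓘(ℝ, Euc q) ∞ (fun x => (Φ x).2) Φ.source :=
  contDiff_snd.contMDiff.comp_contMDiffOn hΦ.adapted.smooth

theorem IsTubularChart.smoothOn_tubularPrimitive (hΦ : F.IsTubularChart L Φ h a r) (hε : 0 < ε)
    {η : FormField n M (k + 1)} (hη : η.IsBasicOn F (Metric.thickening ε L)) :
    (tubularPrimitive η Φ a).SmoothOn (Φ.source ∩ Metric.thickening ε L) :=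
  FormField.contDiffOn_inChart_ofPullback (Φ.open_source.inter Metric.isOpen_thickening)
    (hΦ.contMDiffOn_transverse.mono Set.inter_subset_left)
    ((hΦ.contDiffOn_transversalForm hε hη.1).radialPrimitive (isOpen_tubeBase h r ε)
      (hΦ.starConvex_tubeBase ε)) fun _ hx => hΦ.mem_tubeBase hε hx.1 hx.2

theorem IsTubularChart.extD_tubularPrimitive (hΦ : F.IsTubularChart L Φ h a r) (hε : 0 < ε)
    {η : FormField n M (k + 1)} (hη : η.IsBasicOn F (Metric.thickening ε L))
    (hd : ∀ x ∈ Metric.thickening ε L, η.extD x = 0) {x : M} (hx : x ∈ Φ.source)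
    (hxU : x ∈ Metric.thickening ε L) : (tubularPrimitive η Φ a).extD x = η x := by
  have hα := hΦ.contDiffOn_transversalForm hε hη.1
  have hstar := hΦ.starConvex_tubeBase ε
  refine (FormField.extD_ofPullback (Φ.open_source.inter Metric.isOpen_thickening)
    (hΦ.contMDiffOn_transverse.mono Set.inter_subset_left) (isOpen_tubeBase h r ε)
    (hα.radialPrimitive (isOpen_tubeBase h r ε) hstar)
    (fun _ hx => hΦ.mem_tubeBase hε hx.1 hx.2) ⟨hx, hxU⟩).trans ?_
  ext v
  rw [hΦ.apply_eq_transversalForm hε hη hd hx hxU]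
  unfold FormField.ofPullback
  rw [extDeriv_radialPrimitive (isOpen_tubeBase h r ε) hstar hα
    (fun y hy => hΦ.extDeriv_transversalForm hε hη.1 hd hy) (hΦ.mem_tubeBase hε hx hxU)]
  rfl

omit [IsManifold (𝓡 n) ∞ M] in
theorem IsTubularChart.horizontalAt_tubularPrimitive (hΦ : F.IsTubularChart L Φ h a r)
    {η : FormField n M (k + 1)} {x : M} (hx : x ∈ Φ.source) :
    (tubularPrimitive η Φ a).HorizontalAt F x := by
  intro v i hi
  rw [hΦ.adapted.mem_tangent_iff x hx] at hi
  change radialPrimitive (transversalForm η Φ a) (Φ x).2 (fun j => transverseDeriv Φ x (v j)) = 0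
  exact ContinuousAlternatingMap.map_coord_zero _ i hi

end SmoothFoliation

/-! ### Agreement of the primitives on overlaps -/

namespace SmoothFoliation

set_option maxSynthPendingDepth 3

section Transition

variable {n p q k : ℕ} {M : Type*} [EMetricSpace M] [ChartedSpace (Euc n) M]
  [RiemannianBundle (fun x : M => TangentSpace (𝓡 n) x)]
  {F : SmoothFoliation n p q M} {L : Set M}
  {Φ Ψ : OpenPartialHomeomorph M (Euc p × Euc q)} {h h' : Euc q →L[ℝ] Euc q →L[ℝ] ℝ}
  {a a' : Euc p} {r r' ε : ℝ}

theorem IsTubularChart.smul_mem_target (hΦ : F.IsTubularChart L Φ h a r) {b : Euc p} {y : Euc q}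
    (hy : (b, y) ∈ Φ.target) {s : ℝ} (hs : s ∈ Set.Icc (0 : ℝ) 1) : (b, s • y) ∈ Φ.target := by
  rw [hΦ.target_eq] at hy ⊢
  refine ⟨hy.1, ?_⟩
  have h1 := hy.2
  rw [mem_ball_zero_iff] at h1 ⊢
  rw [norm_smul, Real.norm_of_nonneg hs.1]
  exact (mul_le_of_le_one_left (norm_nonneg y) hs.2).trans_lt h1

omit [RiemannianBundle (fun x : M => TangentSpace (𝓡 n) x)] in
theorem hasFDerivAt_transition (hΦ : Φ.MDifferentiable (𝓡 n) 𝓘(ℝ, Euc p × Euc q))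
    (hΨ : Ψ.MDifferentiable (𝓡 n) 𝓘(ℝ, Euc p × Euc q)) {b : Euc p} {y : Euc q}
    (hy : (b, y) ∈ Φ.target) (hy' : Φ.symm (b, y) ∈ Ψ.source) :
    HasFDerivAt (fun y => (Ψ (Φ.symm (b, y))).2)
      ((transverseDeriv (n := n) Ψ (Φ.symm (b, y)) ∘L symmDeriv Φ (b, y)) ∘L
        ContinuousLinearMap.inr ℝ (Euc p) (Euc q)) y := by
  have h1 : HasMFDerivAt 𝓘(ℝ, Euc p × Euc q) (𝓡 n) Φ.symm (b, y) (symmDeriv Φ (b, y)) :=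
    (hΦ.symm.mdifferentiableAt hy).hasMFDerivAt
  have h2 := (hasMFDerivAt_transverse hΨ hy').comp (b, y) h1
  exact HasFDerivAt.comp y (g := fun w => (Ψ (Φ.symm w)).2) (f := fun y => (b, y))
    h2.hasFDerivAt (hasFDerivAt_prodMk_right b y)

/-- With the leaf coordinate `b` fixed, the transition sends radial vectors to radial vectors by
`transverseDeriv_radial`; this is Euler's equation for it. -/
theorem IsTubularChart.transition_euler (hΦ : F.IsTubularChart L Φ h a r)
    (hΨ : F.IsTubularChart L Ψ h' a' r') {b : Euc p} {y : Euc q}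
    (hseg : ∀ᶠ y' in 𝓝 y, (b, y') ∈ Φ.target ∧
      ∀ s ∈ Set.Icc (0 : ℝ) 1, Φ.symm (b, s • y') ∈ Ψ.source) {s : ℝ} (hs : s ∈ Set.Ioc (0 : ℝ) 1) :
    (Ψ (Φ.symm (b, s • y))).2 = s • (Ψ (Φ.symm (b, y))).2 ∧
      fderiv ℝ (fun y => (Ψ (Φ.symm (b, y))).2) (s • y) =
        fderiv ℝ (fun y => (Ψ (Φ.symm (b, y))).2) y := by
  have hdΦ := hΦ.adapted.mdifferentiable
  have hdΨ := hΨ.adapted.mdifferentiable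
  refine homogeneous_of_euler (G := fun y => (Ψ (Φ.symm (b, y))).2)
    (D := {y | (b, y) ∈ Φ.target ∧ Φ.symm (b, y) ∈ Ψ.source})
    (fun y' hy' => (hasFDerivAt_transition hdΦ hdΨ hy'.1 hy'.2).differentiableAt)
    (fun y' hy' => ?_) ?_ hs
  · rw [(hasFDerivAt_transition hdΦ hdΨ hy'.1 hy'.2).fderiv]
    refine hΦ.transverseDeriv_radial hΨ (Φ.map_target hy'.1) hy'.2
      (v := symmDeriv Φ (b, y') (0, y')) ?_
    rw [transverseDeriv_symmDeriv hdΦ hy'.1, Φ.right_inv hy'.1]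
  · filter_upwards [hseg] with y' hy' s hs
    exact ⟨hΦ.smul_mem_target hy'.1 ⟨hs.1.le, hs.2⟩, hy'.2 s ⟨hs.1.le, hs.2⟩⟩

variable [IsManifold (𝓡 n) ∞ M]

/-- The primitives constructed in two tubular charts agree on their overlap. -/
theorem IsTubularChart.tubularPrimitive_eq (hΦ : F.IsTubularChart L Φ h a r)
    (hΨ : F.IsTubularChart L Ψ h' a' r') (hε : 0 < ε)
    {η : FormField n M (k + 1)} (hη : η.IsBasicOn F (Metric.thickening ε L))
    (hd : ∀ x ∈ Metric.thickening ε L, η.extD x = 0) {x : M} (hx : x ∈ Φ.source)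
    (hx' : x ∈ Ψ.source) (hxU : x ∈ Metric.thickening ε L)
    (hseg : ∀ᶠ x' in 𝓝 x, ∀ s ∈ Set.Icc (0 : ℝ) 1,
      Φ.symm ((Φ x').1, s • (Φ x').2) ∈ Ψ.source) :
    tubularPrimitive η Φ a x = tubularPrimitive η Ψ a' x := by
  have hdΦ := hΦ.adapted.mdifferentiable
  have hdΨ := hΨ.adapted.mdifferentiable
  have hyΦ := hΦ.mem_tubeBase hε hx hxU
  have hyΨ := hΨ.mem_tubeBase hε hx' hxU
  obtain ⟨⟨b, y⟩, hw, rfl⟩ : ∃ w ∈ Φ.target, Φ.symm w = x :=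
    ⟨Φ x, Φ.map_source hx, Φ.left_inv hx⟩
  rw [Φ.right_inv hw] at hyΦ
  have hseg' : ∀ᶠ y' in 𝓝 y, (b, y') ∈ Φ.target ∧
      ∀ s ∈ Set.Icc (0 : ℝ) 1, Φ.symm (b, s • y') ∈ Ψ.source := by
    have h1 : ContinuousAt (fun y' => (b, y')) y := by fun_prop
    have h2 : ContinuousAt (fun y' => Φ.symm (b, y')) y :=
      ContinuousAt.comp (f := fun y' => (b, y')) (Φ.continuousAt_symm hw) h1
    filter_upwards [h2.eventually hseg, h1.eventually (Φ.open_target.mem_nhds hw)] with y' h3 h4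
    refine ⟨h4, ?_⟩
    simpa only [Φ.right_inv h4] using h3
  set G : Euc q → Euc q := fun y => (Ψ (Φ.symm (b, y))).2 with hG
  have hG' := fun y' (h1 : (b, y') ∈ Φ.target) h2 =>
    (hasFDerivAt_transition (n := n) hdΦ hdΨ h1 h2).fderiv
  ext v
  change radialPrimitive (transversalForm η Φ a) (Φ (Φ.symm (b, y))).2
    (fun i => transverseDeriv Φ (Φ.symm (b, y)) (v i)) =
    radialPrimitive (transversalForm η Ψ a') (G y)
    (fun i => transverseDeriv Ψ (Φ.symm (b, y)) (v i))
  rw [Φ.right_inv hw, radialPrimitive_apply (hΦ.starConvex_tubeBase ε)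
    (hΦ.contDiffOn_transversalForm hε hη.1).continuousOn hyΦ,
    radialPrimitive_apply (hΨ.starConvex_tubeBase ε)
    (hΨ.contDiffOn_transversalForm hε hη.1).continuousOn hyΨ]
  -- The integrands are compared for `s > 0` only, where the transition is known to be homogeneous.
  refine intervalIntegral.integral_congr_ae (Filter.Eventually.of_forall fun s hs => ?_)
  rw [Set.uIoc_of_le zero_le_one] at hs
  have hs' : s ∈ Set.Icc (0 : ℝ) 1 := ⟨hs.1.le, hs.2⟩
  congr 1
  have hwt := hΦ.smul_mem_target hw hs'
  have hwΨ : Φ.symm (b, s • y) ∈ Ψ.source := hseg'.self_of_nhds.2 s hs'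
  have hwU : Φ.symm (b, s • y) ∈ Metric.thickening ε L :=
    hΦ.symm_mem_thickening hε hwt ((hΦ.starConvex_tubeBase ε).smul_mem hyΦ hs.1.le hs.2)
  set c : Fin (k + 1) → Euc q :=
    Matrix.vecCons y fun i => transverseDeriv Φ (Φ.symm (b, y)) (v i) with hc
  -- Both integrands are the value of `η` at `Φ.symm (b, s • y)` on the vectors `V`. Homogeneity of
  -- the transition matches the base points, and the invariance of its derivative under scaling
  -- matches the arguments, the first of which is radial in either chart.
  let V : Fin (k + 1) → TangentSpace (𝓡 n) (Φ.symm (b, s • y)) := fun i =>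
    symmDeriv Φ (b, s • y) (0, c i)
  have h1 := hΦ.apply_eq_transversalForm hε hη hd (Φ.map_target hwt) hwU V
  have h2 := hΨ.apply_eq_transversalForm hε hη hd hwΨ hwU V
  have h3 : (fun i => transverseDeriv Φ (Φ.symm (b, s • y)) (V i)) = c :=
    funext fun i => transverseDeriv_symmDeriv hdΦ hwt _
  obtain ⟨hG1, hG2⟩ := hΦ.transition_euler hΨ hseg' hs
  have h4 : (fun i => transverseDeriv Ψ (Φ.symm (b, s • y)) (V i)) =
      Matrix.vecCons (G y) fun i => transverseDeriv Ψ (Φ.symm (b, y)) (v i) := by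
    have h5 : ∀ u, transverseDeriv Ψ (Φ.symm (b, s • y)) (symmDeriv (n := n) Φ (b, s • y) (0, u)) =
        transverseDeriv Ψ (Φ.symm (b, y)) (symmDeriv (n := n) Φ (b, y) (0, u)) := by
      intro u
      have h6 := DFunLike.congr_fun hG2 u
      rw [hG' _ hwt hwΨ, hG' _ hw hx'] at h6
      exact h6
    funext i
    refine (h5 (c i)).trans ?_
    refine Fin.cases ?_ (fun j => ?_) i
    · exact hΦ.transverseDeriv_radial hΨ (Φ.map_target hw) hx'
        (by rw [transverseDeriv_symmDeriv hdΦ hw, Φ.right_inv hw]; rfl)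
    · exact hΦ.adapted.transverseDeriv_congr hΨ.adapted (Φ.map_target hw) hx'
        (transverseDeriv_symmDeriv hdΦ hw _)
  rw [h3, Φ.right_inv hwt] at h1
  rw [h4, hG1] at h2
  exact h1.symm.trans h2

end Transition

/-! ### Radial segments near the leaf and gluing -/

section Cover

variable {n p q : ℕ} {M : Type*} [EMetricSpace M] [ChartedSpace (Euc n) M]
  [RiemannianBundle (fun x : M => TangentSpace (𝓡 n) x)]
  {F : SmoothFoliation n p q M} {L : Set M}
  {Φ Ψ : OpenPartialHomeomorph M (Euc p × Euc q)} {h : Euc q →L[ℝ] Euc q →L[ℝ] ℝ}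
  {a : Euc p} {r : ℝ}

theorem IsTubularChart.transverse_eq_zero (hΦ : F.IsTubularChart L Φ h a r) {x : M}
    (hx : x ∈ Φ.source) (hxL : x ∈ L) : (Φ x).2 = 0 := by
  by_contra hne
  have h1 := hΦ.infEDist_eq x hx
  rw [Metric.infEDist_zero_of_mem hxL, eq_comm, ENNReal.ofReal_eq_zero] at h1
  exact absurd (Real.sqrt_pos.2 (hΦ.definite _ hne)) (not_lt.2 h1)

/-- At a point of the leaf the segment is constant, so the condition holds near it for parameters
close to each `s`; compactness of `[0, 1]` makes it uniform. -/
theorem IsTubularChart.eventually_segment_mem (hΦ : F.IsTubularChart L Φ h a r) {x : M}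
    (hx : x ∈ Φ.source) (hx' : x ∈ Ψ.source) (hxL : x ∈ L) :
    ∀ᶠ x' in 𝓝 x, ∀ s ∈ Set.Icc (0 : ℝ) 1, Φ.symm ((Φ x').1, s • (Φ x').2) ∈ Ψ.source := by
  refine isCompact_Icc.eventually_forall_of_forall_eventually fun s _ => ?_
  have h0 : ((Φ x).1, s • (Φ x).2) = Φ x := by
    rw [hΦ.transverse_eq_zero hx hxL, smul_zero, ← hΦ.transverse_eq_zero hx hxL]
  have h1 : ContinuousAt (fun z : M × ℝ => Φ z.1) (x, s) :=
    ContinuousAt.comp (f := fun z : M × ℝ => z.1) (Φ.continuousAt hx) continuousAt_fst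
  have h2 : ContinuousAt (fun z : M × ℝ => ((Φ z.1).1, z.2 • (Φ z.1).2)) (x, s) :=
    h1.fst.prodMk (continuousAt_snd.smul h1.snd)
  have h3 : ContinuousAt (fun z : M × ℝ => Φ.symm ((Φ z.1).1, z.2 • (Φ z.1).2)) (x, s) := by
    refine ContinuousAt.comp (f := fun z : M × ℝ => ((Φ z.1).1, z.2 • (Φ z.1).2)) ?_ h2
    rw [h0]
    exact Φ.continuousAt_symm (Φ.map_source hx)
  refine h3.eventually (Ψ.open_source.mem_nhds ?_)
  change Φ.symm ((Φ x).1, s • (Φ x).2) ∈ Ψ.source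
  rw [h0, Φ.left_inv hx]
  exact hx'

end Cover

end SmoothFoliation

theorem FormField.smoothOn_of_local {n k : ℕ} {M : Type*} [TopologicalSpace M]
    [ChartedSpace (Euc n) M] {μ : FormField n M k} {U : Set M}
    (h : ∀ x ∈ U, ∃ θ : FormField n M k, ∃ O, IsOpen O ∧ x ∈ O ∧ θ.SmoothOn O ∧
      ∀ y ∈ O, μ y = θ y) : μ.SmoothOn U := by
  intro x₀ z hz
  obtain ⟨θ, O, hO, hzO, hθ, hμθ⟩ := h _ hz.2
  have hD : IsOpen ((extChartAt (𝓡 n) x₀).target ∩ (extChartAt (𝓡 n) x₀).symm ⁻¹' O) :=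
    (continuousOn_extChartAt_symm x₀).isOpen_inter_preimage (isOpen_extChartAt_target x₀) hO
  have h1 := (hθ x₀).contDiffAt (hD.mem_nhds ⟨hz.1, hzO⟩)
  refine (h1.congr_of_eventuallyEq ?_).contDiffWithinAt
  filter_upwards [hD.mem_nhds ⟨hz.1, hzO⟩] with z' hz'
  unfold FormField.inChart
  rw [hμθ _ hz'.2]

end

theorem proposition2p5 {n p q : ℕ} {M : Type*} [EMetricSpace M] [CompactSpace M]
    [ChartedSpace (Euc n) M] [IsManifold (𝓡 n) ∞ M]
    [RiemannianBundle (fun x : M => TangentSpace (𝓡 n) x)]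
    [IsContMDiffRiemannianBundle (𝓡 n) ∞ (Euc n) (fun x : M => TangentSpace (𝓡 n) x)]
    [IsRiemannianManifold (𝓡 n) M]
    (F : SmoothFoliation n p q M) (hF : F.IsBundleLike)
    (hclosed : ∀ x : M, IsClosed (F.leaf x)) (x₀ : M) :
    ∃ ε₀ : ℝ, 0 < ε₀ ∧ ∀ ε : ℝ, 0 < ε → ε < ε₀ →
      ∀ (k : ℕ) (η : FormField n M (k + 1)),
        η.IsBasicOn F (Metric.thickening ε (F.leaf x₀)) →
        (∀ x ∈ Metric.thickening ε (F.leaf x₀), η.extD x = 0) →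
        ∃ μ : FormField n M k, μ.IsBasicOn F (Metric.thickening ε (F.leaf x₀)) ∧
          ∀ x ∈ Metric.thickening ε (F.leaf x₀), μ.extD x = η x := by
  have : SecondCountableTopology M := EMetric.secondCountable_of_sigmaCompact M
  set L := F.leaf x₀ with hL
  have hLc : IsCompact L := (hclosed x₀).isCompact
  have hne : Nonempty L := ⟨⟨x₀, Relation.ReflTransGen.refl⟩⟩
  -- The smaller sets `O` have closure inside the chart domain. A point of `L` in this closure still
  -- lies in the chart, and near a point of `L` outside it there are no points of `O`; so the
  -- segment condition on points of the sets `O` holds near all of `L`.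
  have hex : ∀ z : L, ∃ (Φ : OpenPartialHomeomorph M (Euc p × Euc q))
      (h : Euc q →L[ℝ] Euc q →L[ℝ] ℝ) (a : Euc p) (r : ℝ) (O : Set M),
      F.IsTubularChart L Φ h a r ∧ IsOpen O ∧ (z : M) ∈ O ∧ closure O ⊆ Φ.source := by
    intro z
    obtain ⟨Φ, h, hΦ, hz⟩ := SmoothFoliation.exists_isNormalChart hF z.2
      (F.isTransverselyIsolatedAt_leaf (hclosed x₀) z.2)
    obtain ⟨Ψ, a, r, hΨ, hz'⟩ := hΦ.exists_isTubularChart hz z.2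
    obtain ⟨C, hC, hCc, hCs⟩ := exists_mem_nhds_isClosed_subset (Ψ.open_source.mem_nhds hz')
    exact ⟨Ψ, h, a, r, interior C, hΨ, isOpen_interior, mem_interior_iff_mem_nhds.2 hC,
      (closure_minimal interior_subset hCc).trans hCs⟩
  choose Φ h a r O hΦ hO hzO hOs using hex
  have hsource : ∀ i, O i ⊆ (Φ i).source := fun i => subset_closure.trans (hOs i)
  obtain ⟨S, hS⟩ := hLc.elim_finite_subcover O hO
    fun z hz => Set.mem_iUnion.2 ⟨⟨z, hz⟩, hzO ⟨z, hz⟩⟩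
  let Seg : L → L → M → Prop := fun i j x => ∀ s ∈ Set.Icc (0 : ℝ) 1,
    (Φ i).symm ((Φ i x).1, s • (Φ i x).2) ∈ (Φ j).source
  -- Points covered by the finite family at which every pair of its charts satisfies the segment
  -- condition of `tubularPrimitive_eq`. This set is a neighbourhood of the compact leaf, hence
  -- contains a tube, whose radius is taken as `ε₀`.
  let Good : Set M := {x | (∃ i ∈ S, x ∈ O i) ∧
    ∀ i ∈ S, ∀ j ∈ S, x ∈ O i → x ∈ O j → Seg i j x}
  have hGood : ∀ x ∈ L, Good ∈ 𝓝 x := by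
    intro x hx
    obtain ⟨i, hi, hxi⟩ := Set.mem_iUnion₂.1 (hS hx)
    refine Filter.inter_mem (Filter.mem_of_superset ((hO i).mem_nhds hxi)
      fun y hy => ⟨i, hi, hy⟩) ?_
    refine (Filter.eventually_all_finset S).2 fun i _ => (Filter.eventually_all_finset S).2
      fun j _ => ?_
    have hout : ∀ i, x ∉ closure (O i) → ∀ᶠ x' in 𝓝 x, x' ∉ O i := fun i hxi => by
      filter_upwards [isClosed_closure.isOpen_compl.mem_nhds hxi] with x' hx' hx''
      exact hx' (subset_closure hx'')
    by_cases hxi : x ∈ closure (O i)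
    · by_cases hxj : x ∈ closure (O j)
      · filter_upwards [(hΦ i).eventually_segment_mem (hOs i hxi) (hOs j hxj) hx]
          with x' hx' _ _ using hx'
      · filter_upwards [hout j hxj] with x' hx' _ hx'' using absurd hx'' hx'
    · filter_upwards [hout i hxi] with x' hx' hx'' using absurd hx'' hx'
  obtain ⟨ε₀, hε₀, hthick⟩ := hLc.exists_thickening_subset_open isOpen_interior
    fun x hx => mem_interior_iff_mem_nhds.2 (hGood x hx)
  refine ⟨ε₀, hε₀, fun ε hε hεε₀ k η hη hd => ?_⟩
  set U := Metric.thickening ε L with hU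
  have hUo : IsOpen U := Metric.isOpen_thickening
  have hUG : U ⊆ Good :=
    ((Metric.thickening_mono hεε₀.le L).trans hthick).trans interior_subset
  have hidx : ∀ x, ∃ i : L, x ∈ U → i ∈ S ∧ x ∈ O i := by
    intro x
    by_cases hx : x ∈ U
    · obtain ⟨i, hi⟩ := (hUG hx).1
      exact ⟨i, fun _ => hi⟩
    · exact ⟨hne.some, fun hx' => absurd hx' hx⟩
  choose idx hidx using hidx
  have hcompat : ∀ i ∈ S, ∀ j ∈ S, ∀ x ∈ U, x ∈ O i → x ∈ O j →
      SmoothFoliation.tubularPrimitive η (Φ i) (a i) x =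
        SmoothFoliation.tubularPrimitive η (Φ j) (a j) x := by
    intro i hi j hj x hx hxi hxj
    refine (hΦ i).tubularPrimitive_eq (hΦ j) hε hη hd (hsource i hxi) (hsource j hxj) hx ?_
    filter_upwards [hUo.mem_nhds hx, (hO i).mem_nhds hxi, (hO j).mem_nhds hxj] with x' h1 h2 h3
    exact (hUG h1).2 i hi j hj h2 h3
  -- The index chosen at `x` may jump, but by `hcompat` the form coincides on each open set `O i ∩
  -- U` with the smooth primitive of the chart `i`.
  let μ : FormField n M k := fun x =>
    SmoothFoliation.tubularPrimitive η (Φ (idx x)) (a (idx x)) x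
  have hμ : ∀ i ∈ S, ∀ x ∈ O i ∩ U, μ x = SmoothFoliation.tubularPrimitive η (Φ i) (a i) x :=
    fun i hi x hx => hcompat _ (hidx x hx.2).1 i hi x hx.2 (hidx x hx.2).2 hx.1
  have hμd : ∀ x ∈ U, μ.extD x = η x := by
    intro x hx
    obtain ⟨hi, hxi⟩ := hidx x hx
    rw [← (hΦ (idx x)).extD_tubularPrimitive hε hη hd (hsource _ hxi) hx]
    refine FormField.extD_congr ?_
    filter_upwards [((hO (idx x)).inter hUo).mem_nhds ⟨hxi, hx⟩] with y hy using hμ _ hi y hy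
  refine ⟨μ, ⟨FormField.smoothOn_of_local fun x hx => ?_, fun x hx => ⟨?_, ?_⟩⟩, hμd⟩
  · obtain ⟨hi, hxi⟩ := hidx x hx
    refine ⟨SmoothFoliation.tubularPrimitive η (Φ (idx x)) (a (idx x)), O (idx x) ∩ U,
      (hO _).inter hUo, ⟨hxi, hx⟩, fun x₁ => ?_, hμ _ hi⟩
    exact ((hΦ (idx x)).smoothOn_tubularPrimitive hε hη x₁).mono fun z hz =>
      ⟨hz.1, hsource _ hz.2.1, hz.2.2⟩
  · intro v i hi
    have h1 := (hΦ (idx x)).horizontalAt_tubularPrimitive (η := η) (hsource _ (hidx x hx).2)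
    exact h1 v i hi
  · intro v i hi
    -- Since `dμ` is `η`, its contraction with leaf directions vanishes.
    rw [hμd x hx]
    exact (hη.2 x hx).1 v i hi
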